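/- **Setting.** Let $G$ be a compact connected Lie group of dimension $m$ with Lie algebra $\mathfrak g$, carrying an $\mathrm{Ad}$-invariant inner product with orthonormal basis $(\epsilon_i)$ and dual basis $(\epsilon^i)$. Let $(A,\alpha)$ be a unital separable $\mathbb Z_2$-graded $G$-C*-algebra that is principal: $\operatorname{span}\{g\mapsto\alpha_g(a)b : a,b\in A\}$ is dense in $C(G,A)$. All commutators of operators below are supercommutators, repeated indices are summed, and $\mathbb{C}\ell_n$ is the Clifford algebra with $n$ odd skew-adjoint anticommuting generators of square $-1$. Fix $n\ge m$ and a separable graded Hilbert space $H$ with a faithful graded unital $*$-representation of $\mathbb{C}\ell_n\mathbin{\widehat\otimes}A$ and a strongly continuous unitary representation $U$ of $G$ by even operators that commute with $\mathbb{C}\ell_n$ and spatially implement $\alpha$. Fix a dense $G$-invariant $*$-subalgebra $\mathcal A\subseteq A$ of $C^1$-vectors, with $\mathcal A^G$ dense in $A^G$, and a sequence $(\phi_k)$ in $\mathcal A^G$ that is an approximate unit of $A$. Fix also: * a vertical metric $\rho$: a positive invertible $\mathrm{Ad}^*(G)$-invariant matrix over $\mathfrak g^*$ that is symmetric and has self-adjoint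 coefficients in the even $G$-fixed part of the centre of $A$. Let $\mathcal M(\rho)$ be the unital $*$-algebra generated by the coefficients of $\sqrt\rho$ and by $\det(\sqrt\rho)^{-1}$; it is required that $\mathcal M(\rho)\mathcal A\subseteq\mathcal A$; * a vertical Clifford action $c:\mathfrak g^*\to\mathbf L(H)$: $\mathbb R$-linear and $G$-equivariant, with odd skew-adjoint values that supercommute with $\mathbb{C}\ell_n$ and $A$ and satisfy $c(\lambda)^2=-\langle\lambda,\rho\lambda\rangle$. Let $\mathbb{C}\ell(\mathfrak g^*;\rho)$ be the $*$-algebra generated by $\mathcal M(\rho)$ and $c(\mathfrak g^*)$. Put $c_0=c\circ\rho^{-1/2}$. Let $V_\rho A$, respectively $V_\rho\mathcal A$, be the span of all $x\,y\,a$ with $x\in\mathbb{C}\ell_m\subseteq\mathbb{C}\ell_n$, $y$ a product of elements of $c_0(\mathfrak g^*)$, and $a\in A$, respectively $a\in\mathcal A$. Let $D_v$ be the closure of $$c(\epsilon^i)\,dU(\epsilon_i)-\tfrac16\langle\epsilon_i,\rho^{-T}[\epsilon_j,\epsilon_k]\rangle\,c(\epsilon^i\epsilon^j\epsilon^k)$$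 on the algebraic vectors of $U$ (the sum of all finite-dimensional invariant subspaces), and give $\operatorname{Dom}D_v$ the graph norm. For a subspace $V\subseteq H$, $\mathcal A\cdot V$ denotes the linear span of $\{a\xi : a\in\mathcal A,\ \xi\in V\}$. **The set $\mathfrak D$.** It consists of all densely defined self-adjoint operators $D$ on $H$ with the following properties. 1. *$n$-multigraded complete $G$-spectral triple.* $D$ is $G$-invariant and $n$-odd (odd and supercommuting with $\mathbb{C}\ell_n$). For $a\in\mathcal A$, $a$ preserves $\operatorname{Dom}D$, $[D,a]$ is bounded and $a(D+i)^{-1}$ is compact. $\sup_k\|[D,\phi_k]\|<\infty$. The subspace $\operatorname{Dom}D\cap\mathcal A\cdot H$ is a core for $D$ and consists of $C^1$-vectors of $U$. 2. *$(\rho,c)$ is a vertical geometry for $D$.* $\mathcal M(\rho)$ and $c(\mathfrak g^*)$ map $\operatorname{Dom}D\cap\mathcal A\cdot H$ into $\operatorname{Dom}D$. On $\operatorname{Dom}D\cap\mathcal A\cdot H$ each of the maps $[D,f]$, $f\in\mathcal M(\rho)$, and $-\tfrac12[D,c(X^\flat)]-dU(X)$, $X\in\mathfrak g$, where $X^\flat=\sum_i\langle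 X,\rho^{-T}\epsilon_i\rangle\epsilon^i$, is locally bounded (its composition with each $a\in\mathcal A$ is bounded), adequate (its supercommutators with the $\phi_k$ are uniformly bounded), and supercommutes with $\mathcal M(\rho)$. 3. *Exactly principal.* $(V_\rho\mathcal A)^G$ is dense in $(V_\rho A)^G$; $(V_\rho A)^{\mathrm{alg}}\cdot H^G$ spans a dense subspace of $H$, where $(V_\rho A)^{\mathrm{alg}}$ is the sum of the finite-dimensional $G$-invariant subspaces of $V_\rho A$; $V_\rho A$ acts faithfully on $H^G$, in the sense that $T\in V_\rho A$ and $T|_{H^G}=0$ imply $T=0$. With $D_h$ the closure of $D-D_v$ on $\operatorname{Dom}D\cap\mathcal A\cdot H$, one has $[D_h,a]\in\overline{A\cdot[D,\mathcal A^G]}$ for $a\in\mathcal A$ and $[D_h,w]\in\overline{V_\rho A\cdot[D_h,(V_\rho\mathcal A)^G]}$ for $w\in V_\rho\mathcal A$ (in particular these supercommutators are bounded). 4. *Gauge-admissible.* $\operatorname{Dom}D\cap\mathcal A\cdot\operatorname{Dom}D_v$ is a core for $D$, and $[D_h,w]\in\overline{V_\rho A\cdot[D,\mathcal A^G]}$ for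 $w\in V_\rho\mathcal A$. **Gauge comparability and the Atiyah space.** $D_1,D_2\in\mathfrak D$ are *gauge-comparable* if $\operatorname{Dom}D_1\cap\operatorname{Dom}D_2\cap\mathcal A\cdot\operatorname{Dom}D_v$ is a joint core for $D_1$, $D_2$ and $D_v$, if on it $(D_1-D_2)a$ extends to an element of $\mathbf L(\operatorname{Dom}D_v,H)$ for every $a\in\mathcal A$, and if $D_1-D_2$ supercommutes there with $\mathbb{C}\ell(\mathfrak g^*;\rho)$ and $\mathcal A^G$. Fix $D_{\mathrm{base}}\in\mathfrak D$. The *Atiyah space* $\mathfrak{At}$ is the set of all $D\in\mathfrak D$ gauge-comparable with $D_{\mathrm{base}}$, with the weak topology of the maps $$\nu_k:\mathfrak{At}\to\mathbf L(\operatorname{Dom}D_v,H),\qquad D\mapsto\overline{(D-D_{\mathrm{base}})\phi_k}\,|_{\operatorname{Dom}D_v},$$ where $\mathbf L(\operatorname{Dom}D_v,H)$ has the norm topology. **Gauge transformations.** A *gauge transformation* of $D\in\mathfrak{At}$ is an even $G$-invariant unitary $S$ on $H$ commuting with $\mathbb{C}\ell_n$, $\mathbb{C}\ell(\mathfrak g^*;\rho)$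 and $A^G$, such that $S\mathcal AS^*=\mathcal A$; $S$ maps $\operatorname{Dom}D\cap\mathcal A\cdot\operatorname{Dom}D_v$ onto itself; $[D,S]a$ extends to an element of $\mathbf L(\operatorname{Dom}D_v,H)$ for every $a\in\mathcal A$; and $[D,S]$ supercommutes with $\mathbb{C}\ell(\mathfrak g^*;\rho)$ and $\mathcal A^G$. **Relative gauge potentials.** A *relative gauge potential* for $D\in\mathfrak{At}$ is an $n$-odd symmetric $G$-invariant operator $\omega$ with domain $\operatorname{Dom}D\cap\mathcal A\cdot\operatorname{Dom}D_v$, supercommuting with $\mathbb{C}\ell(\mathfrak g^*;\rho)$ and $\mathcal A^G$, such that for every $a\in\mathcal A$ the operator $[\omega,a]$ extends to an element of $\overline{A\cdot[D,\mathcal A^G]}$ and $\omega a$ extends to an element of $\mathbf L(\operatorname{Dom}D_v,H)$. **Theorem.** 1. Each relative gauge potential for each $D\in\mathfrak{At}$ extends uniquely to an element of $\mathbf L(\operatorname{Dom}D_v,H)$. The set $\mathfrak{at}$ of these extensions is the same for every $D\in\mathfrak{At}$, and it is an $\mathbb R$-linear subspace of $\mathbf L(\operatorname{Dom}D_v,H)$.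 Its topology defined by the seminorms $\omega\mapsto\|\omega\phi_k\|_{\mathbf L(\operatorname{Dom}D_v,H)}$ is that of the operator norm. 2. The set $\mathfrak G$ of gauge transformations of $D$ is the same for every $D\in\mathfrak{At}$, and it is a subgroup of the unitary group of $H$. It acts on $\mathfrak{At}$ by $(S,D)\mapsto SDS^*$. 3. $\mathfrak{At}$ is a topological $\mathbb R$-affine space modelled on the normed $\mathbb R$-vector space $\mathfrak{at}$, with subtraction $$\Lambda(D_1,D_2)=\overline{D_1-D_2}\,|_{\operatorname{Dom}D_v}.$$ 4. For every $D\in\mathfrak{At}$ the map $\Lambda(\cdot,D):\mathfrak{At}\to\mathfrak{at}$ is a homeomorphism, and it intertwines the gauge action of $\mathfrak G$ on $\mathfrak{At}$ with the isometric $\mathbb R$-affine action of $\mathfrak G$ on $\mathfrak{at}$ given by $$(S,\omega)\mapsto S[D,S^*]+S\omega S^*,$$ the right-hand side being determined by its restriction to $\operatorname{Dom}D$. -/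

import Mathlib

open scoped Manifold ContDiff InnerProductSpace
open Filter Topology

noncomputable section

namespace NCGauge

/-! ### The structure group and its Lie algebra -/

/-- The Lie algebra of the Lie group `G`: the tangent space at the identity, with the bracket of
left-invariant vector fields. -/
abbrev Lie (m : ℕ) (G : Type*) [TopologicalSpace G] [ChartedSpace (EuclideanSpace ℝ (Fin m)) G]
    [Group G] : Type _ :=
  GroupLieAlgebra (𝓡 m) G

/-- The adjoint representation: `Ad g` is the derivative at `1` of `h ↦ g h g⁻¹`. -/
def Ad (m : ℕ) {G : Type*} [TopologicalSpace G] [ChartedSpace (EuclideanSpace ℝ (Fin m)) G]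
    [Group G] (g : G) : Lie m G →ₗ[ℝ] Lie m G :=
  { toFun := fun X => (mfderiv (𝓡 m) (𝓡 m) (fun h : G => g * h * g⁻¹) 1) X
    map_add' := fun X Y => map_add (mfderiv (𝓡 m) (𝓡 m) (fun h : G => g * h * g⁻¹) 1) X Y
    map_smul' := fun s X => map_smul (mfderiv (𝓡 m) (𝓡 m) (fun h : G => g * h * g⁻¹) 1) s X }

/-- The coadjoint representation `(Ad* g) l = l ∘ Ad g⁻¹` on the dual of the Lie algebra. -/
def coAd (m : ℕ) {G : Type*} [TopologicalSpace G] [ChartedSpace (EuclideanSpace ℝ (Fin m)) G]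
    [Group G] (g : G) (l : Module.Dual ℝ (Lie m G)) : Module.Dual ℝ (Lie m G) :=
  l.comp (Ad m g⁻¹)

/-- An `Ad`-invariant inner product on the Lie algebra together with an orthonormal basis: the inner
product is the one for which `ε` is orthonormal, `⟨X, Y⟩ = ∑ i, Xⁱ Yⁱ`. -/
structure InvariantFrame (m : ℕ) (G : Type*) [TopologicalSpace G]
    [ChartedSpace (EuclideanSpace ℝ (Fin m)) G] [Group G] where
  ε : Module.Basis (Fin m) ℝ (Lie m G)
  ad_invariant : ∀ (g : G) (X Y : Lie m G),
    ∑ i, ε.repr (Ad m g X) i * ε.repr (Ad m g Y) i = ∑ i, ε.repr X i * ε.repr Y i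

/-! ### Unital `G`-C*-algebras and vertical metrics -/

/-- A unital, separable, `ℤ/2`-graded C*-algebra `A` with a strongly continuous action of `G` by even
`*`-automorphisms that is principal in the sense of Ellwood. -/
structure PrincipalAlgebra (G A : Type*) [TopologicalSpace G] [Group G] [CStarAlgebra A] where
  separable : TopologicalSpace.SeparableSpace A
  /-- the grading automorphism -/
  gr : A →⋆ₐ[ℂ] A
  gr_gr : ∀ a, gr (gr a) = a
  α : G → A →⋆ₐ[ℂ] A
  α_one : ∀ a, α 1 a = a
  α_mul : ∀ g h a, α (g * h) a = α g (α h a)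
  α_continuous : ∀ a, Continuous fun g => α g a
  α_even : ∀ g a, α g (gr a) = gr (α g a)
  principal : Dense (Submodule.span ℂ
    {f : C(G, A) | ∃ a b : A, ∀ g, f g = α g a * b} : Set C(G, A))

/-- `a` is a fixed point of the `G`-action. -/
def PrincipalAlgebra.Fixed {G A : Type*} [TopologicalSpace G] [Group G] [CStarAlgebra A]
    (P : PrincipalAlgebra G A) (a : A) : Prop :=
  ∀ g, P.α g a = a

section

variable {m : ℕ} {G A : Type*} [TopologicalSpace G] [ChartedSpace (EuclideanSpace ℝ (Fin m)) G]
  [Group G] [CStarAlgebra A]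

/-- For an `A`-valued matrix `M = (⟨εⁱ, M εʲ⟩)`, the matrix coefficient `⟨l, M l'⟩`. -/
def coeff (F : InvariantFrame m G) (M : CStarMatrix (Fin m) (Fin m) A)
    (l l' : Module.Dual ℝ (Lie m G)) : A :=
  ∑ i, ∑ j, ((l (F.ε i) * l' (F.ε j) : ℝ) : ℂ) • M i j

/-- The formal determinant (used for matrices with commuting entries). -/
def formalDet (M : CStarMatrix (Fin m) (Fin m) A) : A :=
  ∑ σ : Equiv.Perm (Fin m),
    ((Equiv.Perm.sign σ : ℤ) : ℂ) • (List.ofFn fun i => M (σ i) i).prod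

variable [PartialOrder A] [StarOrderedRing A]

/-- The square root of a positive element of a C*-algebra, by continuous functional calculus. -/
def posSqrt {C : Type*} [CStarAlgebra C] (a : C) : C := cfc Real.sqrt a

/-- A vertical metric on the unital `G`-C*-algebra `A` (so that `M(A) = A`), as the matrix
`(⟨εⁱ, ρ εʲ⟩)` in the orthonormal basis: a positive invertible element of
`Z(A)^G_even ⊗ End(𝔤*)^G` with symmetric self-adjoint coefficients. -/
structure VerticalMetric (P : PrincipalAlgebra G A) (F : InvariantFrame m G) where
  mat : CStarMatrix (Fin m) (Fin m) A
  even : ∀ i j, P.gr (mat i j) = mat i j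
  central : ∀ i j a, mat i j * a = a * mat i j
  fixed : ∀ i j, P.Fixed (mat i j)
  invariant : ∀ (g : G) (l l' : Module.Dual ℝ (Lie m G)),
    coeff F mat (coAd m g l) (coAd m g l') = coeff F mat l l'
  selfAdjoint : ∀ i j, star (mat i j) = mat i j
  symmetric : ∀ i j, mat i j = mat j i
  nonneg : 0 ≤ mat
  isUnit : IsUnit mat

namespace VerticalMetric

variable {P : PrincipalAlgebra G A} {F : InvariantFrame m G} (ρ : VerticalMetric P F)

/-- The positive square root of `ρ`. -/
def sqrt : CStarMatrix (Fin m) (Fin m) A := posSqrt ρ.mat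

/-- The matrix coefficient `⟨εᵢ, ρ^{-T} εⱼ⟩` of the transposed inverse. -/
def invT (i j : Fin m) : A := (Ring.inverse ρ.mat) j i

/-- `⟨X, ρ^{-T} Y⟩` for `X, Y` in the Lie algebra. -/
def lower (X Y : Lie m G) : A :=
  ∑ i, ∑ j, ((F.ε.repr X i * F.ε.repr Y j : ℝ) : ℂ) • ρ.invT i j

/-- The generalised coefficient algebra: the unital `*`-subalgebra generated by the coefficients
`⟨l, √ρ l'⟩` and by `det(√ρ)⁻¹`. -/
def coeffAlgebra : StarSubalgebra ℂ A :=
  StarAlgebra.adjoin ℂ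
    ({a | ∃ l l', a = coeff F ρ.sqrt l l'} ∪ {Ring.inverse (formalDet ρ.sqrt)})

end VerticalMetric

end

/-! ### Unbounded operators -/

section Operators

variable {H : Type*} [NormedAddCommGroup H] [InnerProductSpace ℂ H]

/-- Value of a partially defined operator, with the value `0` off the domain. -/
def ev (T : H →ₗ.[ℂ] H) (ξ : H) : H :=
  open Classical in if h : ξ ∈ T.domain then T ⟨ξ, h⟩ else 0

/-- The ordered product `∏_{i ∈ I} e i`. -/
def cliffordMonomial {k : ℕ} (e : Fin k → H →L[ℂ] H) (I : Finset (Fin k)) : H →L[ℂ] H :=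
  ((I.sort (· ≤ ·)).map e).prod

/-- `[D, S] ξ` for an even bounded operator `S`. -/
def comm (D : H →ₗ.[ℂ] H) (S : H →L[ℂ] H) (ξ : H) : H := ev D (S ξ) - S (ev D ξ)

/-- `S T S*` for an unbounded operator `T`, with domain `S (Dom T)`. -/
def conj [CompleteSpace H] (S : unitary (H →L[ℂ] H)) (T : H →ₗ.[ℂ] H) : H →ₗ.[ℂ] H where
  domain := T.domain.comap ((star S : unitary (H →L[ℂ] H)) : H →L[ℂ] H).toLinearMap
  toFun := ((S : H →L[ℂ] H).toLinearMap).comp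
    (T.toFun.comp
      ((((star S : unitary (H →L[ℂ] H)) : H →L[ℂ] H).toLinearMap).restrict fun _ hx => hx))

end Operators

/-! ### Equivariant multigraded representations -/

/-- A faithful graded nondegenerate `*`-representation of `ℂl_n ⊗̂ A` on a separable graded Hilbert
space with a strongly continuous unitary representation `U` of `G` by even operators that
supercommute with the multigrading and spatially implement the action. -/
structure EquivariantRep {G A : Type*} [TopologicalSpace G] [Group G] [CStarAlgebra A]
    (P : PrincipalAlgebra G A) (n : ℕ) (H : Type*) [NormedAddCommGroup H] [InnerProductSpace ℂ H]
    [CompleteSpace H] where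
  separable : TopologicalSpace.SeparableSpace H
  /-- the grading operator -/
  γ : H →L[ℂ] H
  γ_star : star γ = γ
  γ_sq : γ * γ = 1
  /-- the generators of the multigrading `ℂl_n` -/
  e : Fin n → H →L[ℂ] H
  e_odd : ∀ i, γ * e i = -(e i * γ)
  e_star : ∀ i, star (e i) = -e i
  e_clifford : ∀ i j, e i * e j + e j * e i = if i = j then -2 else 0
  π : A →⋆ₐ[ℂ] (H →L[ℂ] H)
  π_graded : ∀ a, γ * π a * γ = π (P.gr a)
  e_π : ∀ i a, e i * π a = π (P.gr a) * e i
  faithful : ∀ a : Finset (Fin n) → A,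
    ∑ I, cliffordMonomial e I * π (a I) = 0 → ∀ I, a I = 0
  U : G →* unitary (H →L[ℂ] H)
  U_continuous : ∀ ξ : H, Continuous fun g => (U g : H →L[ℂ] H) ξ
  U_even : ∀ g, (U g : H →L[ℂ] H) * γ = γ * U g
  U_e : ∀ g i, (U g : H →L[ℂ] H) * e i = e i * U g
  U_π : ∀ g a, (U g : H →L[ℂ] H) * π a * star (U g : H →L[ℂ] H) = π (P.α g a)

/-- The data, common to all Dirac operators under consideration, of an `n`-multigraded complete
`G`-spectral triple with vertical geometry `(ρ, c)`: everything except the Dirac operator. -/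
structure Background (m n : ℕ) (G A H : Type*) [TopologicalSpace G]
    [ChartedSpace (EuclideanSpace ℝ (Fin m)) G] [Group G]
    [CStarAlgebra A] [PartialOrder A] [StarOrderedRing A]
    [NormedAddCommGroup H] [InnerProductSpace ℂ H] [CompleteSpace H] where
  P : PrincipalAlgebra G A
  F : InvariantFrame m G
  ρ : VerticalMetric P F
  R : EquivariantRep P n H
  le : m ≤ n
  /-- the differentiable algebra -/
  𝒜 : NonUnitalStarSubalgebra ℂ A
  𝒜_dense : Dense (𝒜 : Set A)
  𝒜_invariant : ∀ g, ∀ a ∈ 𝒜, P.α g a ∈ 𝒜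
  𝒜_C1 : ∀ a ∈ 𝒜, ContMDiff (𝓡 m) 𝓘(ℝ, A) 1 fun g : G => P.α g a
  𝒜_fixed_dense : ∀ a, P.Fixed a → a ∈ closure {b | b ∈ 𝒜 ∧ P.Fixed b}
  /-- the adequate approximate unit -/
  φ : ℕ → A
  φ_mem : ∀ k, φ k ∈ 𝒜
  φ_fixed : ∀ k, P.Fixed (φ k)
  φ_approx : (Filter.map φ atTop).IsApproximateUnit
  /-- the vertical Clifford action -/
  c : Module.Dual ℝ (Lie m G) →ₗ[ℝ] (H →L[ℂ] H)
  c_odd : ∀ l, R.γ * c l = -(c l * R.γ)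
  c_e : ∀ l i, c l * R.e i = -(R.e i * c l)
  c_star : ∀ l, star (c l) = -c l
  c_clifford : ∀ l, c l * c l = -R.π (coeff F ρ.mat l l)
  c_π : ∀ l a, c l * R.π a = R.π (P.gr a) * c l
  c_equivariant : ∀ g l,
    (R.U g : H →L[ℂ] H) * c l * star (R.U g : H →L[ℂ] H) = c (coAd m g l)
  coeff_mul : ∀ f ∈ ρ.coeffAlgebra, ∀ a ∈ 𝒜, f * a ∈ 𝒜 ∧ a * f ∈ 𝒜

namespace Background

variable {m n : ℕ} {G A H : Type*} [TopologicalSpace G]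
  [ChartedSpace (EuclideanSpace ℝ (Fin m)) G] [Group G]
  [CStarAlgebra A] [PartialOrder A] [StarOrderedRing A]
  [NormedAddCommGroup H] [InnerProductSpace ℂ H] [CompleteSpace H]
  (B : Background m n G A H)

/-- The unitary `U_g` as a bounded operator. -/
def u (g : G) : H →L[ℂ] H := (B.R.U g : H →L[ℂ] H)

/-- `c(εⁱ)`. -/
def cε (i : Fin m) : H →L[ℂ] H := B.c (B.F.ε.coord i)

/-- `c(X^♭)`, where `X^♭ = ∑ i, ⟨X, ρ^{-T} εᵢ⟩ εⁱ`. -/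
def cFlat (X : Lie m G) : H →L[ℂ] H :=
  ∑ i, B.R.π (B.ρ.lower X (B.F.ε i)) * B.cε i

/-- `γ S γ`; the supercommutator of an odd operator `T` with `S` is `T S - (γ S γ) T`. -/
def twist (S : H →L[ℂ] H) : H →L[ℂ] H := B.R.γ * S * B.R.γ

/-! ### Vectors of class `C¹`, algebraic vectors, the vertical Dirac operator -/

/-- The `C¹` vectors of the unitary representation. -/
def C1 : Submodule ℂ H where
  carrier := {ξ | ContMDiff (𝓡 m) 𝓘(ℝ, H) 1 fun g : G => B.u g ξ}
  add_mem' {x y} hx hy := by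
    have h : ContMDiff (𝓡 m) 𝓘(ℝ, H) 1 fun g : G => B.u g x + B.u g y :=
      ContMDiff.add (show ContMDiff (𝓡 m) 𝓘(ℝ, H) 1 fun g : G => B.u g x from hx) hy
    have e : (fun g : G => B.u g (x + y)) = fun g : G => B.u g x + B.u g y := by
      funext g; exact map_add _ _ _
    show ContMDiff (𝓡 m) 𝓘(ℝ, H) 1 fun g : G => B.u g (x + y)
    rw [e]; exact h
  zero_mem' := by
    have e : (fun g : G => B.u g (0 : H)) = fun _ => 0 := by
      funext g; exact map_zero _
    show ContMDiff (𝓡 m) 𝓘(ℝ, H) 1 fun g : G => B.u g (0 : H)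
    rw [e]; exact contMDiff_const
  smul_mem' s x hx := by
    have h := (((s • ContinuousLinearMap.id ℂ H).restrictScalars ℝ).contDiff (n := 1)).contMDiff.comp
      (show ContMDiff (𝓡 m) 𝓘(ℝ, H) 1 fun g : G => B.u g x from hx)
    have e : (fun g : G => B.u g (s • x)) =
        ((s • ContinuousLinearMap.id ℂ H).restrictScalars ℝ) ∘ fun g : G => B.u g x := by
      funext g; exact map_smul _ _ _
    show ContMDiff (𝓡 m) 𝓘(ℝ, H) 1 fun g : G => B.u g (s • x)
    rw [e]; exact h

/-- The differential `dU(X) ξ`, the derivative at `1` of `g ↦ U_g ξ` in the direction `X`. -/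
def dU (X : Lie m G) (ξ : H) : H :=
  (mfderiv (𝓡 m) 𝓘(ℝ, H) (fun g : G => B.u g ξ) 1) X

/-- The algebraic vectors of `U`: the (algebraic) sum of all finite-dimensional invariant subspaces,
which is the algebraic direct sum of the isotypical components. -/
def alg : Submodule ℂ H :=
  sSup {W | FiniteDimensional ℂ W ∧ ∀ g, ∀ ξ ∈ W, B.u g ξ ∈ W}

/-- The zeroth-order (cubic) term `(1/6) ⟨εᵢ, ρ^{-T}[εⱼ, εₖ]⟩ c(εⁱ εʲ εᵏ)`. -/
def cubic : H →L[ℂ] H :=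
  (1 / 6 : ℂ) • ∑ i, ∑ j, ∑ k,
    B.R.π (B.ρ.lower (B.F.ε i) ⁅B.F.ε j, B.F.ε k⁆) * (B.cε i * B.cε j * B.cε k)

theorem dU_add (X : Lie m G) {ξ η : H} (hξ : ξ ∈ B.C1) (hη : η ∈ B.C1) :
    B.dU X (ξ + η) = B.dU X ξ + B.dU X η := by
  have h1 : MDifferentiableAt (𝓡 m) 𝓘(ℝ, H) (fun g : G => B.u g ξ) 1 :=
    (show ContMDiff (𝓡 m) 𝓘(ℝ, H) 1 fun g : G => B.u g ξ from hξ).mdifferentiable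
      one_ne_zero 1
  have h2 : MDifferentiableAt (𝓡 m) 𝓘(ℝ, H) (fun g : G => B.u g η) 1 :=
    (show ContMDiff (𝓡 m) 𝓘(ℝ, H) 1 fun g : G => B.u g η from hη).mdifferentiable
      one_ne_zero 1
  have h := (h1.hasMFDerivAt.add h2.hasMFDerivAt).mfderiv
  have e : (fun g : G => B.u g (ξ + η)) = (fun g : G => B.u g ξ) + fun g : G => B.u g η := by
    funext g; simp
  unfold dU
  rw [e]
  exact congrArg (fun L : EuclideanSpace ℝ (Fin m) →L[ℝ] H => L X) h

theorem dU_smul (X : Lie m G) (s : ℂ) {ξ : H} (hξ : ξ ∈ B.C1) :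
    B.dU X (s • ξ) = s • B.dU X ξ := by
  have h1 : MDifferentiableAt (𝓡 m) 𝓘(ℝ, H) (fun g : G => B.u g ξ) 1 :=
    (show ContMDiff (𝓡 m) 𝓘(ℝ, H) 1 fun g : G => B.u g ξ from hξ).mdifferentiable
      one_ne_zero 1
  let L : H →L[ℝ] H := (s • ContinuousLinearMap.id ℂ H).restrictScalars ℝ
  have hL : HasMFDerivAt 𝓘(ℝ, H) 𝓘(ℝ, H) L (B.u 1 ξ) L := L.hasFDerivAt.hasMFDerivAt
  have h := (HasMFDerivAt.comp (1 : G) hL h1.hasMFDerivAt).mfderiv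
  have e : (fun g : G => B.u g (s • ξ)) = L ∘ fun g : G => B.u g ξ := by
    funext g; simp [L]
  unfold dU
  rw [e]
  exact congrArg (fun L : EuclideanSpace ℝ (Fin m) →L[ℝ] H => L X) h

/-- The represented cubic Dirac element `c(εⁱ) dU(εᵢ) - (1/6) ⟨εᵢ, ρ^{-T}[εⱼ, εₖ]⟩ c(εⁱ εʲ εᵏ)` on
algebraic vectors. (Algebraic vectors are automatically `C¹`; the intersection makes this explicit.) -/
def cubicDirac : H →ₗ.[ℂ] H where
  domain := B.alg ⊓ B.C1
  toFun :=
    { toFun := fun ξ => ∑ i, B.cε i (B.dU (B.F.ε i) ξ) - B.cubic ξ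
      map_add' := fun ξ η => by
        simp only [Submodule.coe_add, B.dU_add _ ξ.2.2 η.2.2, map_add, Finset.sum_add_distrib]
        abel
      map_smul' := fun s ξ => by
        simp only [Submodule.coe_smul, B.dU_smul _ s ξ.2.2, map_smul, RingHom.id_apply, smul_sub,
          Finset.smul_sum] }

/-- The vertical Dirac operator. -/
def Dv : H →ₗ.[ℂ] H := B.cubicDirac.closure

/-- The domain of the vertical Dirac operator with its graph norm
`‖ξ‖² = ‖ξ‖²_H + ‖D_v ξ‖²_H`. -/
def VDom : Type _ := B.Dv.domain

instance : AddCommGroup B.VDom := inferInstanceAs (AddCommGroup B.Dv.domain)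
instance : Module ℂ B.VDom := inferInstanceAs (Module ℂ B.Dv.domain)

/-- The inclusion `Dom D_v → H`. -/
def incl : B.VDom →ₗ[ℂ] H := B.Dv.domain.subtype

/-- `ξ ↦ (ξ, D_v ξ)`. -/
def graphMap : B.VDom →ₗ[ℂ] WithLp 2 (H × H) :=
  (WithLp.linearEquiv 2 ℂ (H × H)).symm.toLinearMap.comp (B.incl.prod B.Dv.toFun)

theorem graphMap_injective : Function.Injective B.graphMap := by
  intro x y h
  have h2 := congrArg (fun z : WithLp 2 (H × H) => (WithLp.ofLp z).1) h
  exact Subtype.ext h2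

instance : NormedAddCommGroup B.VDom :=
  NormedAddCommGroup.induced B.VDom (WithLp 2 (H × H)) B.graphMap B.graphMap_injective

instance : NormedSpace ℂ B.VDom := NormedSpace.induced ℂ B.VDom (WithLp 2 (H × H)) B.graphMap

/-- An element of `L(Dom D_v, H)` as a function on `H`, with the value `0` off `Dom D_v`. -/
def evV (T : B.VDom →L[ℂ] H) (ξ : H) : H :=
  open Classical in if h : ξ ∈ B.Dv.domain then T (⟨ξ, h⟩ : B.Dv.domain) else 0

/-- The map `M`, considered on the subspace `V`, extends to the bounded operator `T : Dom D_v → H`. -/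
def ExtendsTo (V : Submodule ℂ H) (M : H → H) (T : B.VDom →L[ℂ] H) : Prop :=
  V ≤ B.Dv.domain ∧ ∀ ξ : B.VDom, B.incl ξ ∈ V → T ξ = M (B.incl ξ)

/-- The extension of `M`, considered on the subspace `V`, to an element of `L(Dom D_v, H)`
(and `0` if there is none). -/
def extension (V : Submodule ℂ H) (M : H → H) : B.VDom →L[ℂ] H :=
  open Classical in if h : ∃ T, B.ExtendsTo V M T then h.choose else 0

/-! ### Spectral triples with vertical geometry -/

/-- `𝒜 · V`. -/
def mulSpace (V : Submodule ℂ H) : Submodule ℂ H :=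
  Submodule.span ℂ {η | ∃ a ∈ B.𝒜, ∃ ξ ∈ V, η = B.R.π a ξ}

/-- `a` belongs to `𝒜^G`. -/
def FixedA (a : A) : Prop := a ∈ B.𝒜 ∧ B.P.Fixed a

/-- The odd operator `T` and the bounded operator `S` satisfy `S Dom T ⊆ Dom T`, and the
supercommutator `[T, S]` extends to the bounded operator `K`. -/
def SupercommIs (T : H →ₗ.[ℂ] H) (S K : H →L[ℂ] H) : Prop :=
  ∀ ξ ∈ T.domain, S ξ ∈ T.domain ∧ ev T (S ξ) - B.twist S (ev T ξ) = K ξ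

/-- The odd map `M`, considered on the subspace `V`, supercommutes with the bounded operator `S`
(which preserves `V`). -/
def Supercommutes (V : Submodule ℂ H) (M : H → H) (S : H →L[ℂ] H) : Prop :=
  ∀ ξ ∈ V, S ξ ∈ V ∧ M (S ξ) = B.twist S (M ξ)

/-- `T` is `n`-odd: it is odd and supercommutes with the multigrading. -/
def NOdd (T : H →ₗ.[ℂ] H) : Prop :=
  (∀ ξ ∈ T.domain, B.R.γ ξ ∈ T.domain ∧ ev T (B.R.γ ξ) = -B.R.γ (ev T ξ)) ∧
    ∀ i, B.Supercommutes T.domain (ev T) (B.R.e i)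

/-- `T` is `G`-invariant. -/
def GInvariant (T : H →ₗ.[ℂ] H) : Prop :=
  ∀ g, ∀ ξ ∈ T.domain, B.u g ξ ∈ T.domain ∧ ev T (B.u g ξ) = B.u g (ev T ξ)

/-- The map `M` on the subspace `V` is locally bounded (each `M a`, `a ∈ 𝒜`, extends to a bounded
operator), adequate (`sup_k ‖[M, φ_k]‖ < ∞`, where `tw` is `S ↦ γ S γ` for odd `M` and `id` for even
`M`), and supercommutes with the coefficient algebra. -/
def LocBddAdequate (V : Submodule ℂ H) (M : H → H) (tw : (H →L[ℂ] H) → H →L[ℂ] H) : Prop :=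
  (∀ a ∈ B.𝒜, ∃ K : H →L[ℂ] H, ∀ ξ ∈ V, B.R.π a ξ ∈ V ∧ M (B.R.π a ξ) = K ξ) ∧
  (∃ C : ℝ, ∀ k, ∀ ξ ∈ V,
    ‖M (B.R.π (B.φ k) ξ) - tw (B.R.π (B.φ k)) (M ξ)‖ ≤ C * ‖ξ‖) ∧
  ∀ f ∈ B.ρ.coeffAlgebra, ∀ ξ ∈ V, B.R.π f ξ ∈ V ∧ M (B.R.π f ξ) = B.R.π f (M ξ)

/-- `(𝒜, H, D; U)` is an `n`-multigraded complete `G`-spectral triple with adequate approximate unit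
`φ`. -/
structure IsSpectralTriple (D : H →ₗ.[ℂ] H) : Prop where
  dense : Dense (D.domain : Set H)
  selfAdjoint : IsSelfAdjoint D
  nodd : B.NOdd D
  lipschitz : ∀ a ∈ B.𝒜, ∃ K, B.SupercommIs D (B.R.π a) K
  resolvent : ∃ Q : H →L[ℂ] H,
    (∀ η, Q η ∈ D.domain ∧ ev D (Q η) + Complex.I • Q η = η) ∧
    ∀ a ∈ B.𝒜, IsCompactOperator (B.R.π a * Q)
  complete : ∃ C : ℝ, ∀ k, ∃ K, B.SupercommIs D (B.R.π (B.φ k)) K ∧ ‖K‖ ≤ C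
  invariant : B.GInvariant D
  core : D.HasCore (D.domain ⊓ B.mulSpace ⊤)
  C1 : D.domain ⊓ B.mulSpace ⊤ ≤ B.C1

/-- `μ(X) = -(1/2) [D, c(X^♭)] - dU(X)`. -/
def moment (D : H →ₗ.[ℂ] H) (X : Lie m G) (ξ : H) : H :=
  -(1 / 2 : ℂ) • (ev D (B.cFlat X ξ) + B.cFlat X (ev D ξ)) - B.dU X ξ

/-- `(ρ, c)` is a vertical geometry for `(𝒜, H, D; U)`. -/
structure IsVerticalGeometry (D : H →ₗ.[ℂ] H) : Prop where
  coeff_dom : ∀ f ∈ B.ρ.coeffAlgebra, ∀ ξ ∈ D.domain ⊓ B.mulSpace ⊤, B.R.π f ξ ∈ D.domain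
  coeff_comm : ∀ f ∈ B.ρ.coeffAlgebra, B.LocBddAdequate (D.domain ⊓ B.mulSpace ⊤)
    (fun ξ => ev D (B.R.π f ξ) - B.R.π f (ev D ξ)) B.twist
  clifford_dom : ∀ l, ∀ ξ ∈ D.domain ⊓ B.mulSpace ⊤, B.c l ξ ∈ D.domain
  moment_bdd : ∀ X, B.LocBddAdequate (D.domain ⊓ B.mulSpace ⊤) (B.moment D X) id

/-! ### Principal and gauge-admissible triples -/

/-- `c₀(εʲ)`, where `c₀(l) = ⟨ρ^{-1/2} l, εᵢ⟩ c(εⁱ)`. -/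
def c₀ (j : Fin m) : H →L[ℂ] H :=
  ∑ i, B.R.π ((Ring.inverse B.ρ.sqrt) i j) * B.cε i

/-- The image in `L(H)` of `ℂl_m ⊗̂ ℂl(𝔤*) ⊗̂ 𝒮` for a set `𝒮 ⊆ A`. For `𝒮 = A` this is the
(faithfully represented) vertical algebra, for `𝒮 = 𝒜` the differentiable vertical algebra. -/
def vertical (𝒮 : Set A) : Submodule ℂ (H →L[ℂ] H) :=
  Submodule.span ℂ {T | ∃ I J : Finset (Fin m), ∃ a ∈ 𝒮,
    T = cliffordMonomial (fun i => B.R.e (Fin.castLE B.le i)) I * cliffordMonomial B.c₀ J * B.R.π a}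

/-- The vertical algebra `V_ρ A` in `L(H)`. -/
def VA : Submodule ℂ (H →L[ℂ] H) := B.vertical Set.univ

/-- The differentiable vertical algebra `V_ρ 𝒜` in `L(H)`. -/
def V𝒜 : Submodule ℂ (H →L[ℂ] H) := B.vertical (B.𝒜 : Set A)

/-- `T` is fixed by the conjugation action of `G`. -/
def FixedOp (T : H →L[ℂ] H) : Prop := ∀ g, B.u g * T * star (B.u g) = T

/-- The algebraic vectors of the `G`-C*-algebra `V_ρ A`. -/
def VAalg : Submodule ℂ (H →L[ℂ] H) :=
  sSup {W | W ≤ B.VA ∧ FiniteDimensional ℂ W ∧ ∀ g, ∀ T ∈ W, B.u g * T * star (B.u g) ∈ W}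

/-- The horizontal Dirac operator for the zero remainder: the closure of `D - D_v` on
`Dom D ∩ 𝒜 · H`. -/
def Dh (D : H →ₗ.[ℂ] H) : H →ₗ.[ℂ] H :=
  ((D - B.Dv).domRestrict (D.domain ⊓ B.mulSpace ⊤)).closure

/-- The norm closure of `A · [D, 𝒜^G]`. -/
def oneForms (D : H →ₗ.[ℂ] H) : Submodule ℂ (H →L[ℂ] H) :=
  (Submodule.span ℂ {T | ∃ (a b : A) (K : H →L[ℂ] H),
    B.FixedA b ∧ B.SupercommIs D (B.R.π b) K ∧ T = B.R.π a * K}).topologicalClosure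

/-- The norm closure of `V_ρ A · [D, 𝒜^G]`. -/
def verticalOneForms (D : H →ₗ.[ℂ] H) : Submodule ℂ (H →L[ℂ] H) :=
  (Submodule.span ℂ {T | ∃ w ∈ B.VA, ∃ (b : A) (K : H →L[ℂ] H),
    B.FixedA b ∧ B.SupercommIs D (B.R.π b) K ∧ T = w * K}).topologicalClosure

/-- The norm closure of `V_ρ A · [T, (V_ρ 𝒜)^G]`. -/
def verticalOneFormsV (T : H →ₗ.[ℂ] H) : Submodule ℂ (H →L[ℂ] H) :=
  (Submodule.span ℂ {S | ∃ w ∈ B.VA, ∃ η ∈ B.V𝒜, ∃ K : H →L[ℂ] H,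
    B.FixedOp η ∧ B.SupercommIs T η K ∧ S = w * K}).topologicalClosure

/-- The subspace `H^G`. -/
def HG : Set H := {ξ | ∀ g, B.u g ξ = ξ}

/-- `(𝒜, H, D; U)` is exactly principal, i.e. principal with respect to `(ρ, c)` and the remainder
`0`. -/
structure IsExactlyPrincipal (D : H →ₗ.[ℂ] H) : Prop where
  fixed_dense : ∀ T ∈ B.VA, B.FixedOp T → T ∈ closure {S | S ∈ B.V𝒜 ∧ B.FixedOp S}
  generates : Dense (Submodule.span ℂ {η | ∃ T ∈ B.VAalg, ∃ ξ ∈ B.HG, η = T ξ} : Set H)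
  faithful : ∀ T ∈ B.VA, (∀ ξ ∈ B.HG, T ξ = 0) → T = 0
  horizontal : ∀ a ∈ B.𝒜, ∃ K ∈ B.oneForms D, B.SupercommIs (B.Dh D) (B.R.π a) K
  horizontal_vertical : ∀ w ∈ B.V𝒜, ∃ K ∈ B.verticalOneFormsV (B.Dh D),
    B.SupercommIs (B.Dh D) w K

/-- `Dom D ∩ 𝒜 · Dom D_v`. -/
def smoothDom (D : H →ₗ.[ℂ] H) : Submodule ℂ H := D.domain ⊓ B.mulSpace B.Dv.domain

/-- `D` belongs to the set `𝔇`: `(𝒜, H, D; U)` is an `n`-multigraded gauge-admissible exactly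
principal `G`-spectral triple with vertical geometry `(ρ, c)` and adequate approximate unit `φ`. -/
structure IsAdmissible (D : H →ₗ.[ℂ] H) : Prop where
  triple : B.IsSpectralTriple D
  geometry : B.IsVerticalGeometry D
  principal : B.IsExactlyPrincipal D
  core : D.HasCore (B.smoothDom D)
  admissible : ∀ w ∈ B.V𝒜, ∃ K ∈ B.verticalOneForms D, B.SupercommIs (B.Dh D) w K

/-! ### The Atiyah space, the gauge group, relative gauge potentials -/

/-- The image in `L(H)` of the Clifford algebra `ℂl(𝔤*; ρ)`, generated by the coefficient algebra
and by `c(𝔤*)`. -/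
def clifford : StarSubalgebra ℂ (H →L[ℂ] H) :=
  StarAlgebra.adjoin ℂ ({T | ∃ f ∈ B.ρ.coeffAlgebra, T = B.R.π f} ∪ Set.range B.c)

/-- `Dom D₁ ∩ Dom D₂ ∩ 𝒜 · Dom D_v`. -/
def jointDom (D₁ D₂ : H →ₗ.[ℂ] H) : Submodule ℂ H :=
  D₁.domain ⊓ D₂.domain ⊓ B.mulSpace B.Dv.domain

/-- The odd map `M`, considered on the subspace `V`, supercommutes with `ℂl(𝔤*; ρ)` and `𝒜^G`. -/
def SupercommutesBase (V : Submodule ℂ H) (M : H → H) : Prop :=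
  (∀ S ∈ B.clifford, B.Supercommutes V M S) ∧ ∀ b, B.FixedA b → B.Supercommutes V M (B.R.π b)

/-- Gauge comparability. -/
structure GaugeComparable (D₁ D₂ : H →ₗ.[ℂ] H) : Prop where
  core₁ : D₁.HasCore (B.jointDom D₁ D₂)
  core₂ : D₂.HasCore (B.jointDom D₁ D₂)
  core_vertical : B.Dv.HasCore (B.jointDom D₁ D₂)
  bounded : ∀ a ∈ B.𝒜, ∃ T, B.ExtendsTo (B.jointDom D₁ D₂)
    (fun ξ => ev D₁ (B.R.π a ξ) - ev D₂ (B.R.π a ξ)) T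
  supercommutes : B.SupercommutesBase (B.jointDom D₁ D₂) fun ξ => ev D₁ ξ - ev D₂ ξ

/-- The Atiyah space of the base point `D₀`: its gauge comparability class in `𝔇`. -/
def Atiyah (D₀ : H →ₗ.[ℂ] H) : Type _ :=
  {D : H →ₗ.[ℂ] H // B.IsAdmissible D ∧ B.GaugeComparable D₀ D}

/-- The map `ν_k`, sending `D` to the restriction to `Dom D_v` of the closure of `(D - D₀) φ_k`. -/
def ν (D₀ : H →ₗ.[ℂ] H) (k : ℕ) (D : B.Atiyah D₀) : B.VDom →L[ℂ] H :=
  B.extension (B.jointDom D.1 D₀)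
    fun ξ => ev D.1 (B.R.π (B.φ k) ξ) - ev D₀ (B.R.π (B.φ k) ξ)

/-- The weak topology induced by the maps `ν_k`, with the norm topology on `L(Dom D_v, H)`. -/
instance (D₀ : H →ₗ.[ℂ] H) : TopologicalSpace (B.Atiyah D₀) :=
  ⨅ k, TopologicalSpace.induced (B.ν D₀ k) inferInstance

/-- `S` is a gauge transformation of `D`. -/
structure IsGaugeTransformation (D : H →ₗ.[ℂ] H) (S : unitary (H →L[ℂ] H)) : Prop where
  even : (S : H →L[ℂ] H) * B.R.γ = B.R.γ * S
  invariant : ∀ g, (S : H →L[ℂ] H) * B.u g = B.u g * S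
  multigrading : ∀ i, (S : H →L[ℂ] H) * B.R.e i = B.R.e i * S
  clifford : ∀ T ∈ B.clifford, (S : H →L[ℂ] H) * T = T * S
  fixed : ∀ a, B.P.Fixed a → (S : H →L[ℂ] H) * B.R.π a = B.R.π a * S
  algebra : {T | ∃ a ∈ B.𝒜, T = (S : H →L[ℂ] H) * B.R.π a * star (S : H →L[ℂ] H)} =
    {T | ∃ a ∈ B.𝒜, T = B.R.π a}
  dom : (B.smoothDom D).map (S : H →L[ℂ] H).toLinearMap = B.smoothDom D
  bounded : ∀ a ∈ B.𝒜, ∃ T, B.ExtendsTo (B.smoothDom D)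
    (fun ξ => comm D S (B.R.π a ξ)) T
  supercommutes : B.SupercommutesBase (B.smoothDom D) (comm D S)

/-- `θ` is a relative gauge potential for `D`. -/
structure IsRelGaugePotential (D θ : H →ₗ.[ℂ] H) : Prop where
  domain_eq : θ.domain = B.smoothDom D
  nodd : B.NOdd θ
  symmetric : ∀ ξ ∈ θ.domain, ∀ η ∈ θ.domain, ⟪ev θ ξ, η⟫_ℂ = ⟪ξ, ev θ η⟫_ℂ
  invariant : B.GInvariant θ
  supercommutes : B.SupercommutesBase θ.domain (ev θ)
  commutator : ∀ a ∈ B.𝒜, ∃ K ∈ B.oneForms D, B.SupercommIs θ (B.R.π a) K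
  bounded : ∀ a ∈ B.𝒜, ∃ T, B.ExtendsTo θ.domain (fun ξ => ev θ (B.R.π a ξ)) T

end Background

end NCGauge

end

noncomputable section

namespace NCGauge

/-! ### Partially defined operators: cores, closability, self-adjointness and the continuity method.
-/

section UnboundedOperators

variable {H : Type*} [NormedAddCommGroup H] [InnerProductSpace ℂ H]

/-! Since `A` is unital, an approximate unit converges to `1` in norm, so some `φ_k` is an
invertible element `φu` of `𝒜^G` (`exists_isUnit_φ`). Hence `𝒜 · H = H`, the resolvent of `D` is
compact, `Dom D` consists of `C¹` vectors, and local boundedness of a map that supercommutes with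
`𝒜^G` is plain boundedness on `Dom D_v`.

Domains. The spectral projections of `Q Q*`, `Q = (D + i)⁻¹`, have finite rank, commute with `U`,
map into `Dom D` and converge strongly to `1`. They approximate each `C¹` vector by algebraic
vectors together with its vertical derivatives. Therefore `C¹` vectors lie in `Dom D_v`
(`IsAdmissible.C1_le`), `Dom D` is a core for `D_v` (`IsAdmissible.hasCore_Dv`), and `Dom D ∩ 𝒜 ·
Dom D_v` is `Dom D`.

Estimate. The moment map `μ(X) = -½[D, c(X^♭)] - dU(X)` is bounded. Pairing this identity with
`dU(X)ξ`, and moving `dU(X)` past `D` by symmetry and invariance, gives `‖dU(X)ξ‖ ≤ C(‖Dξ‖ + ‖ξ‖)`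
(`IsAdmissible.dU_bound`). The constant serves every symmetric invariant operator with the same
domain and the same anticommutator with `c(X^♭)`. So each `T` in `L(Dom D_v, H)` is relatively
bounded with respect to `D`, and uniformly with respect to all `D + tT` when `T` is a relative gauge
potential.

Torsor. Gauge-comparable operators consequently have equal domains (`GaugeComparable.domain_eq`),
and `D + T` is self-adjoint by the continuity method (`IsShift.isSelfAdjoint`). Since `T`
supercommutes with the Clifford algebra and `𝒜^G`, passing to `D + T` changes neither `[D, b]` for
`b ∈ 𝒜^G`, nor the one-forms, nor the moment map, and the remaining axioms follow
(`IsShift.isAdmissible`). Conversely, if `E` is comparable with `D`, then `[E - D, a] = [E_h, a] -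
[D_h, a]` because `D_v` cancels, and exact principality makes this a one-form
(`GaugeComparable.exists_isShift`). Thus `E ↦ E - D` is a bijection onto the potentials, which do
not depend on `D`. The seminorm of `φu` alone recovers the norm, because `T = gr(φu)⁻¹ (T φu)`.

Gauge group. A gauge transformation `S` commutes with `U` and the Clifford algebra, hence with
`D_v`, so it is isometric on `Dom D_v`. The difference `S D S* - D = S[D, S*]` is a potential
(`IsGauge.exists_isShift`), and `S D S* - S E S* = S(D - E)S*`; these two facts give the action on
the Atiyah space and its isometric affine form. -/

theorem ev_of_mem {T : H →ₗ.[ℂ] H} {ξ : H} (h : ξ ∈ T.domain) : ev T ξ = T ⟨ξ, h⟩ := dif_pos h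

theorem ev_coe (T : H →ₗ.[ℂ] H) (ξ : T.domain) : ev T ξ = T ξ := ev_of_mem ξ.2

theorem ev_add {T : H →ₗ.[ℂ] H} {ξ η : H} (hξ : ξ ∈ T.domain) (hη : η ∈ T.domain) :
    ev T (ξ + η) = ev T ξ + ev T η := by
  rw [ev_of_mem hξ, ev_of_mem hη, ev_of_mem (add_mem hξ hη), ← LinearPMap.map_add]; rfl

theorem ev_smul {T : H →ₗ.[ℂ] H} {ξ : H} (s : ℂ) (hξ : ξ ∈ T.domain) :
    ev T (s • ξ) = s • ev T ξ := by
  rw [ev_of_mem hξ, ev_of_mem (T.domain.smul_mem s hξ), ← LinearPMap.map_smul]; rfl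

theorem ev_neg {T : H →ₗ.[ℂ] H} {ξ : H} (hξ : ξ ∈ T.domain) : ev T (-ξ) = -ev T ξ := by
  rw [ev_of_mem hξ, ev_of_mem (neg_mem hξ), ← LinearPMap.map_neg]; rfl

theorem ev_sub {T : H →ₗ.[ℂ] H} {ξ η : H} (hξ : ξ ∈ T.domain) (hη : η ∈ T.domain) :
    ev T (ξ - η) = ev T ξ - ev T η := by
  rw [sub_eq_add_neg, ev_add hξ (neg_mem hη), ev_neg hη, sub_eq_add_neg]

theorem ev_zero (T : H →ₗ.[ℂ] H) : ev T 0 = 0 := by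
  simpa using ev_smul (T := T) 0 T.domain.zero_mem

theorem ev_of_le {f g : H →ₗ.[ℂ] H} (h : f ≤ g) {ξ : H} (hξ : ξ ∈ f.domain) :
    ev g ξ = ev f ξ := by
  rw [ev_of_mem hξ, ev_of_mem (h.1 hξ)]
  exact (@h.2 ⟨ξ, hξ⟩ ⟨ξ, h.1 hξ⟩ rfl).symm

theorem mem_graph_iff_ev {T : H →ₗ.[ℂ] H} {ξ η : H} :
    (ξ, η) ∈ T.graph ↔ ξ ∈ T.domain ∧ ev T ξ = η := by
  rw [LinearPMap.mem_graph_iff]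
  constructor
  · rintro ⟨y, rfl, h⟩
    exact ⟨y.2, by rw [ev_coe]; exact h⟩
  · rintro ⟨h, e⟩
    exact ⟨⟨ξ, h⟩, rfl, by rw [← e, ev_of_mem h]⟩

theorem ev_add_op {T S : H →ₗ.[ℂ] H} {ξ : H} (hT : ξ ∈ T.domain) (hS : ξ ∈ S.domain) :
    ev (T + S) ξ = ev T ξ + ev S ξ := by
  rw [ev_of_mem hT, ev_of_mem hS, ev_of_mem (T := T + S) ⟨hT, hS⟩]; rfl

theorem ev_sub_op {T S : H →ₗ.[ℂ] H} {ξ : H} (hT : ξ ∈ T.domain) (hS : ξ ∈ S.domain) :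
    ev (T - S) ξ = ev T ξ - ev S ξ := by
  rw [ev_of_mem hT, ev_of_mem hS, ev_of_mem (T := T - S) ⟨hT, hS⟩]; rfl

theorem ev_smul_op {T : H →ₗ.[ℂ] H} {ξ : H} (s : ℂ) (hT : ξ ∈ T.domain) :
    ev (s • T) ξ = s • ev T ξ := by
  rw [ev_of_mem hT, ev_of_mem (T := s • T) hT]; rfl

theorem ev_add_smul_op {T W : H →ₗ.[ℂ] H} {ξ : H} (s : ℂ) (hT : ξ ∈ T.domain)
    (hW : ξ ∈ W.domain) : ev (T + s • W) ξ = ev T ξ + s • ev W ξ := by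
  rw [ev_add_op (S := s • W) hT hW, ev_smul_op s hW]

theorem ev_domRestrict {T : H →ₗ.[ℂ] H} {S : Submodule ℂ H} {ξ : H} (hS : ξ ∈ S)
    (hT : ξ ∈ T.domain) : ev (T.domRestrict S) ξ = ev T ξ :=
  (ev_of_le LinearPMap.domRestrict_le ⟨hS, hT⟩).symm

theorem ext_of_ev {T S : H →ₗ.[ℂ] H} (h : T.domain = S.domain)
    (h' : ∀ ξ ∈ T.domain, ev T ξ = ev S ξ) : T = S :=
  LinearPMap.eq_of_eq_graph (Submodule.ext fun x => by
    obtain ⟨x, y⟩ := x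
    rw [mem_graph_iff_ev, mem_graph_iff_ev, ← h]
    exact and_congr_right fun hx => by rw [h' x hx])

theorem mem_closure_of_closable {T : H →ₗ.[ℂ] H} (hT : T.IsClosable) {ξ η : H}
    (h : (ξ, η) ∈ closure (T.graph : Set (H × H))) :
    ξ ∈ T.closure.domain ∧ ev T.closure ξ = η := by
  rw [← mem_graph_iff_ev, ← hT.graph_closure_eq_closure_graph]
  exact h

theorem mem_closure_graph {T : H →ₗ.[ℂ] H} (hT : T.IsClosable) {ξ : H}
    (h : ξ ∈ T.closure.domain) : (ξ, ev T.closure ξ) ∈ closure (T.graph : Set (H × H)) := by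
  have := (mem_graph_iff_ev (T := T.closure)).2 ⟨h, rfl⟩
  rwa [← hT.graph_closure_eq_closure_graph] at this

theorem graph_coe_eq_image (T : H →ₗ.[ℂ] H) :
    (T.graph : Set (H × H)) = (fun ξ => (ξ, ev T ξ)) '' (T.domain : Set H) := by
  ext ⟨x, y⟩
  rw [SetLike.mem_coe, mem_graph_iff_ev]
  constructor
  · rintro ⟨h, rfl⟩; exact ⟨x, h, rfl⟩
  · rintro ⟨z, h, e⟩
    obtain ⟨rfl, rfl⟩ := Prod.mk.inj e
    exact ⟨h, rfl⟩

theorem graph_domRestrict {T : H →ₗ.[ℂ] H} {S : Submodule ℂ H} (hS : S ≤ T.domain) :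
    ((T.domRestrict S).graph : Set (H × H)) = (fun ξ => (ξ, ev T ξ)) '' (S : Set H) := by
  rw [graph_coe_eq_image, LinearPMap.domRestrict_domain, inf_eq_left.2 hS]
  exact Set.image_congr fun ξ h => by rw [ev_domRestrict h (hS h)]

/-- Every vector of the domain is a graph-norm limit of vectors of a core. -/
theorem exists_seq_of_hasCore {T : H →ₗ.[ℂ] H} {S : Submodule ℂ H} (hT : T.IsClosed)
    (h : T.HasCore S) {ξ : H} (hξ : ξ ∈ T.domain) :
    ∃ x : ℕ → H, (∀ k, x k ∈ S) ∧ Tendsto x atTop (𝓝 ξ) ∧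
      Tendsto (fun k => ev T (x k)) atTop (𝓝 (ev T ξ)) := by
  have hc : (T.domRestrict S).IsClosable := hT.isClosable.leIsClosable LinearPMap.domRestrict_le
  have h1 := mem_closure_graph hc (ξ := ξ) (by rw [h.closure_eq]; exact hξ)
  rw [h.closure_eq, graph_domRestrict h.le_domain, mem_closure_iff_seq_limit] at h1
  obtain ⟨x, hx, hl⟩ := h1
  choose y hy e using hx
  refine ⟨y, hy, ?_, ?_⟩
  · have := (continuous_fst.tendsto _).comp hl
    refine this.congr fun k => ?_
    simp [← e]
  · have := (continuous_snd.tendsto _).comp hl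
    refine this.congr fun k => ?_
    simp [← e]

theorem hasCore_of_mem_closure {T : H →ₗ.[ℂ] H} {S : Submodule ℂ H} (hT : T.IsClosed)
    (hS : S ≤ T.domain)
    (h : ∀ ξ ∈ T.domain, (ξ, ev T ξ) ∈ closure ((fun ξ => (ξ, ev T ξ)) '' (S : Set H))) :
    T.HasCore S := by
  have hc : (T.domRestrict S).IsClosable := hT.isClosable.leIsClosable LinearPMap.domRestrict_le
  refine ⟨hS, LinearPMap.eq_of_eq_graph (le_antisymm ?_ ?_)⟩
  · rw [← hc.graph_closure_eq_closure_graph]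
    refine Submodule.topologicalClosure_minimal _ ?_ hT
    exact LinearPMap.le_graph_of_le LinearPMap.domRestrict_le
  · rintro ⟨x, y⟩ hxy
    obtain ⟨hx, rfl⟩ := mem_graph_iff_ev.1 hxy
    rw [← hc.graph_closure_eq_closure_graph]
    have := h x hx
    rw [← graph_domRestrict hS] at this
    exact this

theorem hasCore_domain {T : H →ₗ.[ℂ] H} (hT : T.IsClosed) : T.HasCore T.domain :=
  hasCore_of_mem_closure hT le_rfl fun _ hξ => subset_closure ⟨_, hξ, rfl⟩

/-- An operator whose formal adjoint is densely defined is closable. -/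
theorem isClosable_of_formal_adjoint [CompleteSpace H] {T : H →ₗ.[ℂ] H} {Z : Set H} (hZ : Dense Z)
    (h : ∀ y ∈ Z, ∃ z, ∀ x ∈ T.domain, ⟪y, ev T x⟫_ℂ = ⟪z, x⟫_ℂ) : T.IsClosable := by
  -- The relation `⟪y, w⟫ = ⟪z, x⟫` is closed in `(x, w)`, so it passes to the closure of the graph.
  -- At `x = 0` it makes `w` orthogonal to the dense set `Z`.
  have key : ∀ x ∈ T.graph.topologicalClosure, x.1 = 0 → x.2 = 0 := by
    rintro ⟨x, w⟩ hx rfl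
    refine hZ.eq_zero_of_inner_left (𝕜 := ℂ) fun y hy => ?_
    obtain ⟨z, hz⟩ := h y hy
    have hcl : IsClosed {p : H × H | ⟪y, p.2⟫_ℂ = ⟪z, p.1⟫_ℂ} :=
      isClosed_eq (by fun_prop) (by fun_prop)
    have hsub : (T.graph : Set (H × H)) ⊆ {p : H × H | ⟪y, p.2⟫_ℂ = ⟪z, p.1⟫_ℂ} := by
      rintro ⟨a, b⟩ hab
      obtain ⟨ha, rfl⟩ := mem_graph_iff_ev.1 hab
      exact hz a ha
    have := closure_minimal hsub hcl hx
    simp only [Set.mem_ofPred_eq, inner_zero_right] at this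
    rw [← inner_conj_symm, this, map_zero]
  exact ⟨_, (Submodule.toLinearPMap_graph_eq _ key).symm⟩

/-- The symmetry of a partially defined operator. -/
def Symm (T : H →ₗ.[ℂ] H) : Prop :=
  ∀ ξ ∈ T.domain, ∀ η ∈ T.domain, ⟪ev T ξ, η⟫_ℂ = ⟪ξ, ev T η⟫_ℂ

/-- Surjectivity of `T + i`. -/
def SurjI (T : H →ₗ.[ℂ] H) : Prop :=
  ∀ η, ∃ ξ ∈ T.domain, ev T ξ + Complex.I • ξ = η

theorem symm_of_isSelfAdjoint [CompleteSpace H] {T : H →ₗ.[ℂ] H} (hT : IsSelfAdjoint T) :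
    Symm T := by
  intro ξ hξ η hη
  have h := LinearPMap.adjoint_isFormalAdjoint (T := T) hT.dense_domain
  rw [LinearPMap.isSelfAdjoint_def.1 hT] at h
  have := h ⟨ξ, hξ⟩ ⟨η, hη⟩
  rw [ev_of_mem hξ, ev_of_mem hη]
  exact this

theorem Symm.inner_re {T : H →ₗ.[ℂ] H} (hT : Symm T) {ξ : H} (hξ : ξ ∈ T.domain) :
    (starRingEnd ℂ) ⟪ev T ξ, ξ⟫_ℂ = ⟪ev T ξ, ξ⟫_ℂ := by
  rw [inner_conj_symm, hT ξ hξ ξ hξ]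

/-- The cross term is the real part of `i⟪Tξ, ξ⟫`, and `⟪Tξ, ξ⟫` is real. -/
theorem Symm.norm_sq {T : H →ₗ.[ℂ] H} (hT : Symm T) {ξ : H} (hξ : ξ ∈ T.domain) :
    ‖ev T ξ + Complex.I • ξ‖ ^ 2 = ‖ev T ξ‖ ^ 2 + ‖ξ‖ ^ 2 := by
  rw [norm_add_sq (𝕜 := ℂ), inner_smul_right, norm_smul]
  have h : (⟪ev T ξ, ξ⟫_ℂ).im = 0 := Complex.conj_eq_iff_im.1 (hT.inner_re hξ)
  simp [h]

theorem Symm.norm_le {T : H →ₗ.[ℂ] H} (hT : Symm T) {ξ : H} (hξ : ξ ∈ T.domain) :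
    ‖ev T ξ‖ ≤ ‖ev T ξ + Complex.I • ξ‖ ∧ ‖ξ‖ ≤ ‖ev T ξ + Complex.I • ξ‖ := by
  have := hT.norm_sq hξ
  constructor <;> refine abs_le_of_sq_le_sq' ?_ (norm_nonneg _) |>.2 <;>
    nlinarith [sq_nonneg ‖ev T ξ‖, sq_nonneg ‖ξ‖]

theorem Symm.injective {T : H →ₗ.[ℂ] H} (hT : Symm T) {ξ η : H} (hξ : ξ ∈ T.domain)
    (hη : η ∈ T.domain) (h : ev T ξ + Complex.I • ξ = ev T η + Complex.I • η) : ξ = η := by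
  have h1 := (hT.norm_le (sub_mem hξ hη)).2
  rw [ev_sub hξ hη, smul_sub] at h1
  have : ev T ξ - ev T η + (Complex.I • ξ - Complex.I • η) = 0 := by
    rw [← sub_eq_zero] at h; rw [← h]; abel
  rw [this, norm_zero] at h1
  exact sub_eq_zero.1 (norm_le_zero_iff.1 h1)

/-- The resolvent at `-i` of a symmetric operator for which `T + i` is surjective. -/
theorem Symm.exists_resolvent {T : H →ₗ.[ℂ] H} (hT : Symm T) (hs : SurjI T) :
    ∃ Q : H →L[ℂ] H, ∀ η, Q η ∈ T.domain ∧ ev T (Q η) + Complex.I • Q η = η := by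
  choose q hq e using hs
  have uniq : ∀ ξ ∈ T.domain, ∀ η, ev T ξ + Complex.I • ξ = η → q η = ξ := fun ξ hξ η h =>
    hT.injective (hq η) hξ (by rw [e, h])
  refine ⟨LinearMap.mkContinuous
    { toFun := q
      map_add' := fun x y => uniq _ (add_mem (hq x) (hq y)) _ ?_
      map_smul' := fun s x => uniq _ (T.domain.smul_mem s (hq x)) _ ?_ } 1 fun x => ?_,
    fun η => ⟨hq η, e η⟩⟩
  · rw [ev_add (hq x) (hq y), smul_add, add_add_add_comm, e, e]
  · rw [ev_smul s (hq x), smul_comm, ← smul_add, e]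
  · have := (hT.norm_le (hq x)).2
    rw [e] at this
    simpa using this

/-- A densely defined symmetric operator with `T ± i` surjective is self-adjoint. -/
theorem Symm.isSelfAdjoint [CompleteSpace H] {T : H →ₗ.[ℂ] H} (hT : Symm T)
    (hd : Dense (T.domain : Set H)) (hs : SurjI T)
    (hs' : ∀ η, ∃ ξ ∈ T.domain, ev T ξ - Complex.I • ξ = η) : IsSelfAdjoint T := by
  have hle : T ≤ LinearPMap.adjoint T := by
    refine LinearPMap.IsFormalAdjoint.le_adjoint hd fun x y => ?_
    have := hT x x.2 y y.2
    rw [ev_coe, ev_coe] at this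
    exact this
  rw [LinearPMap.isSelfAdjoint_def]
  refine (LinearPMap.eq_of_le_of_domain_eq hle (le_antisymm hle.1 fun y hy => ?_)).symm
  set z := ev (LinearPMap.adjoint T) y with hz
  have hadj : ∀ x ∈ T.domain, ⟪z, x⟫_ℂ = ⟪y, ev T x⟫_ℂ := by
    intro x hx
    have := LinearPMap.adjoint_isFormalAdjoint (T := T) hd ⟨y, hy⟩ ⟨x, hx⟩
    rw [hz, ev_of_mem hy, ev_of_mem hx]
    exact this
  -- With `(T + i)x = (T* + i)y` and `y - x = (T - i)w`, one gets `‖y - x‖² = ⟪(T* + i)y - (T + i)x,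
  -- w⟫ = 0`, so `y = x` lies in `Dom T`.
  obtain ⟨x, hx, e⟩ := hs (z + Complex.I • y)
  have : y - x = 0 := by
    obtain ⟨w, hw, e'⟩ := hs' (y - x)
    rw [← inner_self_eq_zero (𝕜 := ℂ)]
    nth_rewrite 2 [← e']
    rw [inner_sub_right, inner_smul_right, inner_sub_left, ← hadj w hw, ← hT x hx w hw,
      inner_sub_left]
    have h2 : ⟪ev T x + Complex.I • x, w⟫_ℂ = ⟪z + Complex.I • y, w⟫_ℂ := by rw [e]
    simp only [inner_add_left, inner_smul_left, Complex.conj_I] at h2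
    linear_combination -h2
  rw [sub_eq_zero.1 this]; exact hx

/-- Surjectivity of `T + i` is stable under small relatively bounded perturbations. -/
theorem Symm.surjI_add [CompleteSpace H] {T W : H →ₗ.[ℂ] H} (hT : Symm T) (hs : SurjI T)
    (hW : T.domain ≤ W.domain) {C : ℝ}
    (hC : ∀ ξ ∈ T.domain, ‖ev W ξ‖ ≤ C * (‖ev T ξ‖ + ‖ξ‖)) {s : ℂ} (hsC : ‖s‖ * (C * 2) < 1)
    (hC0 : 0 ≤ C) : SurjI (T + s • W) := by
  obtain ⟨Q, hQ⟩ := hT.exists_resolvent hs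
  have hb : ∀ η, ‖ev W (Q η)‖ ≤ C * 2 * ‖η‖ := fun η => by
    have h1 := hT.norm_le (hQ η).1
    rw [(hQ η).2] at h1
    refine (hC _ (hQ η).1).trans ?_
    rw [mul_assoc]
    exact mul_le_mul_of_nonneg_left (by linarith [h1.1, h1.2]) hC0
  -- `K = W(T + i)⁻¹` has norm at most `2C`, as the resolvent controls both `Tξ` and `ξ`. Since `(T
  -- + sW + i)Q = 1 + sK`, inverting `1 + sK` by a Neumann series solves the equation.
  let K : H →L[ℂ] H := LinearMap.mkContinuous
    { toFun := fun η => ev W (Q η)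
      map_add' := fun x y => by rw [map_add, ev_add (hW (hQ x).1) (hW (hQ y).1)]
      map_smul' := fun c x => by rw [map_smul, ev_smul c (hW (hQ x).1), RingHom.id_apply] } (C * 2) hb
  have hK : ‖-(s • K)‖ < 1 := by
    rw [norm_neg, norm_smul]
    refine lt_of_le_of_lt (mul_le_mul_of_nonneg_left ?_ (norm_nonneg s)) hsC
    exact LinearMap.mkContinuous_norm_le _ (by positivity) _
  intro η
  let u := Units.oneSub (-(s • K)) hK
  have hu : (u : H →L[ℂ] H) = 1 + s • K := by rw [Units.val_oneSub, sub_neg_eq_add]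
  refine ⟨Q ((↑u⁻¹ : H →L[ℂ] H) η), ⟨(hQ _).1, hW (hQ _).1⟩, ?_⟩
  set ζ := (↑u⁻¹ : H →L[ℂ] H) η with hζ
  have h1 : ζ + s • ev W (Q ζ) = η := by
    have : (u : H →L[ℂ] H) ζ = η := by
      rw [hζ, ← mul_apply_eq_comp, u.mul_inv]; rfl
    rw [hu] at this
    exact this
  rw [ev_add_smul_op s (hQ ζ).1 (hW (hQ ζ).1), ← h1]
  rw [add_right_comm, (hQ ζ).2]

/-- The continuity method: a uniform relative bound along `T + t W`, `0 ≤ t ≤ 1`. -/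
theorem Symm.surjI_of_uniform_bound [CompleteSpace H] {T W : H →ₗ.[ℂ] H} (hT : Symm T)
    (hs : SurjI T) (hW : T.domain ≤ W.domain)
    (hWs : ∀ ξ ∈ T.domain, ∀ η ∈ T.domain, ⟪ev W ξ, η⟫_ℂ = ⟪ξ, ev W η⟫_ℂ) {C : ℝ} (hC0 : 0 ≤ C)
    (hC : ∀ t : ℝ, 0 ≤ t → t ≤ 1 → ∀ ξ ∈ T.domain,
      ‖ev W ξ‖ ≤ C * (‖ev T ξ + (t : ℂ) • ev W ξ‖ + ‖ξ‖)) : SurjI (T + W) := by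
  -- Steps of length `1/N` with `N > 2C` are admissible for `Symm.surjI_add`. The bound is the same
  -- at every `t`, so `N` equal steps reach `t = 1`; the extra `1` keeps `N` positive.
  obtain ⟨N, hN⟩ := exists_nat_gt (C * 2 + 1)
  have hN0 : (0 : ℝ) < N := by linarith
  have hdom : ∀ c : ℂ, (T + c • W).domain = T.domain := fun c => inf_eq_left.2 hW
  have hev : ∀ c : ℂ, ∀ ξ ∈ T.domain, ev (T + c • W) ξ = ev T ξ + c • ev W ξ := fun c ξ hξ =>
    ev_add_smul_op c hξ (hW hξ)
  have step : ∀ k : ℕ, k ≤ N → SurjI (T + ((k / N : ℝ) : ℂ) • W) := by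
    intro k
    induction k with
    | zero =>
      intro _ η
      obtain ⟨ξ, hξ, e⟩ := hs η
      refine ⟨ξ, (hdom _).symm ▸ hξ, ?_⟩
      rw [hev _ ξ hξ]; simpa using e
    | succ k ih =>
      intro hk
      have hk' : (k : ℝ) / N ≤ 1 := by
        rw [div_le_one hN0]; exact_mod_cast (Nat.le_of_succ_le hk)
      have hsym : Symm (T + ((k / N : ℝ) : ℂ) • W) := by
        intro ξ hξ η hη
        rw [hdom] at hξ hη
        rw [hev _ ξ hξ, hev _ η hη, inner_add_left, inner_add_right, inner_smul_left,
          inner_smul_right, hT ξ hξ η hη, hWs ξ hξ η hη, Complex.conj_ofReal]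
      have := hsym.surjI_add (ih (Nat.le_of_succ_le hk)) (W := W) (C := C)
        (by rw [hdom]; exact hW) (fun ξ hξ => by
          rw [hdom] at hξ
          rw [hev _ ξ hξ]
          exact hC _ (by positivity) hk' ξ hξ) (s := ((1 / N : ℝ) : ℂ)) (by
          rw [Complex.norm_real, Real.norm_of_nonneg (by positivity), one_div_mul_eq_div,
            div_lt_one hN0]
          linarith) hC0
      intro η
      obtain ⟨ξ, hξ, e⟩ := this η
      have hξ' : ξ ∈ T.domain := hξ.1.1
      refine ⟨ξ, (hdom _).symm ▸ hξ', ?_⟩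
      have hc : (((k + 1 : ℕ) / N : ℝ) : ℂ) = ((k / N : ℝ) : ℂ) + ((1 / N : ℝ) : ℂ) := by
        push_cast
        ring
      rw [← e, ev_add_smul_op (T := T + ((k / N : ℝ) : ℂ) • W) _ hξ.1 (hW hξ'), hev _ ξ hξ',
        hev _ ξ hξ', hc, add_smul, add_assoc (ev T ξ) (_ • _) (_ • _)]
  have := step N le_rfl
  rw [div_self hN0.ne'] at this
  simpa using this

end UnboundedOperators

end NCGauge

end

noncomputable section

namespace NCGauge

/-! ### Derivatives on the group along curves through the identity. -/

section Calculus

variable {m : ℕ} {G : Type*} [TopologicalSpace G] [ChartedSpace (EuclideanSpace ℝ (Fin m)) G]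
  [Group G]

/-- An element of the Lie algebra as a vector of the model space. -/
def toModel (X : Lie m G) : EuclideanSpace ℝ (Fin m) := X

/-- A curve in `G` through `1` with velocity `X`. -/
def curve (X : Lie m G) (s : ℝ) : G :=
  (extChartAt (𝓡 m) (1 : G)).symm (extChartAt (𝓡 m) (1 : G) 1 + s • toModel X)

theorem curve_zero (X : Lie m G) : curve X 0 = (1 : G) := by
  rw [curve, zero_smul, add_zero, extChartAt_to_inv]

/-- Source and target base points are constantly `1`, so the coordinate changes of the tangent
bundle are identities. Regularity of the derivative in tangent coordinates is thereby regularity of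
the derivative itself. -/
theorem inTangentCoordinates_const {g : G → G} (hg : ∀ x, g x = 1)
    (ϕ : G → EuclideanSpace ℝ (Fin m) →L[ℝ] EuclideanSpace ℝ (Fin m)) (x : G)
    (v : EuclideanSpace ℝ (Fin m)) [IsManifold (𝓡 m) 1 G] :
    inTangentCoordinates (𝓡 m) (𝓡 m) (fun _ : G => (1 : G)) g ϕ 1 x v = ϕ x v := by
  obtain rfl : g = fun _ => 1 := funext hg
  rw [inTangentCoordinates_eq _ _ _ (by simp) (by simp)]
  have hs := (tangentBundleCore (𝓡 m) G).coordChange_self (achart _ (1 : G)) 1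
    (mem_achart_source _ _)
  simp only [ContinuousLinearMap.comp_apply]
  rw [hs, hs]

variable [LieGroup (𝓡 m) ∞ G]

/-- In the chart at `1` the curve is a straight line, and the inverse chart has derivative the
identity there. This replaces manifold derivatives by derivatives in one real variable, for which
product rules and uniqueness are immediate. -/
theorem hasDerivAt_comp_curve {E : Type*} [NormedAddCommGroup E] [NormedSpace ℝ E] {f : G → E}
    (hf : MDifferentiableAt (𝓡 m) 𝓘(ℝ, E) f 1) (X : Lie m G) :
    HasDerivAt (fun s => f (curve X s)) (mfderiv (𝓡 m) 𝓘(ℝ, E) f 1 X) 0 := by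
  have : IsManifold (𝓡 m) 1 G := IsManifold.of_le (n := ∞) (by simp)
  set ψ := extChartAt (𝓡 m) (1 : G) with hψ
  have h1 : HasMFDerivAt 𝓘(ℝ, EuclideanSpace ℝ (Fin m)) (𝓡 m) ψ.symm (ψ 1)
      (ContinuousLinearMap.id ℝ (EuclideanSpace ℝ (Fin m))) := by
    have h := (mdifferentiableWithinAt_extChartAt_symm (I := 𝓡 m) (x := (1 : G))
      (mem_extChartAt_target (I := 𝓡 m) (1 : G))).hasMFDerivWithinAt
    rw [mfderivWithin_range_extChartAt_symm] at h
    exact h.hasMFDerivAt (by simp)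
  have h2 : HasMFDerivAt 𝓘(ℝ, EuclideanSpace ℝ (Fin m)) 𝓘(ℝ, E) (f ∘ ψ.symm) (ψ 1)
      (mfderiv (𝓡 m) 𝓘(ℝ, E) f 1) := by
    have hf' : HasMFDerivAt (𝓡 m) 𝓘(ℝ, E) f (ψ.symm (ψ 1)) (mfderiv (𝓡 m) 𝓘(ℝ, E) f 1) := by
      rw [hψ, extChartAt_to_inv]; exact hf.hasMFDerivAt
    exact hf'.comp _ h1
  have h3 := h2.hasFDerivAt
  have h4 : HasDerivAt (fun s : ℝ => ψ 1 + s • toModel X) (toModel X) 0 := by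
    have := ((hasDerivAt_id (0 : ℝ)).smul_const (toModel X)).const_add (ψ 1)
    simpa using this
  exact HasFDerivAt.comp_hasDerivAt_of_eq (0 : ℝ) h3 h4 (by rw [zero_smul, add_zero])

/-- The map `(x, h) ↦ x⁻¹ h x` is jointly `C²`, so its derivative in `h` at `1` is `C¹` in `x`. -/
theorem mdifferentiableAt_Ad_inv (Y : Lie m G) :
    MDifferentiableAt (𝓡 m) 𝓘(ℝ, EuclideanSpace ℝ (Fin m)) (fun g : G => toModel (Ad m g⁻¹ Y))
      1 := by
  have : IsManifold (𝓡 m) 1 G := IsManifold.of_le (n := ∞) (by simp)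
  have : LieGroup (𝓡 m) 2 G := LieGroup.of_le (n := ∞) (WithTop.coe_le_coe.2 le_top)
  have hf : ContMDiffAt ((𝓡 m).prod (𝓡 m)) (𝓡 m) 2
      (Function.uncurry fun x h : G => x⁻¹ * h * x⁻¹⁻¹) (1, 1) :=
    ((contMDiff_fst.inv.mul contMDiff_snd).mul contMDiff_fst.inv.inv).contMDiffAt
  have h := ContMDiffAt.mfderiv (m := 1) (fun x h : G => x⁻¹ * h * x⁻¹⁻¹) (fun _ : G => (1 : G)) hf
    contMDiffAt_const (by norm_num)
  have h' := (h.mdifferentiableAt one_ne_zero).clm_apply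
    (mdifferentiableAt_const (c := toModel Y))
  refine h'.congr_of_eventuallyEq (Eventually.of_forall fun x => ?_)
  have key := inTangentCoordinates_const (m := m) (g := fun x : G => x⁻¹ * 1 * x⁻¹⁻¹)
    (fun x => by simp) (fun x => mfderiv (𝓡 m) (𝓡 m) (fun h : G => x⁻¹ * h * x⁻¹⁻¹) 1) x (toModel Y)
  exact key.symm

end Calculus

/-! ### The unitary representation, its `C¹` vectors and its differential. -/

namespace Background

variable {m n : ℕ} {G A H : Type*} [TopologicalSpace G]
  [ChartedSpace (EuclideanSpace ℝ (Fin m)) G] [Group G]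
  [CStarAlgebra A] [PartialOrder A] [StarOrderedRing A]
  [NormedAddCommGroup H] [InnerProductSpace ℂ H] [CompleteSpace H]
  (B : Background m n G A H)

theorem u_one : B.u 1 = 1 := by simp [u]

theorem u_mul (g h : G) : B.u (g * h) = B.u g * B.u h := by simp [u]

theorem star_u (g : G) : star (B.u g) = B.u g⁻¹ := by
  simp [u, map_inv, ← Unitary.star_eq_inv]

theorem star_u_mul (g : G) : star (B.u g) * B.u g = 1 := by
  rw [star_u, ← u_mul, inv_mul_cancel, u_one]

theorem u_mul_star (g : G) : B.u g * star (B.u g) = 1 := by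
  rw [star_u, ← u_mul, mul_inv_cancel, u_one]

theorem inner_u (g : G) (ξ η : H) : ⟪B.u g ξ, η⟫_ℂ = ⟪ξ, B.u g⁻¹ η⟫_ℂ := by
  rw [← star_u, ContinuousLinearMap.star_eq_adjoint, ContinuousLinearMap.adjoint_inner_right]

theorem inner_u_u (g : G) (ξ η : H) : ⟪B.u g ξ, B.u g η⟫_ℂ = ⟪ξ, η⟫_ℂ := by
  rw [inner_u, ← mul_apply_eq_comp, ← u_mul, inv_mul_cancel, u_one]; rfl

theorem u_mul_π (g : G) (a : A) : B.u g * B.R.π a = B.R.π (B.P.α g a) * B.u g := by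
  rw [← B.R.U_π g a, mul_assoc]
  exact (by rw [star_u_mul, mul_one] :
    B.u g * B.R.π a = B.u g * B.R.π a * (star (B.u g) * B.u g))

theorem u_mul_c (g : G) (l : Module.Dual ℝ (Lie m G)) :
    B.u g * B.c l = B.c (coAd m g l) * B.u g := by
  rw [← B.c_equivariant g l, mul_assoc]
  exact (by rw [star_u_mul, mul_one] :
    B.u g * B.c l = B.u g * B.c l * (star (B.u g) * B.u g))

theorem commute_π_of_fixed {a : A} (ha : B.P.Fixed a) (g : G) :
    B.R.π a * B.u g = B.u g * B.R.π a := by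
  rw [u_mul_π, ha g]

theorem mem_C1_iff {ξ : H} : ξ ∈ B.C1 ↔ ContMDiff (𝓡 m) 𝓘(ℝ, H) 1 fun g : G => B.u g ξ := Iff.rfl

theorem mdifferentiableAt_u {ξ : H} (hξ : ξ ∈ B.C1) :
    MDifferentiableAt (𝓡 m) 𝓘(ℝ, H) (fun g : G => B.u g ξ) 1 :=
  (B.mem_C1_iff.1 hξ).mdifferentiable one_ne_zero 1

theorem mem_C1_of_commute {S : H →L[ℂ] H} (hS : ∀ g, S * B.u g = B.u g * S) {ξ : H}
    (hξ : ξ ∈ B.C1) : S ξ ∈ B.C1 := by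
  have h := (S.restrictScalars ℝ).contDiff (n := 1) |>.contMDiff.comp (B.mem_C1_iff.1 hξ)
  have e : (fun g : G => B.u g (S ξ)) = S.restrictScalars ℝ ∘ fun g : G => B.u g ξ := by
    funext g
    exact (DFunLike.congr_fun (hS g) ξ).symm
  rw [mem_C1_iff, e]
  exact h

/-- The representation as a bounded real-linear map into the real-linear operators. -/
def πℝ : A →L[ℝ] (H →L[ℝ] H) :=
  (ContinuousLinearMap.restrictScalarsL ℂ H H ℝ ℝ).comp
    ((⟨B.R.π.toAlgHom.toLinearMap, map_continuous B.R.π⟩ : A →L[ℂ] (H →L[ℂ] H)).restrictScalars ℝ)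

theorem πℝ_apply (a : A) (ξ : H) : B.πℝ a ξ = B.R.π a ξ := rfl

theorem π_mem_C1 {a : A} (ha : a ∈ B.𝒜) {ξ : H} (hξ : ξ ∈ B.C1) : B.R.π a ξ ∈ B.C1 := by
  have h := ((B.πℝ.contDiff (n := 1)).contMDiff.comp (B.𝒜_C1 a ha)).clm_apply (B.mem_C1_iff.1 hξ)
  have e : (fun g : G => B.u g (B.R.π a ξ)) = fun g => B.πℝ (B.P.α g a) (B.u g ξ) := by
    funext g
    exact DFunLike.congr_fun (B.u_mul_π g a) ξ
  rw [mem_C1_iff, e]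
  exact h

/-- The derivative of `g ↦ α_g a` at `1` in the direction `X`. -/
def dα (X : Lie m G) (a : A) : A := mfderiv (𝓡 m) 𝓘(ℝ, A) (fun g : G => B.P.α g a) 1 X

variable [LieGroup (𝓡 m) ∞ G]

theorem hasDerivAt_u {ξ : H} (hξ : ξ ∈ B.C1) (X : Lie m G) :
    HasDerivAt (fun s => B.u (curve X s) ξ) (B.dU X ξ) 0 :=
  hasDerivAt_comp_curve (B.mdifferentiableAt_u hξ) X

theorem dU_of_commute {S : H →L[ℂ] H} (hS : ∀ g, S * B.u g = B.u g * S) {ξ : H}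
    (hξ : ξ ∈ B.C1) (X : Lie m G) : B.dU X (S ξ) = S (B.dU X ξ) := by
  have h1 := B.hasDerivAt_u (B.mem_C1_of_commute hS hξ) X
  have h2 := (S.restrictScalars ℝ).hasFDerivAt.comp_hasDerivAt (0 : ℝ) (B.hasDerivAt_u hξ X)
  refine h1.unique (h2.congr_of_eventuallyEq (Eventually.of_forall fun s => ?_))
  exact (DFunLike.congr_fun (hS (curve X s)) ξ).symm

/-- Differentiate the constant function `g ↦ ⟪U_g ξ, U_g η⟫`. -/
theorem inner_dU {ξ η : H} (hξ : ξ ∈ B.C1) (hη : η ∈ B.C1) (X : Lie m G) :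
    ⟪B.dU X ξ, η⟫_ℂ = -⟪ξ, B.dU X η⟫_ℂ := by
  have h := (B.hasDerivAt_u hξ X).inner ℂ (B.hasDerivAt_u hη X)
  simp only [inner_u_u, curve_zero, u_one, one_apply_eq_self] at h
  have := h.unique (hasDerivAt_const _ _)
  linear_combination this

theorem dU_π {a : A} (ha : a ∈ B.𝒜) {ξ : H} (hξ : ξ ∈ B.C1) (X : Lie m G) :
    B.dU X (B.R.π a ξ) = B.R.π a (B.dU X ξ) + B.R.π (B.dα X a) ξ := by
  have h1 := B.hasDerivAt_u (B.π_mem_C1 ha hξ) X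
  have ha' : HasDerivAt (fun s => B.P.α (curve X s) a) (B.dα X a) 0 :=
    hasDerivAt_comp_curve ((B.𝒜_C1 a ha).mdifferentiable one_ne_zero 1) X
  have h2 := (B.πℝ.hasFDerivAt.comp_hasDerivAt (0 : ℝ) ha').clm_apply (B.hasDerivAt_u hξ X)
  have h3 := h1.unique (h2.congr_of_eventuallyEq (Eventually.of_forall fun s => ?_))
  · rw [h3]
    simp only [Function.comp, curve_zero, u_one, B.P.α_one, πℝ_apply]
    rw [add_comm]; rfl
  · exact DFunLike.congr_fun (B.u_mul_π (curve X s) a) ξ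

/-- The commutator `[dU(X), c(l)]` is bounded. -/
theorem exists_dU_c (X : Lie m G) (l : Module.Dual ℝ (Lie m G)) :
    ∃ K : H →L[ℂ] H, ∀ ξ ∈ B.C1, B.c l ξ ∈ B.C1 →
      B.dU X (B.c l ξ) = B.c l (B.dU X ξ) + K ξ := by
  -- Equivariance gives `U_g c(l) = c(Ad*_g l) U_g`. After expansion in the dual basis only the real
  -- coefficients `l(Ad_{g⁻¹} εᵢ)` are differentiated besides `U_g ξ`; their derivatives make up the
  -- bounded commutator.
  have hd : ∀ i, ∃ d : ℝ, HasDerivAt (fun s => coAd m (curve X s) l (B.F.ε i)) d 0 := by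
    intro i
    have h := hasDerivAt_comp_curve (mdifferentiableAt_Ad_inv (B.F.ε i)) X
    let l' : EuclideanSpace ℝ (Fin m) →ₗ[ℝ] ℝ := l
    exact ⟨_, (LinearMap.toContinuousLinearMap l').hasFDerivAt.comp_hasDerivAt (0 : ℝ) h⟩
  choose d hd using hd
  have hc : ∀ g : G, B.c (coAd m g l) = ∑ i, (coAd m g l (B.F.ε i)) • B.cε i := fun g => by
    conv_lhs => rw [← B.F.ε.sum_dual_apply_smul_coord (coAd m g l)]
    rw [map_sum]
    exact Finset.sum_congr rfl fun i _ => map_smul _ _ _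
  refine ⟨∑ i, d i • B.cε i, fun ξ hξ hcξ => ?_⟩
  have h1 := B.hasDerivAt_u hcξ X
  have h2 : HasDerivAt (fun s => ∑ i, (coAd m (curve X s) l (B.F.ε i)) •
      (B.cε i (B.u (curve X s) ξ))) (∑ i, ((coAd m (curve X 0) l (B.F.ε i)) • B.cε i (B.dU X ξ) +
        d i • B.cε i (B.u (curve X 0) ξ))) 0 :=
    HasDerivAt.fun_sum fun i _ => (hd i).fun_smul
      (((B.cε i).restrictScalars ℝ).hasFDerivAt.comp_hasDerivAt (0 : ℝ) (B.hasDerivAt_u hξ X))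
  have h3 := h1.unique (h2.congr_of_eventuallyEq (Eventually.of_forall fun s => ?_))
  · have h4 : B.c (coAd m (1 : G) l) = B.c l := by
      have := B.u_mul_c 1 l
      rw [u_one, one_mul, mul_one] at this
      exact this.symm
    rw [h3, Finset.sum_add_distrib, ← h4, hc, curve_zero, u_one]
    simp
  · have := DFunLike.congr_fun (B.u_mul_c (curve X s) l) ξ
    rw [hc] at this
    simpa [sum_apply] using this

end Background

end NCGauge

end

noncomputable section

namespace NCGauge

/-! ### Square root and inverse of the vertical metric. -/

section VerticalMetric

variable {m : ℕ} {G A : Type*} [TopologicalSpace G] [ChartedSpace (EuclideanSpace ℝ (Fin m)) G]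
  [Group G] [CStarAlgebra A]

theorem continuous_starAlgHom {B C : Type*} [CStarAlgebra B] [CStarAlgebra C] (f : B →⋆ₐ[ℂ] C) :
    Continuous f :=
  (NonUnitalStarAlgHom.instContinuousLinearMapClassComplex
    (F := B →⋆ₐ[ℂ] C) (A := B) (B := C)).map_continuous f

theorem posSqrt_mul_posSqrt {C : Type*} [CStarAlgebra C] [PartialOrder C] [StarOrderedRing C] {a : C}
    (ha : 0 ≤ a) : posSqrt a * posSqrt a = a := by
  have hsa := IsSelfAdjoint.of_nonneg ha
  have h := cfc_mul Real.sqrt Real.sqrt a (by fun_prop) (by fun_prop)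
  rw [posSqrt, ← h]
  conv_rhs => rw [← cfc_id' ℝ a hsa]
  exact cfc_congr fun x hx => Real.mul_self_sqrt (spectrum_nonneg_of_nonneg ha hx)

/-- Applied to matrices over the closed algebra `invCenter`, this and `ringInverse_mem` keep the
entries of `√ρ` and its inverse central, `G`-fixed and even. -/
theorem posSqrt_mem {C : Type*} [CStarAlgebra C] {S : StarSubalgebra ℂ C}
    (hS : IsClosed (S : Set C)) {a : C} (ha : a ∈ S) : posSqrt a ∈ S :=
  cfc_mem (hs := hS) _ ha

theorem ringInverse_mem {C : Type*} [CStarAlgebra C] {S : StarSubalgebra ℂ C}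
    (hS : IsClosed (S : Set C)) {a : C} (hu : IsUnit a) (hsa : IsSelfAdjoint a) (ha : a ∈ S) :
    Ring.inverse a ∈ S := by
  rw [← cfc_ringInverse_id (R := ℝ) (a := a) (ha_unit := hu) (ha := hsa)]
  exact cfc_mem (hs := hS) _ ha

theorem isSelfAdjoint_posSqrt {C : Type*} [CStarAlgebra C] (a : C) : IsSelfAdjoint (posSqrt a) :=
  cfc_predicate Real.sqrt a

/-- The central, `G`-fixed and even elements. -/
def PrincipalAlgebra.invCenter (P : PrincipalAlgebra G A) : StarSubalgebra ℂ A where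
  carrier := {z | (∀ a, z * a = a * z) ∧ P.Fixed z ∧ P.gr z = z}
  mul_mem' := fun {x y} hx hy => ⟨fun a => by rw [mul_assoc, hy.1, ← mul_assoc, hx.1, mul_assoc],
    fun g => by rw [map_mul, hx.2.1 g, hy.2.1 g], by rw [map_mul, hx.2.2, hy.2.2]⟩
  add_mem' := fun {x y} hx hy => ⟨fun a => by rw [add_mul, mul_add, hx.1, hy.1],
    fun g => by rw [map_add, hx.2.1 g, hy.2.1 g], by rw [map_add, hx.2.2, hy.2.2]⟩
  algebraMap_mem' := fun r => ⟨fun a => Algebra.commutes r a,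
    fun g => AlgHomClass.commutes (P.α g) r, AlgHomClass.commutes P.gr r⟩
  star_mem' := fun {x} hx => ⟨fun a => by
      have := congrArg star (hx.1 (star a))
      rw [star_mul, star_mul, star_star] at this
      exact this.symm,
    fun g => by rw [map_star, hx.2.1 g], by rw [map_star, hx.2.2]⟩

theorem PrincipalAlgebra.mem_invCenter {P : PrincipalAlgebra G A} {z : A} :
    z ∈ P.invCenter ↔ (∀ a, z * a = a * z) ∧ P.Fixed z ∧ P.gr z = z := Iff.rfl

theorem PrincipalAlgebra.isClosed_invCenter (P : PrincipalAlgebra G A) :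
    IsClosed (P.invCenter : Set A) := by
  have e : (P.invCenter : Set A) =
      (⋂ a, {z | z * a = a * z}) ∩ ((⋂ g, {z | P.α g z = z}) ∩ {z | P.gr z = z}) := by
    ext z
    simp only [SetLike.mem_coe, mem_invCenter, Set.mem_inter_iff, Set.mem_iInter,
      Set.mem_ofPred_eq]
    rfl
  rw [e]
  refine (isClosed_iInter fun a => isClosed_eq (by fun_prop) (by fun_prop)).inter
    ((isClosed_iInter fun g => isClosed_eq (continuous_starAlgHom (P.α g)) continuous_id).inter
      (isClosed_eq (continuous_starAlgHom P.gr) continuous_id))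

theorem PrincipalAlgebra.Fixed.inverse {P : PrincipalAlgebra G A} {z : A} (hz : P.Fixed z) :
    P.Fixed (Ring.inverse z) := by
  intro g
  by_cases h : IsUnit z
  · obtain ⟨u, rfl⟩ := h
    rw [Ring.inverse_unit]
    have h1 : (u : A) * P.α g ↑u⁻¹ = 1 := by
      nth_rewrite 1 [← hz g]
      rw [← map_mul, u.mul_inv, map_one]
    exact (u.eq_inv_of_mul_eq_one_left h1)
  · rw [Ring.inverse_non_unit _ h, map_zero]

theorem PrincipalAlgebra.inverse_mem_invCenter {P : PrincipalAlgebra G A} {z : A}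
    (hz : z ∈ P.invCenter) : Ring.inverse z ∈ P.invCenter := by
  by_cases h : IsUnit z
  · refine ⟨fun a => ?_, hz.2.1.inverse, ?_⟩
    · obtain ⟨u, rfl⟩ := h
      rw [Ring.inverse_unit]
      have : Commute (u : A) a := hz.1 a
      exact this.units_inv_left
    · obtain ⟨u, rfl⟩ := h
      rw [Ring.inverse_unit]
      have h1 : (u : A) * P.gr ↑u⁻¹ = 1 := by
        nth_rewrite 1 [← hz.2.2]
        rw [← map_mul, u.mul_inv, map_one]
      exact (u.eq_inv_of_mul_eq_one_left h1)
  · rw [Ring.inverse_non_unit _ h]; exact zero_mem _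

/-- The matrices with entries in a star subalgebra. -/
def matrixSubalgebra (Z : StarSubalgebra ℂ A) : StarSubalgebra ℂ (CStarMatrix (Fin m) (Fin m) A) where
  carrier := {M | ∀ i j, M i j ∈ Z}
  mul_mem' := fun {M N} hM hN i j => by
    rw [CStarMatrix.mul_apply]
    exact sum_mem fun k _ => mul_mem (hM i k) (hN k j)
  add_mem' := fun hM hN i j => add_mem (hM i j) (hN i j)
  algebraMap_mem' := fun r i j => by
    rw [CStarMatrix.algebraMap_apply]
    split_ifs
    · exact algebraMap_mem Z r
    · exact zero_mem Z
  star_mem' := fun {M} hM i j => by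
    rw [CStarMatrix.star_apply]
    exact star_mem (hM j i)

theorem mem_matrixSubalgebra {Z : StarSubalgebra ℂ A} {M : CStarMatrix (Fin m) (Fin m) A} :
    M ∈ matrixSubalgebra Z ↔ ∀ i j, M i j ∈ Z := Iff.rfl

theorem coeff_coord (F : InvariantFrame m G) (M : CStarMatrix (Fin m) (Fin m) A) (i j : Fin m) :
    coeff F M (F.ε.coord i) (F.ε.coord j) = M i j := by
  simp [coeff, Finsupp.single_apply]

theorem coeff_mem (F : InvariantFrame m G) {M : CStarMatrix (Fin m) (Fin m) A}
    {Z : StarSubalgebra ℂ A} (hM : ∀ i j, M i j ∈ Z) (l l' : Module.Dual ℝ (Lie m G)) :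
    coeff F M l l' ∈ Z :=
  sum_mem fun _ _ => sum_mem fun _ _ => Z.smul_mem (hM _ _) _

theorem formalDet_mem {M : CStarMatrix (Fin m) (Fin m) A} {Z : StarSubalgebra ℂ A}
    (hM : ∀ i j, M i j ∈ Z) : formalDet M ∈ Z :=
  sum_mem fun _ _ => Z.smul_mem (list_prod_mem fun x hx => by
    obtain ⟨i, rfl⟩ := (List.mem_ofFn' _ _).1 hx
    exact hM _ _) _

/-- Cramer's rule for matrices with central entries: the entries of the inverse are polynomials in
the entries and the inverse of the determinant. -/
theorem inverse_entry_mem {M N : CStarMatrix (Fin m) (Fin m) A} (hM : ∀ i j a, M i j * a = a * M i j)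
    (hN : ∀ i j a, N i j * a = a * N i j) (hMN : M * N = 1) (S : StarSubalgebra ℂ A)
    (hS : ∀ i j, M i j ∈ S) (hd : Ring.inverse (formalDet M) ∈ S) (i j : Fin m) : N i j ∈ S := by
  -- Determinants need a commutative ring: `R` is the centre of `A`, and `R'` is the part of it
  -- lying in `S`. The adjugate of `M` is computed over `R'`, hence has entries in `S`, whereas `N`
  -- is only known over `R`.
  let R := Subalgebra.center ℂ A
  let R' : Subalgebra ℂ R := S.toSubalgebra.comap R.val
  have hc : ∀ {x : A}, (∀ a, x * a = a * x) → x ∈ R := fun h =>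
    Subalgebra.mem_center_iff.2 fun a => (h a).symm
  let M' : Matrix (Fin m) (Fin m) R' := fun i j => ⟨⟨M i j, hc (hM i j)⟩, hS i j⟩
  let N' : Matrix (Fin m) (Fin m) R := fun i j => ⟨N i j, hc (hN i j)⟩
  let ι' : R' →+* R := R'.val.toRingHom
  let ι : R →+* A := R.val.toRingHom
  have hprod : (M'.map ι') * N' = 1 := by
    ext a b
    have := congrFun (congrFun (congrArg CStarMatrix.ofMatrix.symm hMN) a) b
    change (M * N) a b = (1 : Matrix (Fin m) (Fin m) A) a b at this
    rw [CStarMatrix.mul_apply] at this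
    rw [Matrix.mul_apply, AddSubmonoidClass.coe_finsetSum]
    refine Eq.trans this ?_
    simp only [Matrix.one_apply]
    split_ifs <;> rfl
  have hdet : ι (ι' M'.det) = formalDet M := by
    rw [Matrix.det_apply, map_sum, map_sum, formalDet]
    refine Finset.sum_congr rfl fun σ _ => ?_
    have h5 : ι (ι' (∏ i, M' (σ i) i)) = (List.ofFn fun i => M (σ i) i).prod := by
      rw [← List.prod_ofFn, map_list_prod, map_list_prod, List.map_map, List.map_ofFn]
      rfl
    rw [← h5, Units.smul_def, Int.cast_smul_eq_zsmul]
    exact map_zsmul (ι.comp ι') _ _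
  have hu : ι' M'.det * N'.det = 1 := by
    have h1 := congrArg Matrix.det hprod
    rw [Matrix.det_mul, Matrix.det_one] at h1
    rw [RingHom.map_det]
    exact h1
  have hinv : Ring.inverse (formalDet M) = ι N'.det := by
    let u : Aˣ := ⟨formalDet M, ι N'.det, by rw [← hdet, ← map_mul, hu, map_one],
      by rw [← hdet, ← map_mul, mul_comm, hu, map_one]⟩
    exact Ring.inverse_unit u
  have hadj : (M'.adjugate.map ι') = ι' M'.det • N' := by
    have h2 := congrArg (fun X : Matrix (Fin m) (Fin m) R' => X.map ι') (Matrix.adjugate_mul M')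
    simp only [Matrix.map_mul] at h2
    have h3 : M'.adjugate.map ι' = (M'.adjugate.map ι' * M'.map ι') * N' := by
      rw [Matrix.mul_assoc, hprod, Matrix.mul_one]
    rw [h3, h2, Matrix.map_smul' _ _ _ (fun _ _ => map_mul ι' _ _), Matrix.map_one _ (map_zero _) (map_one _),
      Matrix.smul_mul, Matrix.one_mul]
  have hfin : N i j = Ring.inverse (formalDet M) * ι (ι' (M'.adjugate i j)) := by
    have h4 := congrFun (congrFun hadj i) j
    simp only [Matrix.map_apply, Matrix.smul_apply, smul_eq_mul] at h4
    rw [h4, hinv, ← map_mul, ← mul_assoc, mul_comm N'.det, hu, one_mul]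
    rfl
  rw [hfin]
  exact mul_mem hd (M'.adjugate i j).2

theorem isClosed_matrixSubalgebra {Z : StarSubalgebra ℂ A} (hZ : IsClosed (Z : Set A)) :
    IsClosed (matrixSubalgebra (m := m) Z : Set (CStarMatrix (Fin m) (Fin m) A)) := by
  have e : (matrixSubalgebra (m := m) Z : Set (CStarMatrix (Fin m) (Fin m) A)) =
      ⋂ i, ⋂ j, (fun M => M i j) ⁻¹' (Z : Set A) := by
    ext M
    simp only [SetLike.mem_coe, mem_matrixSubalgebra, Set.mem_iInter, Set.mem_preimage]
  rw [e]
  refine isClosed_iInter fun i => isClosed_iInter fun j => hZ.preimage ?_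
  have h : Continuous fun M : Matrix (Fin m) (Fin m) A => M i j := by fun_prop
  exact h.comp (CStarMatrix.ofMatrixL (A := A) (m := Fin m) (n := Fin m)).symm.continuous

variable [PartialOrder A] [StarOrderedRing A]

namespace VerticalMetric

variable {P : PrincipalAlgebra G A} {F : InvariantFrame m G} (ρ : VerticalMetric P F)

theorem mat_mem : ρ.mat ∈ matrixSubalgebra P.invCenter := fun i j =>
  ⟨ρ.central i j, ρ.fixed i j, ρ.even i j⟩

theorem sqrt_mem : ρ.sqrt ∈ matrixSubalgebra P.invCenter :=
  posSqrt_mem (isClosed_matrixSubalgebra P.isClosed_invCenter) ρ.mat_mem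

theorem isSelfAdjoint_sqrt : IsSelfAdjoint ρ.sqrt := isSelfAdjoint_posSqrt ρ.mat

theorem sqrt_mul_sqrt : ρ.sqrt * ρ.sqrt = ρ.mat := posSqrt_mul_posSqrt ρ.nonneg

theorem isUnit_sqrt : IsUnit ρ.sqrt := by
  have h := ρ.isUnit
  rw [← sqrt_mul_sqrt] at h
  exact ((Commute.refl ρ.sqrt).isUnit_mul_iff.1 h).1

theorem inverse_sqrt_mem : Ring.inverse ρ.sqrt ∈ matrixSubalgebra P.invCenter :=
  ringInverse_mem (isClosed_matrixSubalgebra P.isClosed_invCenter) ρ.isUnit_sqrt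
    ρ.isSelfAdjoint_sqrt ρ.sqrt_mem

theorem sqrt_entry_mem (i j : Fin m) : ρ.sqrt i j ∈ ρ.coeffAlgebra :=
  StarAlgebra.subset_adjoin ℂ _ (Or.inl ⟨F.ε.coord i, F.ε.coord j, (coeff_coord F _ i j).symm⟩)

/-- This is what the generator `det(√ρ)⁻¹` of the coefficient algebra is for: with it Cramer's rule
stays inside the algebra. Hence `c(X^♭)`, `c₀` and the cubic term all lie in the Clifford algebra.
-/
theorem inverse_sqrt_entry_mem (i j : Fin m) : Ring.inverse ρ.sqrt i j ∈ ρ.coeffAlgebra :=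
  inverse_entry_mem (fun i j => (ρ.sqrt_mem i j).1) (fun i j => (ρ.inverse_sqrt_mem i j).1)
    (Ring.mul_inverse_cancel _ ρ.isUnit_sqrt) _ ρ.sqrt_entry_mem
    (StarAlgebra.subset_adjoin ℂ _ (Or.inr rfl)) i j

theorem inverse_mat : Ring.inverse ρ.mat = Ring.inverse ρ.sqrt * Ring.inverse ρ.sqrt := by
  rw [← sqrt_mul_sqrt, Ring.mul_inverse_rev' (Commute.refl _)]

theorem inverse_mat_entry_mem (i j : Fin m) : Ring.inverse ρ.mat i j ∈ ρ.coeffAlgebra := by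
  rw [inverse_mat, CStarMatrix.mul_apply]
  exact sum_mem fun k _ => mul_mem (ρ.inverse_sqrt_entry_mem _ _) (ρ.inverse_sqrt_entry_mem _ _)

theorem lower_mem (X Y : Lie m G) : ρ.lower X Y ∈ ρ.coeffAlgebra :=
  sum_mem fun _ _ => sum_mem fun _ _ =>
    ρ.coeffAlgebra.smul_mem (ρ.inverse_mat_entry_mem _ _) _

theorem coeffAlgebra_le : ρ.coeffAlgebra ≤ P.invCenter := by
  refine StarAlgebra.adjoin_le ?_
  rintro a (⟨l, l', rfl⟩ | rfl)
  · exact coeff_mem F ρ.sqrt_mem l l'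
  · exact PrincipalAlgebra.inverse_mem_invCenter (formalDet_mem ρ.sqrt_mem)

end VerticalMetric

end VerticalMetric

/-! ### The grading and the represented Clifford algebra. -/

namespace Background

variable {m n : ℕ} {G A H : Type*} [TopologicalSpace G]
  [ChartedSpace (EuclideanSpace ℝ (Fin m)) G] [Group G]
  [CStarAlgebra A] [PartialOrder A] [StarOrderedRing A]
  [NormedAddCommGroup H] [InnerProductSpace ℂ H] [CompleteSpace H]
  (B : Background m n G A H)

theorem continuous_π : Continuous B.R.π := continuous_starAlgHom B.R.π

theorem twist_mul (S T : H →L[ℂ] H) : B.twist (S * T) = B.twist S * B.twist T := by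
  have h := B.R.γ_sq
  simp only [twist]
  calc B.R.γ * (S * T) * B.R.γ = B.R.γ * S * 1 * T * B.R.γ := by simp only [mul_assoc, one_mul]
    _ = B.R.γ * S * (B.R.γ * B.R.γ) * T * B.R.γ := by rw [h]
    _ = _ := by simp only [mul_assoc]

theorem twist_one : B.twist 1 = 1 := by simp [twist, B.R.γ_sq]

theorem twist_zero : B.twist 0 = 0 := by simp [twist]

theorem twist_add (S T : H →L[ℂ] H) : B.twist (S + T) = B.twist S + B.twist T := by
  simp [twist, mul_add, add_mul]

theorem twist_smul (s : ℂ) (S : H →L[ℂ] H) : B.twist (s • S) = s • B.twist S := by simp [twist]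

theorem twist_sum {ι : Type*} (s : Finset ι) (f : ι → H →L[ℂ] H) :
    B.twist (∑ i ∈ s, f i) = ∑ i ∈ s, B.twist (f i) := by
  simp [twist, Finset.mul_sum, Finset.sum_mul]

theorem twist_star (S : H →L[ℂ] H) : B.twist (star S) = star (B.twist S) := by
  simp [twist, B.R.γ_star, mul_assoc]

theorem twist_π (a : A) : B.twist (B.R.π a) = B.R.π (B.P.gr a) := B.R.π_graded a

theorem twist_of_even {S : H →L[ℂ] H} (hS : S * B.R.γ = B.R.γ * S) : B.twist S = S := by
  rw [twist, ← hS, mul_assoc, B.R.γ_sq, mul_one]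

theorem twist_of_odd {S : H →L[ℂ] H} (hS : B.R.γ * S = -(S * B.R.γ)) : B.twist S = -S := by
  rw [twist, hS, neg_mul, mul_assoc, B.R.γ_sq, mul_one]

theorem γ_apply_γ (ξ : H) : B.R.γ (B.R.γ ξ) = ξ := by
  rw [← mul_apply_eq_comp, B.R.γ_sq]; rfl

theorem twist_c (l : Module.Dual ℝ (Lie m G)) : B.twist (B.c l) = -B.c l :=
  B.twist_of_odd (B.c_odd l)

theorem twist_cε (i : Fin m) : B.twist (B.cε i) = -B.cε i := B.twist_c _

theorem twist_e (i : Fin n) : B.twist (B.R.e i) = -B.R.e i := B.twist_of_odd (B.R.e_odd i)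

theorem twist_π_coeff {f : A} (hf : f ∈ B.ρ.coeffAlgebra) : B.twist (B.R.π f) = B.R.π f := by
  rw [twist_π, (B.ρ.coeffAlgebra_le hf).2.2]

theorem commute_π_coeff {f : A} (hf : f ∈ B.ρ.coeffAlgebra) (a : A) :
    B.R.π f * B.R.π a = B.R.π a * B.R.π f := by
  rw [← map_mul, ← map_mul, (B.ρ.coeffAlgebra_le hf).1]

/-- Induction over the Clifford algebra of the vertical metric. -/
theorem clifford_induction {p : (H →L[ℂ] H) → Prop}
    (hπ : ∀ f ∈ B.ρ.coeffAlgebra, p (B.R.π f)) (hc : ∀ l, p (B.c l))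
    (hadd : ∀ S T, p S → p T → p (S + T)) (hmul : ∀ S T, p S → p T → p (S * T))
    {S : H →L[ℂ] H} (hS : S ∈ B.clifford) : p S := by
  refine Algebra.adjoin_induction (R := ℂ) (p := fun S _ => p S) ?_ ?_ (fun S T _ _ => hadd S T)
    (fun S T _ _ => hmul S T) hS
  · rintro S ((⟨f, hf, rfl⟩ | ⟨l, rfl⟩) | hS)
    · exact hπ f hf
    · exact hc l
    -- The adjoints of generators are generators, since `c(l)* = c(-l)`; no separate case for `star`
    -- is needed.
    · rcases hS with ⟨f, hf, e⟩ | ⟨l, e⟩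
      · have : S = B.R.π (star f) := by rw [map_star, ← e, star_star]
        rw [this]; exact hπ _ (star_mem hf)
      · have : S = B.c (-l) := by rw [map_neg, ← B.c_star, e, star_star]
        rw [this]; exact hc _
  · intro r
    have : algebraMap ℂ (H →L[ℂ] H) r = B.R.π (algebraMap ℂ A r) :=
      (AlgHomClass.commutes B.R.π r).symm
    rw [this]; exact hπ _ (algebraMap_mem _ r)

theorem π_mem_clifford {f : A} (hf : f ∈ B.ρ.coeffAlgebra) : B.R.π f ∈ B.clifford :=
  StarAlgebra.subset_adjoin ℂ _ (Or.inl ⟨f, hf, rfl⟩)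

theorem c_mem_clifford (l : Module.Dual ℝ (Lie m G)) : B.c l ∈ B.clifford :=
  StarAlgebra.subset_adjoin ℂ _ (Or.inr ⟨l, rfl⟩)

theorem cFlat_mem_clifford (X : Lie m G) : B.cFlat X ∈ B.clifford :=
  sum_mem fun _ _ => mul_mem (B.π_mem_clifford (B.ρ.lower_mem _ _)) (B.c_mem_clifford _)

theorem c₀_mem_clifford (j : Fin m) : B.c₀ j ∈ B.clifford :=
  sum_mem fun _ _ => mul_mem (B.π_mem_clifford (B.ρ.inverse_sqrt_entry_mem _ _))
    (B.c_mem_clifford _)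

theorem cubic_mem_clifford : B.cubic ∈ B.clifford :=
  B.clifford.smul_mem (sum_mem fun _ _ => sum_mem fun _ _ => sum_mem fun _ _ =>
    mul_mem (B.π_mem_clifford (B.ρ.lower_mem _ _))
      (mul_mem (mul_mem (B.c_mem_clifford _) (B.c_mem_clifford _)) (B.c_mem_clifford _))) _

theorem twist_cFlat (X : Lie m G) : B.twist (B.cFlat X) = -B.cFlat X := by
  simp only [cFlat, twist_sum, twist_mul, twist_cε, twist_π_coeff _ (B.ρ.lower_mem _ _), mul_neg,
    Finset.sum_neg_distrib]

theorem twist_c₀ (j : Fin m) : B.twist (B.c₀ j) = -B.c₀ j := by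
  simp only [c₀, twist_sum, twist_mul, twist_cε, twist_π_coeff _ (B.ρ.inverse_sqrt_entry_mem _ _),
    mul_neg, Finset.sum_neg_distrib]

theorem cε_mul_π (i : Fin m) (a : A) : B.cε i * B.R.π a = B.R.π (B.P.gr a) * B.cε i :=
  B.c_π _ a

theorem cubic_mul_π (a : A) : B.cubic * B.R.π a = B.R.π (B.P.gr a) * B.cubic := by
  simp only [cubic, smul_mul_assoc, mul_smul_comm, Finset.sum_mul, Finset.mul_sum]
  congr 1
  refine Finset.sum_congr rfl fun i _ => Finset.sum_congr rfl fun j _ =>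
    Finset.sum_congr rfl fun k _ => ?_
  have h : B.cε i * B.cε j * B.cε k * B.R.π a =
      B.R.π (B.P.gr a) * (B.cε i * B.cε j * B.cε k) := by
    rw [mul_assoc, cε_mul_π, ← mul_assoc, mul_assoc (B.cε i), cε_mul_π, B.P.gr_gr, ← mul_assoc,
      cε_mul_π]
    simp only [mul_assoc]
  rw [mul_assoc, h, ← mul_assoc, B.commute_π_coeff (B.ρ.lower_mem _ _), mul_assoc]

end Background

end NCGauge

end

noncomputable section

namespace NCGauge

section Closed

variable {H : Type*} [NormedAddCommGroup H] [InnerProductSpace ℂ H]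

theorem ev_of_tendsto {T : H →ₗ.[ℂ] H} (hT : T.IsClosed) {ι : Type*} {l : Filter ι} [l.NeBot]
    {x : ι → H} {ξ η : H} (hx : ∀ k, x k ∈ T.domain) (h : Tendsto x l (𝓝 ξ))
    (h' : Tendsto (fun k => ev T (x k)) l (𝓝 η)) : ξ ∈ T.domain ∧ ev T ξ = η :=
  mem_graph_iff_ev.1 (hT.mem_of_tendsto (h.prodMk_nhds h')
    (Eventually.of_forall fun k => mem_graph_iff_ev.2 ⟨hx k, rfl⟩))

end Closed

namespace Background

variable {m n : ℕ} {G A H : Type*} [TopologicalSpace G]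
  [ChartedSpace (EuclideanSpace ℝ (Fin m)) G] [Group G]
  [CStarAlgebra A] [PartialOrder A] [StarOrderedRing A]
  [NormedAddCommGroup H] [InnerProductSpace ℂ H] [CompleteSpace H]
  (B : Background m n G A H)

/-! ### Supercommutators and closures -/

variable {B} in
-- The hypothesis says that `(x, y) ↦ (Sx, twist(S) y + Kx)` preserves the graph; being continuous,
-- this map preserves the closure of the graph. For a non-closable operator the closure is by
-- convention the operator itself.
theorem SupercommIs.closure {f : H →ₗ.[ℂ] H} {S K : H →L[ℂ] H} (h : B.SupercommIs f S K) :
    B.SupercommIs f.closure S K := by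
  by_cases hf : f.IsClosable
  · intro ξ hξ
    have h1 := mem_closure_graph hf hξ
    have h2 : Set.MapsTo (fun p : H × H => (S p.1, B.twist S p.2 + K p.1)) f.graph f.graph := by
      rintro ⟨x, y⟩ hxy
      obtain ⟨hx, rfl⟩ := mem_graph_iff_ev.1 hxy
      refine mem_graph_iff_ev.2 ⟨(h x hx).1, ?_⟩
      rw [← (h x hx).2]; abel
    have h3 := mem_closure_of_closable hf (h2.closure (by fun_prop) h1)
    exact ⟨h3.1, by rw [h3.2]; abel⟩
  · rwa [LinearPMap.closure_def' hf]

theorem supercommIs_of_core {T : H →ₗ.[ℂ] H} (hT : T.IsClosed) {V : Submodule ℂ H}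
    (hV : T.HasCore V) {S K : H →L[ℂ] H}
    (h : ∀ ξ ∈ V, S ξ ∈ T.domain ∧ ev T (S ξ) - B.twist S (ev T ξ) = K ξ) :
    B.SupercommIs T S K := by
  intro ξ hξ
  obtain ⟨x, hx, h1, h2⟩ := exists_seq_of_hasCore hT hV hξ
  have h3 := ev_of_tendsto hT (fun k => (h (x k) (hx k)).1) ((S.continuous.tendsto _).comp h1)
    (η := B.twist S (ev T ξ) + K ξ)
    ((((B.twist S).continuous.tendsto _).comp h2).add ((K.continuous.tendsto _).comp h1) |>.congr
      fun k => by simp only [Function.comp]; rw [← (h (x k) (hx k)).2]; abel)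
  exact ⟨h3.1, by rw [h3.2]; abel⟩

/-! ### The approximate unit of a unital algebra -/

/-- In a unital algebra `φ_k = φ_k · 1` tends to `1`, and units form an open set. All localisation
by elements of `𝒜` is removed by means of this one invertible `φ_k`. -/
theorem exists_isUnit_φ : ∃ k, IsUnit (B.φ k) := by
  have h : Tendsto B.φ atTop (𝓝 1) := by
    have := B.φ_approx.tendsto_mul_left 1
    simpa [Function.comp_def] using tendsto_map'_iff.1 this
  exact (h.eventually (Units.isOpen.mem_nhds isUnit_one)).exists

/-- An index at which the approximate unit is invertible. -/
def unitIndex : ℕ := B.exists_isUnit_φ.choose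

/-- An invertible element of `𝒜^G`. -/
def φu : A := B.φ B.unitIndex

/-- The inverse of `φu`. -/
def ψu : A := Ring.inverse B.φu

theorem φu_mem : B.φu ∈ B.𝒜 := B.φ_mem _

theorem φu_fixed : B.P.Fixed B.φu := B.φ_fixed _

theorem ψu_fixed : B.P.Fixed B.ψu := B.φu_fixed.inverse

theorem φu_mul_ψu : B.φu * B.ψu = 1 := Ring.mul_inverse_cancel _ B.exists_isUnit_φ.choose_spec

theorem ψu_mul_φu : B.ψu * B.φu = 1 := Ring.inverse_mul_cancel _ B.exists_isUnit_φ.choose_spec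

theorem π_ψu_φu (ξ : H) : B.R.π B.ψu (B.R.π B.φu ξ) = ξ := by
  rw [← mul_apply_eq_comp, ← map_mul, ψu_mul_φu, map_one]; rfl

theorem π_φu_ψu (ξ : H) : B.R.π B.φu (B.R.π B.ψu ξ) = ξ := by
  rw [← mul_apply_eq_comp, ← map_mul, φu_mul_ψu, map_one]; rfl

theorem π_gr_ψu_φu (ξ : H) : B.R.π (B.P.gr B.ψu) (B.R.π (B.P.gr B.φu) ξ) = ξ := by
  rw [← mul_apply_eq_comp, ← map_mul, ← map_mul, ψu_mul_φu, map_one, map_one]; rfl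

theorem le_mulSpace {V : Submodule ℂ H} (hV : ∀ ξ ∈ V, B.R.π B.ψu ξ ∈ V) : V ≤ B.mulSpace V :=
  fun ξ hξ => Submodule.subset_span ⟨B.φu, B.φu_mem, _, hV ξ hξ, (B.π_φu_ψu ξ).symm⟩

theorem mulSpace_top : B.mulSpace ⊤ = ⊤ := top_le_iff.1 (B.le_mulSpace fun _ _ => trivial)

variable {B} {D : H →ₗ.[ℂ] H}

theorem IsAdmissible.isClosed (hD : B.IsAdmissible D) : D.IsClosed := hD.triple.selfAdjoint.isClosed

theorem IsAdmissible.symm (hD : B.IsAdmissible D) : Symm D :=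
  symm_of_isSelfAdjoint hD.triple.selfAdjoint

theorem inf_mulSpace_top (D : H →ₗ.[ℂ] H) : D.domain ⊓ B.mulSpace ⊤ = D.domain := by
  rw [mulSpace_top, inf_top_eq]

theorem IsAdmissible.dom_le_C1 (hD : B.IsAdmissible D) : D.domain ≤ B.C1 := by
  have := hD.triple.C1
  rwa [inf_mulSpace_top] at this

theorem IsAdmissible.c_mem (hD : B.IsAdmissible D) (l : Module.Dual ℝ (Lie m G)) {ξ : H}
    (hξ : ξ ∈ D.domain) : B.c l ξ ∈ D.domain :=
  hD.geometry.clifford_dom l ξ (by rwa [inf_mulSpace_top])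

theorem IsAdmissible.clifford_mem (hD : B.IsAdmissible D) {S : H →L[ℂ] H} (hS : S ∈ B.clifford)
    {ξ : H} (hξ : ξ ∈ D.domain) : S ξ ∈ D.domain := by
  refine B.clifford_induction (p := fun S => ∀ ξ ∈ D.domain, S ξ ∈ D.domain)
    (fun f hf ξ hξ => hD.geometry.coeff_dom f hf ξ (by rwa [inf_mulSpace_top]))
    (fun l ξ hξ => hD.c_mem l hξ) (fun S T hS hT ξ hξ => add_mem (hS ξ hξ) (hT ξ hξ))
    (fun S T hS hT ξ hξ => hS _ (hT ξ hξ)) hS ξ hξ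

theorem IsAdmissible.π_mem (hD : B.IsAdmissible D) {a : A} (ha : a ∈ B.𝒜) {ξ : H}
    (hξ : ξ ∈ D.domain) : B.R.π a ξ ∈ D.domain := by
  obtain ⟨K, hK⟩ := hD.triple.lipschitz a ha
  exact (hK ξ hξ).1

theorem IsAdmissible.surjI (hD : B.IsAdmissible D) : SurjI D := fun η => by
  obtain ⟨Q, hQ, -⟩ := hD.triple.resolvent
  exact ⟨Q η, hQ η⟩

/-! ### Equivariant finite-rank approximation of the identity -/

/-- The eigenprojections of `Q Q*`, where `Q = (D + i)⁻¹`, are equivariant finite-rank projections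
into the domain of `D` that converge strongly to the identity. -/
theorem IsAdmissible.exists_projections (hD : B.IsAdmissible D) :
    ∃ P : Finset {μ : ℂ // μ ≠ 0} → H →L[ℂ] H, (∀ F g, P F * B.u g = B.u g * P F) ∧
      (∀ F ξ, P F ξ ∈ D.domain) ∧ (∀ F ξ, P F ξ ∈ B.alg) ∧
      ∀ ξ, Tendsto (fun F => P F ξ) atTop (𝓝 ξ) := by
  obtain ⟨Q, hQ, hcomp⟩ := hD.triple.resolvent
  have hsym := hD.symm
  -- Only `π(a)Q` is assumed compact; for `a = φu` the factor `π(φu)` can be cancelled.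
  have hQc : IsCompactOperator Q := by
    have h := (hcomp B.φu B.φu_mem).clm_comp (B.R.π B.ψu)
    have e : (fun ξ => B.R.π B.ψu ((B.R.π B.φu * Q) ξ)) = Q := by
      funext ξ; exact B.π_ψu_φu _
    exact e ▸ h
  have huniq : ∀ ξ ∈ D.domain, Q (ev D ξ + Complex.I • ξ) = ξ := fun ξ hξ =>
    hsym.injective (hQ _).1 hξ (hQ _).2
  have hQu : ∀ g, Q * B.u g = B.u g * Q := fun g => by
    ext ξ
    have h1 := hD.triple.invariant g (Q ξ) (hQ ξ).1
    have h2 := huniq _ h1.1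
    rw [h1.2, ← map_smul, ← map_add, (hQ ξ).2] at h2
    exact h2
  have hQu' : ∀ g, star Q * B.u g = B.u g * star Q := fun g => by
    have h := congrArg star (hQu g⁻¹)
    rw [star_mul, star_mul, star_u, inv_inv] at h
    exact h.symm
  -- `Q` itself need not be self-adjoint, but `Q Q*` is, and it is compact and commutes with `U`. It
  -- is injective because the range of `Q` is the dense subspace `Dom D`, and its eigenvectors for
  -- nonzero eigenvalues lie in that range.
  set T : H →L[ℂ] H := Q * star Q with hT
  have hTu : ∀ g, T * B.u g = B.u g * T := fun g => by
    rw [hT, mul_assoc, hQu', ← mul_assoc, hQu, mul_assoc]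
  have hTc : IsCompactOperator T := hQc.comp_clm (star Q)
  have hTs : (T : H →ₗ[ℂ] H).IsSymmetric :=
    ContinuousLinearMap.isSelfAdjoint_iff_isSymmetric.1 (IsSelfAdjoint.mul_star_self Q)
  have hker : ∀ ξ, T ξ = 0 → ξ = 0 := by
    intro ξ hξ
    have h1 : star Q ξ = 0 := by
      rw [← inner_self_eq_zero (𝕜 := ℂ)]
      nth_rewrite 1 [ContinuousLinearMap.star_eq_adjoint]
      rw [ContinuousLinearMap.adjoint_inner_left]
      change ⟪ξ, T ξ⟫_ℂ = 0
      rw [hξ, inner_zero_right]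
    refine hD.triple.dense.eq_zero_of_inner_left (𝕜 := ℂ) fun η hη => ?_
    rw [← huniq η hη, ← ContinuousLinearMap.adjoint_inner_left,
      ← ContinuousLinearMap.star_eq_adjoint, h1, inner_zero_left]
  let E : {μ : ℂ // μ ≠ 0} → Submodule ℂ H := fun μ => Module.End.eigenspace (T : H →ₗ[ℂ] H) μ
  have hfin : ∀ μ, FiniteDimensional ℂ (E μ) := fun μ =>
    ContinuousLinearMap.finite_dimensional_eigenspace hTc μ μ.2
  let W : Finset {μ : ℂ // μ ≠ 0} → Submodule ℂ H := fun F => ⨆ μ : F, E μ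
  have hWfin : ∀ F, FiniteDimensional ℂ (W F) := fun F => Submodule.finiteDimensional_iSup _
  have hEinv : ∀ μ g, ∀ ξ ∈ E μ, B.u g ξ ∈ E μ := fun μ g ξ hξ => by
    have h1 : T ξ = (μ : ℂ) • ξ := Module.End.mem_eigenspace_iff.1 hξ
    refine Module.End.mem_eigenspace_iff.2 ?_
    have h2 := DFunLike.congr_fun (hTu g) ξ
    change T (B.u g ξ) = B.u g (T ξ) at h2
    rw [h1, map_smul] at h2
    exact h2
  have hWinv : ∀ F g, ∀ ξ ∈ W F, B.u g ξ ∈ W F := fun F g => by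
    have : W F ≤ (W F).comap (B.u g).toLinearMap := iSup_le fun μ ξ hξ =>
      Submodule.mem_iSup_of_mem μ (hEinv μ g ξ hξ)
    exact this
  have hWdom : ∀ F, W F ≤ D.domain := fun F => iSup_le fun μ ξ hξ => by
    have h1 : T ξ = (μ : ℂ) • ξ := Module.End.mem_eigenspace_iff.1 hξ
    have h2 : ξ = ((μ : ℂ))⁻¹ • Q (star Q ξ) := by
      change _ = ((μ : ℂ))⁻¹ • T ξ
      rw [h1, smul_smul, inv_mul_cancel₀ μ.1.2, one_smul]
    rw [h2]
    exact D.domain.smul_mem _ (hQ _).1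
  have hmono : Monotone W := fun F F' h => iSup_le fun μ =>
    le_iSup_of_le (⟨μ.1, h μ.2⟩ : F') le_rfl
  -- All eigenspaces together are total by the spectral theorem, and the eigenvalue `0`, which is
  -- excluded from `W`, contributes nothing by `hker`.
  have hdense : ⊤ ≤ (⨆ F, W F).topologicalClosure := by
    rw [top_le_iff, Submodule.topologicalClosure_eq_top_iff, eq_bot_iff,
      ← ContinuousLinearMap.orthogonalComplement_iSup_eigenspaces_eq_bot hTc hTs]
    refine Submodule.orthogonal_le (iSup_le fun μ => ?_)
    by_cases hμ : μ = 0
    · intro ξ hξ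
      rw [hμ] at hξ
      have h1 := Module.End.mem_eigenspace_iff.1 hξ
      rw [zero_smul] at h1
      rw [hker ξ h1]
      exact zero_mem _
    · exact le_iSup_of_le {⟨μ, hμ⟩} (le_iSup_of_le ⟨⟨μ, hμ⟩, Finset.mem_singleton_self _⟩ le_rfl)
  refine ⟨fun F => (W F).starProjection, fun F g => ?_,
    fun F ξ => hWdom F (Submodule.starProjection_apply_mem _ _), fun F ξ => ?_,
    fun ξ => Submodule.starProjection_tendsto_self W hmono ξ hdense⟩
  · ext ξ
    refine Submodule.eq_starProjection_of_mem_of_inner_eq_zero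
      (hWinv F g _ (Submodule.starProjection_apply_mem _ _)) fun w hw => ?_
    change ⟪B.u g ξ - B.u g ((W F).starProjection ξ), w⟫_ℂ = 0
    rw [← map_sub, inner_u]
    exact Submodule.starProjection_inner_eq_zero _ _ (hWinv F _ w hw)
  · exact (le_sSup (a := W F) ⟨hWfin F, hWinv F⟩ : W F ≤ B.alg)
      (Submodule.starProjection_apply_mem _ _)

end Background

end NCGauge

end

noncomputable section

namespace NCGauge

theorem continuousAt_curve {m : ℕ} {G : Type*} [TopologicalSpace G]
    [ChartedSpace (EuclideanSpace ℝ (Fin m)) G] [Group G] (X : Lie m G) :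
    ContinuousAt (fun s => (curve X s : G)) 0 := by
  have h : ContinuousAt (extChartAt (𝓡 m) (1 : G)).symm
      (extChartAt (𝓡 m) (1 : G) 1 + (0 : ℝ) • toModel X) := by
    rw [zero_smul, add_zero]
    exact continuousAt_extChartAt_symm (I := 𝓡 m) (1 : G)
  exact ContinuousAt.comp (f := fun s : ℝ => extChartAt (𝓡 m) (1 : G) 1 + s • toModel X) h
    (by fun_prop)

namespace Background

variable {m n : ℕ} {G A H : Type*} [TopologicalSpace G]
  [ChartedSpace (EuclideanSpace ℝ (Fin m)) G] [Group G]
  [CStarAlgebra A] [PartialOrder A] [StarOrderedRing A]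
  [NormedAddCommGroup H] [InnerProductSpace ℂ H] [CompleteSpace H]
  (B : Background m n G A H)

/-! ### The vertical Dirac operator on `C¹` vectors -/

/-- The expression of the vertical Dirac operator on `C¹` vectors. -/
def dv (ξ : H) : H := ∑ i, B.cε i (B.dU (B.F.ε i) ξ) - B.cubic ξ

theorem ev_cubicDirac {ξ : H} (hξ : ξ ∈ B.alg ⊓ B.C1) : ev B.cubicDirac ξ = B.dv ξ := by
  rw [ev_of_mem (T := B.cubicDirac) hξ]; rfl

/-- The differential of the representation as a linear map on the `C¹` vectors. -/
def dUₗ (X : Lie m G) : B.C1 →ₗ[ℂ] H where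
  toFun ξ := B.dU X ξ
  map_add' ξ η := B.dU_add X ξ.2 η.2
  map_smul' s ξ := B.dU_smul X s ξ.2

theorem dU_sum (X : Lie m G) {ι : Type*} (s : Finset ι) {f : ι → H} (hf : ∀ i, f i ∈ B.C1) :
    B.dU X (∑ i ∈ s, f i) = ∑ i ∈ s, B.dU X (f i) := by
  have h := map_sum (B.dUₗ X) (fun i => (⟨f i, hf i⟩ : B.C1)) s
  have e : ((∑ i ∈ s, (⟨f i, hf i⟩ : B.C1) : B.C1) : H) = ∑ i ∈ s, f i := by
    simp
  rw [← e]
  exact h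

variable {B} {D : H →ₗ.[ℂ] H}

/-- Local boundedness controls `μ(X)φu` and adequacy controls `[μ(X), φu]`. Their difference
controls `φu μ(X)`, from which `φu` is cancelled. -/
theorem IsAdmissible.moment_bound (hD : B.IsAdmissible D) (X : Lie m G) :
    ∃ C : ℝ, 0 ≤ C ∧ ∀ ξ ∈ D.domain, ‖B.moment D X ξ‖ ≤ C * ‖ξ‖ := by
  obtain ⟨h1, ⟨C, hC⟩, -⟩ := hD.geometry.moment_bdd X
  rw [inf_mulSpace_top] at h1 hC
  obtain ⟨K, hK⟩ := h1 _ B.φu_mem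
  refine ⟨‖B.R.π B.ψu‖ * (‖K‖ + |C|), by positivity, fun ξ hξ => ?_⟩
  have h2 := hC B.unitIndex ξ hξ
  change ‖B.moment D X (B.R.π B.φu ξ) - B.R.π B.φu (B.moment D X ξ)‖ ≤ C * ‖ξ‖ at h2
  rw [(hK ξ hξ).2] at h2
  have h3 : ‖B.R.π B.φu (B.moment D X ξ)‖ ≤ (‖K‖ + |C|) * ‖ξ‖ := by
    have h4 := norm_le_insert (K ξ) (B.R.π B.φu (B.moment D X ξ))
    have h5 := K.le_opNorm ξ
    have h6 := mul_le_mul_of_nonneg_right (le_abs_self C) (norm_nonneg ξ)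
    linarith
  rw [← B.π_ψu_φu (B.moment D X ξ), mul_assoc]
  exact ((B.R.π B.ψu).le_opNorm _).trans (mul_le_mul_of_nonneg_left h3 (norm_nonneg _))

variable [LieGroup (𝓡 m) ∞ G]

/-- Both `c(εⁱ)` and `dU(εᵢ)` are skew. Taking `η` in `Dom D` ensures that `c(εⁱ)η` is again a `C¹`
vector. The density of `Dom D` then makes the cubic Dirac operator closable. -/
theorem IsAdmissible.inner_dv (hD : B.IsAdmissible D) {η ξ : H} (hη : η ∈ D.domain)
    (hξ : ξ ∈ B.C1) : ⟪η, B.dv ξ⟫_ℂ =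
      ⟪∑ i, B.dU (B.F.ε i) (B.cε i η) - star B.cubic η, ξ⟫_ℂ := by
  rw [dv, inner_sub_right, inner_sub_left, inner_sum, sum_inner]
  congr 1
  · refine Finset.sum_congr rfl fun i _ => ?_
    have hcη : B.cε i η ∈ B.C1 := hD.dom_le_C1 (hD.c_mem _ hη)
    rw [B.inner_dU hcη hξ, ← ContinuousLinearMap.adjoint_inner_left,
      ← ContinuousLinearMap.star_eq_adjoint, cε, B.c_star, neg_apply, inner_neg_left]
  · rw [ContinuousLinearMap.star_eq_adjoint, ContinuousLinearMap.adjoint_inner_left]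

theorem IsAdmissible.isClosable_cubicDirac (hD : B.IsAdmissible D) : B.cubicDirac.IsClosable :=
  isClosable_of_formal_adjoint hD.triple.dense fun _ hη => ⟨_, fun _ hξ => by
    rw [B.ev_cubicDirac hξ]; exact hD.inner_dv hη hξ.2⟩

theorem IsAdmissible.isClosed_Dv (hD : B.IsAdmissible D) : B.Dv.IsClosed :=
  hD.isClosable_cubicDirac.closure_isClosed

/-- Operators commuting with `U` commute with `dU`, so the derivatives of `P_F ξ` are `P_F` applied
to the derivatives of `ξ`. -/
theorem IsAdmissible.tendsto_dv {P : Finset {μ : ℂ // μ ≠ 0} → H →L[ℂ] H}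
    (h1 : ∀ F g, P F * B.u g = B.u g * P F)
    (h4 : ∀ ξ, Tendsto (fun F => P F ξ) atTop (𝓝 ξ)) {ξ : H} (hξ : ξ ∈ B.C1) :
    Tendsto (fun F => B.dv (P F ξ)) atTop (𝓝 (B.dv ξ)) := by
  have e : ∀ F, B.dv (P F ξ) = ∑ i, B.cε i (P F (B.dU (B.F.ε i) ξ)) - B.cubic (P F ξ) := fun F => by
    rw [dv]
    congr 1
    exact Finset.sum_congr rfl fun i _ => by rw [B.dU_of_commute (h1 F) hξ]
  simp only [e]
  exact (tendsto_finsetSum _ fun i _ => ((B.cε i).continuous.tendsto _).comp (h4 _)).sub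
    ((B.cubic.continuous.tendsto _).comp (h4 _))

/-- `D_v` is a closure from algebraic vectors, whereas vectors of `Dom D` are only known to be `C¹`.
The equivariant projections bridge the gap: `P_F ξ` is algebraic and converges to `ξ` in the graph
norm of `D_v`. -/
theorem IsAdmissible.C1_le (hD : B.IsAdmissible D) {ξ : H} (hξ : ξ ∈ B.C1) :
    ξ ∈ B.Dv.domain ∧ ev B.Dv ξ = B.dv ξ := by
  obtain ⟨P, h1, h2, h3, h4⟩ := hD.exists_projections
  have hle : B.cubicDirac ≤ B.Dv := LinearPMap.le_closure _
  have hP : ∀ F, P F ξ ∈ B.alg ⊓ B.C1 := fun F => ⟨h3 F ξ, hD.dom_le_C1 (h2 F ξ)⟩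
  refine ev_of_tendsto hD.isClosed_Dv (fun F => hle.1 (hP F)) (h4 ξ) ?_
  refine (IsAdmissible.tendsto_dv h1 h4 hξ).congr fun F => ?_
  rw [ev_of_le hle (hP F), B.ev_cubicDirac (hP F)]

theorem IsAdmissible.dom_le (hD : B.IsAdmissible D) : D.domain ≤ B.Dv.domain := fun _ hξ =>
  (hD.C1_le (hD.dom_le_C1 hξ)).1

theorem IsAdmissible.ev_Dv (hD : B.IsAdmissible D) {ξ : H} (hξ : ξ ∈ D.domain) :
    ev B.Dv ξ = B.dv ξ := (hD.C1_le (hD.dom_le_C1 hξ)).2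

/-- The same projections in the other direction: they move algebraic `C¹` vectors into `Dom D` with
convergence in graph norm. -/
theorem IsAdmissible.hasCore_Dv (hD : B.IsAdmissible D) : B.Dv.HasCore D.domain := by
  refine hasCore_of_mem_closure hD.isClosed_Dv hD.dom_le fun ξ hξ => ?_
  have h := mem_closure_graph hD.isClosable_cubicDirac hξ
  refine closure_minimal ?_ isClosed_closure h
  rintro ⟨x, y⟩ hxy
  obtain ⟨hx, rfl⟩ := mem_graph_iff_ev.1 hxy
  obtain ⟨P, h1, h2, h3, h4⟩ := hD.exists_projections
  refine mem_closure_of_tendsto (f := fun F => (P F x, ev B.Dv (P F x))) (b := atTop)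
    ((h4 x).prodMk_nhds ?_) (Eventually.of_forall fun F => ⟨_, h2 F x, rfl⟩)
  rw [B.ev_cubicDirac hx]
  exact (IsAdmissible.tendsto_dv h1 h4 hx.2).congr fun F => (hD.ev_Dv (h2 F x)).symm

theorem IsAdmissible.supercommIs_Dv (hD : B.IsAdmissible D) {S K : H →L[ℂ] H}
    (h : ∀ ξ ∈ D.domain, S ξ ∈ B.C1 ∧ B.dv (S ξ) = B.twist S (B.dv ξ) + K ξ) :
    B.SupercommIs B.Dv S K := by
  refine B.supercommIs_of_core hD.isClosed_Dv hD.hasCore_Dv fun ξ hξ => ?_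
  have h1 := hD.C1_le (h ξ hξ).1
  refine ⟨h1.1, ?_⟩
  rw [h1.2, (h ξ hξ).2, hD.ev_Dv hξ, add_sub_cancel_left]

/-- Both `c(εⁱ)` and the cubic term supercommute with `A`, so only the Leibniz term of `dU`
survives. As a result `𝒜` acts by bounded operators on `Dom D_v` with its graph norm. -/
theorem IsAdmissible.supercommIs_Dv_π (hD : B.IsAdmissible D) {a : A} (ha : a ∈ B.𝒜) :
    B.SupercommIs B.Dv (B.R.π a) (∑ i, B.cε i * B.R.π (B.dα (B.F.ε i) a)) := by
  refine hD.supercommIs_Dv fun ξ hξ => ⟨B.π_mem_C1 ha (hD.dom_le_C1 hξ), ?_⟩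
  have h1 : ∀ i, B.cε i (B.dU (B.F.ε i) (B.R.π a ξ)) =
      B.R.π (B.P.gr a) (B.cε i (B.dU (B.F.ε i) ξ)) +
        (B.cε i * B.R.π (B.dα (B.F.ε i) a)) ξ := fun i => by
    rw [B.dU_π ha (hD.dom_le_C1 hξ), map_add]
    congr 1
    exact DFunLike.congr_fun (B.cε_mul_π i a) _
  have h2 : B.cubic (B.R.π a ξ) = B.R.π (B.P.gr a) (B.cubic ξ) :=
    DFunLike.congr_fun (B.cubic_mul_π a) ξ
  rw [dv, h2, Finset.sum_congr rfl fun i _ => h1 i, Finset.sum_add_distrib, B.twist_π, dv, map_sub,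
    map_sum, sum_apply]
  abel

theorem IsAdmissible.supercommIs_Dv_of_commute (hD : B.IsAdmissible D) {S S' : H →L[ℂ] H}
    (hS' : B.twist S = S') (hu : ∀ g, S * B.u g = B.u g * S) (hc : ∀ i, B.cε i * S = S' * B.cε i)
    (hq : B.cubic * S = S' * B.cubic) : B.SupercommIs B.Dv S 0 := by
  refine hD.supercommIs_Dv fun ξ hξ => ⟨B.mem_C1_of_commute hu (hD.dom_le_C1 hξ), ?_⟩
  have h1 : ∀ i, B.cε i (B.dU (B.F.ε i) (S ξ)) = S' (B.cε i (B.dU (B.F.ε i) ξ)) := fun i => by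
    rw [B.dU_of_commute hu (hD.dom_le_C1 hξ)]
    exact DFunLike.congr_fun (hc i) _
  have h2 : B.cubic (S ξ) = S' (B.cubic ξ) := DFunLike.congr_fun hq ξ
  rw [dv, h2, Finset.sum_congr rfl fun i _ => h1 i, hS', dv, map_sub, map_sum, zero_apply, add_zero]

theorem IsAdmissible.supercommIs_Dv_fixed (hD : B.IsAdmissible D) {b : A} (hb : B.P.Fixed b) :
    B.SupercommIs B.Dv (B.R.π b) 0 :=
  hD.supercommIs_Dv_of_commute (B.twist_π b) (B.commute_π_of_fixed hb) (fun i => B.cε_mul_π i b)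
    (B.cubic_mul_π b)

theorem IsAdmissible.mulSpace_Dv (hD : B.IsAdmissible D) : B.Dv.domain ≤ B.mulSpace B.Dv.domain :=
  B.le_mulSpace fun ξ hξ => (hD.supercommIs_Dv_fixed B.ψu_fixed ξ hξ).1

/-- `Dom D ⊆ Dom D_v ⊆ 𝒜 · Dom D_v`, the last inclusion because `ξ = φu(ψu ξ)` and `ψu` preserves
`Dom D_v`. The domains in the definitions of potentials and gauge transformations are therefore just
`Dom D`. -/
theorem IsAdmissible.smoothDom_eq (hD : B.IsAdmissible D) : B.smoothDom D = D.domain :=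
  inf_eq_left.2 (hD.dom_le.trans hD.mulSpace_Dv)

theorem IsAdmissible.jointDom_eq (hD : B.IsAdmissible D) (E : H →ₗ.[ℂ] H) :
    B.jointDom D E = D.domain ⊓ E.domain :=
  inf_eq_left.2 (inf_le_left.trans (hD.dom_le.trans hD.mulSpace_Dv))

/-! ### The moment map and the basic estimate -/

theorem IsAdmissible.exists_dU_cFlat (hD : B.IsAdmissible D) (X : Lie m G) :
    ∃ K : H →L[ℂ] H, ∀ ξ ∈ D.domain,
      B.dU X (B.cFlat X ξ) = B.cFlat X (B.dU X ξ) + K ξ := by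
  choose K hK using fun i => B.exists_dU_c X (B.F.ε.coord i)
  have hfix : ∀ i g, B.R.π (B.ρ.lower X (B.F.ε i)) * B.u g =
      B.u g * B.R.π (B.ρ.lower X (B.F.ε i)) := fun i =>
    B.commute_π_of_fixed (B.ρ.coeffAlgebra_le (B.ρ.lower_mem _ _)).2.1
  refine ⟨∑ i, B.R.π (B.ρ.lower X (B.F.ε i)) * K i, fun ξ hξ => ?_⟩
  have hc : ∀ i, B.cε i ξ ∈ B.C1 := fun i => hD.dom_le_C1 (hD.c_mem _ hξ)
  simp only [cFlat, sum_apply, mul_apply_eq_comp]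
  rw [B.dU_sum X _ fun i => B.mem_C1_of_commute (hfix i) (hc i), ← Finset.sum_add_distrib]
  refine Finset.sum_congr rfl fun i _ => ?_
  rw [B.dU_of_commute (hfix i) (hc i), cε, hK i ξ (hD.dom_le_C1 hξ) (hc i), map_add]

/-- Formally `E` commutes with the skew operator `dU(X)`, but neither `dU(X)ξ ∈ Dom E` nor the
differentiability of `U_g Eξ` is known. The proof therefore differentiates `⟪Eη, U_s ξ⟫ = ⟪η, Eξ⟫ -
⟪U_s η - η, U_s Eξ⟫`. -/
theorem inner_ev_dU {E : H →ₗ.[ℂ] H} (hE : Symm E) (hG : B.GInvariant E) {ξ η : H}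
    (hξ : ξ ∈ E.domain) (hη : η ∈ E.domain) (hξ' : ξ ∈ B.C1) (hη' : η ∈ B.C1) (X : Lie m G) :
    ⟪ev E η, B.dU X ξ⟫_ℂ = -⟪B.dU X η, ev E ξ⟫_ℂ := by
  have h1 : HasDerivAt (fun s => ⟪ev E η, B.u (curve X s) ξ⟫_ℂ) ⟪ev E η, B.dU X ξ⟫_ℂ 0 := by
    simpa using (hasDerivAt_const (0 : ℝ) (ev E η)).inner ℂ (B.hasDerivAt_u hξ' X)
  -- The first factor vanishes at `s = 0`, so mere continuity of the second factor suffices.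
  have h2 : HasDerivAt (fun s => ⟪B.u (curve X s) η - η, B.u (curve X s) (ev E ξ)⟫_ℂ)
      ⟪B.dU X η, ev E ξ⟫_ℂ 0 := by
    rw [hasDerivAt_iff_tendsto_slope]
    have h3 := hasDerivAt_iff_tendsto_slope.1 (B.hasDerivAt_u hη' X)
    have h4 : Tendsto (fun s => B.u (curve X s) (ev E ξ)) (𝓝[≠] (0 : ℝ)) (𝓝 (ev E ξ)) := by
      have h5 : ContinuousAt (fun s => B.u (curve X s) (ev E ξ)) 0 :=
        (B.R.U_continuous (ev E ξ)).continuousAt.comp (continuousAt_curve X)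
      have h6 := h5.tendsto
      rw [curve_zero, u_one] at h6
      exact h6.mono_left nhdsWithin_le_nhds
    refine (h3.inner (𝕜 := ℂ) h4).congr fun s => ?_
    simp only [slope, curve_zero, u_one, vsub_eq_sub, sub_zero, one_apply_eq_self, sub_self,
      inner_zero_left]
    exact inner_smul_left_eq_smul _ _ _
  have h5 : ∀ s, ⟪ev E η, B.u (curve X s) ξ⟫_ℂ =
      ⟪η, ev E ξ⟫_ℂ - ⟪B.u (curve X s) η - η, B.u (curve X s) (ev E ξ)⟫_ℂ := fun s => by
    obtain ⟨h6, h7⟩ := hG (curve X s) ξ hξ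
    rw [hE η hη _ h6, h7, inner_sub_left, B.inner_u_u]
    ring
  have h6 := (h2.const_sub ⟪η, ev E ξ⟫_ℂ).congr_of_eventuallyEq (Eventually.of_forall h5)
  exact h1.unique h6

/-- Garding-type estimate: the vertical derivatives are relatively bounded, uniformly over all
symmetric invariant operators with the same domain and the same vertical symbol. -/
theorem IsAdmissible.dU_bound (hD : B.IsAdmissible D) (X : Lie m G) :
    ∃ C : ℝ, 0 ≤ C ∧ ∀ E : H →ₗ.[ℂ] H, E.domain = D.domain → Symm E → B.GInvariant E →
      (∀ ξ ∈ D.domain, ev E (B.cFlat X ξ) + B.cFlat X (ev E ξ) =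
        ev D (B.cFlat X ξ) + B.cFlat X (ev D ξ)) →
      ∀ ξ ∈ D.domain, ‖B.dU X ξ‖ ≤ C * (‖ev E ξ‖ + ‖ξ‖) := by
  obtain ⟨Cm, hCm, hm⟩ := hD.moment_bound X
  obtain ⟨K, hK⟩ := hD.exists_dU_cFlat X
  set c := B.cFlat X with hc
  refine ⟨2 * (‖c‖ + 1 + Cm + ‖K‖), by positivity, fun E hdom hE hG hcomm ξ hξ => ?_⟩
  have hcξ : c ξ ∈ D.domain := hD.clifford_mem (B.cFlat_mem_clifford X) hξ
  set x := ‖B.dU X ξ‖ with hx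
  set e := ‖ev E ξ‖ with he
  set z := ‖ξ‖ with hz
  have h1 := inner_ev_dU (B := B) hE hG (hdom ▸ hξ) (hdom ▸ hcξ) (hD.dom_le_C1 hξ)
    (hD.dom_le_C1 hcξ) X
  -- Equality of anticommutators replaces `D` by `E` in the moment map, so every constant comes from
  -- `D` alone.
  have h2 : B.dU X ξ = -(1 / 2 : ℂ) • (ev E (c ξ) + c (ev E ξ)) - B.moment D X ξ := by
    rw [hcomm ξ hξ, moment]; abel
  -- The derivative is moved onto `cξ`, where it differs from `c dU(X)ξ` by the bounded term `K`.
  have h3 : ‖⟪ev E (c ξ), B.dU X ξ⟫_ℂ‖ ≤ (‖c‖ * x + ‖K‖ * z) * e := by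
    rw [h1, norm_neg]
    refine (norm_inner_le_norm _ _).trans (mul_le_mul_of_nonneg_right ?_ (norm_nonneg _))
    rw [hK ξ hξ]
    exact (norm_add_le _ _).trans (add_le_add (c.le_opNorm _) (K.le_opNorm _))
  have h4 : ‖⟪c (ev E ξ), B.dU X ξ⟫_ℂ‖ ≤ ‖c‖ * e * x :=
    (norm_inner_le_norm _ _).trans (mul_le_mul_of_nonneg_right (c.le_opNorm _) (norm_nonneg _))
  have h5 : ‖⟪B.moment D X ξ, B.dU X ξ⟫_ℂ‖ ≤ Cm * z * x :=
    (norm_inner_le_norm _ _).trans (mul_le_mul_of_nonneg_right (hm ξ hξ) (norm_nonneg _))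
  have h6 : x ^ 2 ≤ 1 / 2 * ((‖c‖ * x + ‖K‖ * z) * e + ‖c‖ * e * x) + Cm * z * x := by
    have h7 : x ^ 2 = ‖⟪B.dU X ξ, B.dU X ξ⟫_ℂ‖ := by
      rw [inner_self_eq_norm_sq_to_K, norm_pow]; simp [hx]
    rw [h7]
    nth_rewrite 1 [h2]
    rw [inner_sub_left, inner_smul_left, inner_add_left]
    refine (norm_sub_le _ _).trans (add_le_add ?_ h5)
    rw [norm_mul]
    have h8 : ‖(starRingEnd ℂ) (-(1 / 2 : ℂ))‖ = 1 / 2 := by simp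
    rw [h8]
    exact mul_le_mul_of_nonneg_left ((norm_add_le _ _).trans (add_le_add h3 h4)) (by norm_num)
  have hx0 : 0 ≤ x := norm_nonneg _
  have he0 : 0 ≤ e := norm_nonneg _
  have hz0 : 0 ≤ z := norm_nonneg _
  have hc0 : 0 ≤ ‖c‖ := norm_nonneg _
  have hK0 : 0 ≤ ‖K‖ := norm_nonneg _
  -- `y` majorises all lower-order terms, so that the quadratic inequality becomes `x² ≤ yx + y²`,
  -- which forces `x ≤ 2y`.
  set y := (‖c‖ + 1 + Cm + ‖K‖) * (e + z) with hy
  have hy0 : 0 ≤ y := by positivity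
  have h7 : ‖c‖ * e + Cm * z ≤ y := by
    rw [hy]
    nlinarith [mul_nonneg hc0 hz0, mul_nonneg hCm he0, mul_nonneg hK0 he0, mul_nonneg hK0 hz0]
  have h8 : 1 / 2 * (‖K‖ * z * e) ≤ y ^ 2 := by
    have h9 : ‖K‖ * z ≤ y := by
      rw [hy]
      nlinarith [mul_nonneg hc0 hz0, mul_nonneg hCm he0, mul_nonneg hK0 he0, mul_nonneg hCm hz0,
        mul_nonneg hc0 he0]
    have h10 : e ≤ y := by
      rw [hy]
      nlinarith [mul_nonneg hc0 hz0, mul_nonneg hCm he0, mul_nonneg hK0 he0, mul_nonneg hCm hz0,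
        mul_nonneg hc0 he0, mul_nonneg hK0 hz0]
    have := mul_le_mul h9 h10 he0 hy0
    nlinarith [mul_nonneg (mul_nonneg hK0 hz0) he0]
  have h9 : x ^ 2 ≤ y * x + y ^ 2 := by
    have := mul_le_mul_of_nonneg_right h7 hx0
    nlinarith
  have h10 : x ≤ 2 * y := by
    by_contra h
    push Not at h
    nlinarith
  rw [mul_assoc]
  exact h10

theorem IsAdmissible.Dv_bound (hD : B.IsAdmissible D) :
    ∃ C : ℝ, 0 ≤ C ∧ ∀ E : H →ₗ.[ℂ] H, E.domain = D.domain → Symm E → B.GInvariant E →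
      (∀ X, ∀ ξ ∈ D.domain, ev E (B.cFlat X ξ) + B.cFlat X (ev E ξ) =
        ev D (B.cFlat X ξ) + B.cFlat X (ev D ξ)) →
      ∀ ξ ∈ D.domain, ‖ev B.Dv ξ‖ ≤ C * (‖ev E ξ‖ + ‖ξ‖) := by
  choose C hC0 hC using fun i => hD.dU_bound (B.F.ε i)
  refine ⟨∑ i, ‖B.cε i‖ * C i + ‖B.cubic‖, add_nonneg (Finset.sum_nonneg fun i _ =>
    mul_nonneg (norm_nonneg _) (hC0 i)) (norm_nonneg _), fun E h1 h2 h3 h4 ξ hξ => ?_⟩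
  rw [hD.ev_Dv hξ, dv, add_mul, Finset.sum_mul]
  refine (norm_sub_le _ _).trans (add_le_add ((norm_sum_le _ _).trans
    (Finset.sum_le_sum fun i _ => ?_)) ?_)
  · rw [mul_assoc]
    exact ((B.cε i).le_opNorm _).trans
      (mul_le_mul_of_nonneg_left (hC i E h1 h2 h3 (h4 _) ξ hξ) (norm_nonneg _))
  · exact (B.cubic.le_opNorm _).trans (mul_le_mul_of_nonneg_left
      (le_add_of_nonneg_left (norm_nonneg _)) (norm_nonneg _))

end Background

end NCGauge

end

noncomputable section

namespace NCGauge

/-- A sequence in `V` converging in the graph norm of `T` has Cauchy images under `S`, by the bound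
applied to differences; closedness of `S` gives the limit. -/
theorem domain_le_of_bound {H : Type*} [NormedAddCommGroup H] [InnerProductSpace ℂ H]
    [CompleteSpace H] {T S : H →ₗ.[ℂ] H} (hT : T.IsClosed) (hS : S.IsClosed) {V : Submodule ℂ H}
    (hV : T.HasCore V) (hVS : V ≤ S.domain) {C : ℝ} (hC0 : 0 ≤ C)
    (hC : ∀ ξ ∈ V, ‖ev S ξ‖ ≤ C * (‖ev T ξ‖ + ‖ξ‖)) : T.domain ≤ S.domain := by
  intro ξ hξ
  obtain ⟨x, hx, h1, h2⟩ := exists_seq_of_hasCore hT hV hξ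
  have hb : ∀ k l, dist (ev S (x k)) (ev S (x l)) ≤
      C * (dist (ev T (x k)) (ev T (x l)) + dist (x k) (x l)) := fun k l => by
    have hle := hV.le_domain
    rw [dist_eq_norm, dist_eq_norm, dist_eq_norm, ← ev_sub (hVS (hx k)) (hVS (hx l)),
      ← ev_sub (hle (hx k)) (hle (hx l))]
    exact hC _ (sub_mem (hx k) (hx l))
  have hcau : CauchySeq fun k => ev S (x k) := by
    rw [Metric.cauchySeq_iff]
    intro ε hε
    -- The `2` accounts for the two distances being added, and `C + 1` in place of `C` allows `C =
    -- 0`.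
    have hδ : 0 < ε / (2 * (C + 1)) := by positivity
    obtain ⟨N1, hN1⟩ := Metric.cauchySeq_iff.1 h1.cauchySeq _ hδ
    obtain ⟨N2, hN2⟩ := Metric.cauchySeq_iff.1 h2.cauchySeq _ hδ
    refine ⟨max N1 N2, fun k hk l hl => (hb k l).trans_lt ?_⟩
    have h3 := hN1 k (le_of_max_le_left hk) l (le_of_max_le_left hl)
    have h4 := hN2 k (le_of_max_le_right hk) l (le_of_max_le_right hl)
    have h5 : C * (dist (ev T (x k)) (ev T (x l)) + dist (x k) (x l)) ≤
        C * (2 * (ε / (2 * (C + 1)))) := mul_le_mul_of_nonneg_left (by linarith) hC0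
    refine h5.trans_lt ?_
    have h6 : C * (2 * (ε / (2 * (C + 1)))) = ε * (C / (C + 1)) := by field_simp
    rw [h6]
    exact mul_lt_of_lt_one_right hε ((div_lt_one (by positivity)).2 (by linarith))
  obtain ⟨η, hη⟩ := cauchySeq_tendsto_of_complete hcau
  exact (ev_of_tendsto hS (fun k => hVS (hx k)) h1 hη).1

namespace Background

variable {m n : ℕ} {G A H : Type*} [TopologicalSpace G]
  [ChartedSpace (EuclideanSpace ℝ (Fin m)) G] [Group G]
  [CStarAlgebra A] [PartialOrder A] [StarOrderedRing A]
  [NormedAddCommGroup H] [InnerProductSpace ℂ H] [CompleteSpace H]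
  (B : Background m n G A H)

/-! ### The graph-norm domain of the vertical Dirac operator -/

/-- A vector of `Dom D_v` as an element of the normed space `Dom D_v`. -/
def toVDom (ξ : H) (h : ξ ∈ B.Dv.domain) : B.VDom := (⟨ξ, h⟩ : B.Dv.domain)

theorem incl_mem (x : B.VDom) : B.incl x ∈ B.Dv.domain := Subtype.property (p := (· ∈ B.Dv.domain)) x

theorem incl_toVDom {ξ : H} (h : ξ ∈ B.Dv.domain) : B.incl (B.toVDom ξ h) = ξ := rfl

variable {B} in
theorem VDom.ext {x y : B.VDom} (h : B.incl x = B.incl y) : x = y := Subtype.ext h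

theorem norm_sq_VDom (x : B.VDom) : ‖x‖ ^ 2 = ‖B.incl x‖ ^ 2 + ‖ev B.Dv (B.incl x)‖ ^ 2 := by
  have h := WithLp.prod_norm_sq_eq_of_L2 (B.graphMap x)
  have e : ev B.Dv (B.incl x) = (B.graphMap x).snd := ev_of_mem (B.incl_mem x)
  rw [e]
  exact h

theorem norm_incl_le (x : B.VDom) : ‖B.incl x‖ ≤ ‖x‖ := by
  refine abs_le_of_sq_le_sq' ?_ (norm_nonneg _) |>.2
  rw [norm_sq_VDom]
  exact le_add_of_nonneg_right (sq_nonneg _)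

theorem norm_ev_Dv_le (x : B.VDom) : ‖ev B.Dv (B.incl x)‖ ≤ ‖x‖ := by
  refine abs_le_of_sq_le_sq' ?_ (norm_nonneg _) |>.2
  rw [norm_sq_VDom]
  exact le_add_of_nonneg_left (sq_nonneg _)

theorem norm_VDom_le (x : B.VDom) : ‖x‖ ≤ ‖B.incl x‖ + ‖ev B.Dv (B.incl x)‖ := by
  refine abs_le_of_sq_le_sq' ?_ (by positivity) |>.2
  rw [norm_sq_VDom]
  nlinarith [mul_nonneg (norm_nonneg (B.incl x)) (norm_nonneg (ev B.Dv (B.incl x)))]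

theorem evV_incl (T : B.VDom →L[ℂ] H) (x : B.VDom) : B.evV T (B.incl x) = T x :=
  dif_pos (B.incl_mem x)

theorem evV_of_mem (T : B.VDom →L[ℂ] H) {ξ : H} (h : ξ ∈ B.Dv.domain) :
    B.evV T ξ = T (B.toVDom ξ h) := dif_pos h

theorem norm_evV_le (T : B.VDom →L[ℂ] H) {ξ : H} (h : ξ ∈ B.Dv.domain) :
    ‖B.evV T ξ‖ ≤ ‖T‖ * (‖ξ‖ + ‖ev B.Dv ξ‖) := by
  rw [B.evV_of_mem T h]
  exact (T.le_opNorm _).trans (mul_le_mul_of_nonneg_left (B.norm_VDom_le _) (norm_nonneg _))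

/-- An element of `L(Dom D_v, H)` as an operator with domain `Dom D_v`. -/
def toPMap (T : B.VDom →L[ℂ] H) : H →ₗ.[ℂ] H := ⟨B.Dv.domain, (T : B.VDom →ₗ[ℂ] H)⟩

theorem ev_toPMap (T : B.VDom →L[ℂ] H) (ξ : H) : ev (B.toPMap T) ξ = B.evV T ξ := rfl

theorem evV_add (T : B.VDom →L[ℂ] H) {ξ η : H} (hξ : ξ ∈ B.Dv.domain) (hη : η ∈ B.Dv.domain) :
    B.evV T (ξ + η) = B.evV T ξ + B.evV T η := ev_add (T := B.toPMap T) hξ hη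

theorem evV_smul (T : B.VDom →L[ℂ] H) (s : ℂ) {ξ : H} (hξ : ξ ∈ B.Dv.domain) :
    B.evV T (s • ξ) = s • B.evV T ξ := ev_smul (T := B.toPMap T) s hξ

theorem add_evV (T S : B.VDom →L[ℂ] H) (ξ : H) : B.evV (T + S) ξ = B.evV T ξ + B.evV S ξ := by
  by_cases h : ξ ∈ B.Dv.domain
  · simp only [B.evV_of_mem _ h, add_apply]
  · simp [evV, h]

theorem real_smul_evV (s : ℝ) (T : B.VDom →L[ℂ] H) (ξ : H) :
    B.evV (s • T) ξ = (s : ℂ) • B.evV T ξ := by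
  by_cases h : ξ ∈ B.Dv.domain
  · simp only [B.evV_of_mem _ h]; rfl
  · simp [evV, h]

theorem neg_evV (T : B.VDom →L[ℂ] H) (ξ : H) : B.evV (-T) ξ = -B.evV T ξ := by
  by_cases h : ξ ∈ B.Dv.domain
  · simp only [B.evV_of_mem _ h]; rfl
  · simp [evV, h]

theorem zero_evV (ξ : H) : B.evV 0 ξ = 0 := by
  by_cases h : ξ ∈ B.Dv.domain
  · simp only [B.evV_of_mem _ h]; rfl
  · simp [evV, h]

variable {B}

/-- The bounded operator on `Dom D_v` induced by a bounded operator on `H` whose supercommutator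
with `D_v` is bounded. -/
def vmap {S K : H →L[ℂ] H} (h : B.SupercommIs B.Dv S K) : B.VDom →L[ℂ] B.VDom :=
  LinearMap.mkContinuous
    { toFun := fun x => B.toVDom (S (B.incl x)) (h _ (B.incl_mem x)).1
      map_add' := fun x y => VDom.ext (show S (B.incl (x + y)) = S (B.incl x) + S (B.incl y) by
        rw [map_add, map_add])
      map_smul' := fun s x => VDom.ext (show S (B.incl (s • x)) = s • S (B.incl x) by
        rw [map_smul, map_smul]) }
    (‖S‖ + ‖B.twist S‖ + ‖K‖) fun x => by
      refine (B.norm_VDom_le _).trans ?_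
      have h1 := (h _ (B.incl_mem x)).2
      have h2 : ev B.Dv (S (B.incl x)) = B.twist S (ev B.Dv (B.incl x)) + K (B.incl x) := by
        rw [← h1]; abel
      change ‖S (B.incl x)‖ + ‖ev B.Dv (S (B.incl x))‖ ≤ _
      rw [h2, add_mul, add_mul, add_assoc]
      exact add_le_add (S.le_of_opNorm_le_of_le le_rfl (B.norm_incl_le x))
        ((norm_add_le _ _).trans (add_le_add
          ((B.twist S).le_of_opNorm_le_of_le le_rfl (B.norm_ev_Dv_le x))
          (K.le_of_opNorm_le_of_le le_rfl (B.norm_incl_le x))))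

theorem incl_vmap {S K : H →L[ℂ] H} (h : B.SupercommIs B.Dv S K) (x : B.VDom) :
    B.incl (vmap h x) = S (B.incl x) := rfl

theorem evV_comp_vmap {S K : H →L[ℂ] H} (h : B.SupercommIs B.Dv S K) (T : B.VDom →L[ℂ] H) {ξ : H}
    (hξ : ξ ∈ B.Dv.domain) : B.evV (T.comp (vmap h)) ξ = B.evV T (S ξ) := by
  rw [B.evV_of_mem _ hξ, B.evV_of_mem _ (h ξ hξ).1]; rfl

theorem evV_clm_comp (S : H →L[ℂ] H) (T : B.VDom →L[ℂ] H) {ξ : H} (hξ : ξ ∈ B.Dv.domain) :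
    B.evV (S.comp T) ξ = S (B.evV T ξ) := by
  rw [B.evV_of_mem _ hξ, B.evV_of_mem _ hξ]; rfl

/-! ### Extension to the domain of the vertical Dirac operator -/

theorem extendsTo_iff {V : Submodule ℂ H} (hV : V ≤ B.Dv.domain) {M : H → H}
    {T : B.VDom →L[ℂ] H} : B.ExtendsTo V M T ↔ ∀ ξ ∈ V, B.evV T ξ = M ξ := by
  refine ⟨fun h ξ hξ => ?_, fun h => ⟨hV, fun ξ hξ => ?_⟩⟩
  · rw [B.evV_of_mem T (hV hξ)]
    exact h.2 (B.toVDom ξ (hV hξ)) hξ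
  · rw [← h _ hξ, B.evV_incl]

/-- Local boundedness implies boundedness for maps that supercommute with `𝒜^G`. -/
theorem exists_extendsTo {V : Submodule ℂ H} {M : H → H}
    (hM : ∀ b, B.FixedA b → B.Supercommutes V M (B.R.π b))
    (h : ∀ a ∈ B.𝒜, ∃ T, B.ExtendsTo V (fun ξ => M (B.R.π a ξ)) T) :
    ∃ T, B.ExtendsTo V M T := by
  obtain ⟨T, hV, hT⟩ := h _ B.φu_mem
  -- `T` extends `M φu = gr(φu) M`, so `M` is recovered by composing on the left with `gr(φu)⁻¹`.
  -- The grading appears because `φu` need not be even.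
  refine ⟨(B.R.π (B.P.gr B.ψu)).comp T, hV, fun ξ hξ => ?_⟩
  rw [ContinuousLinearMap.comp_apply, hT ξ hξ]
  beta_reduce
  rw [(hM _ ⟨B.φu_mem, B.φu_fixed⟩ _ hξ).2, twist_π,
    π_gr_ψu_φu]

theorem GaugeComparable.exists_extendsTo {D E : H →ₗ.[ℂ] H}
    (h : B.GaugeComparable D E) :
    ∃ T, B.ExtendsTo (B.jointDom D E) (fun ξ => ev E ξ - ev D ξ) T := by
  obtain ⟨T, hT⟩ := Background.exists_extendsTo h.supercommutes.2 h.bounded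
  refine ⟨-T, hT.1, fun ξ hξ => ?_⟩
  rw [neg_apply, hT.2 ξ hξ, neg_sub]

section Smooth

variable [LieGroup (𝓡 m) ∞ G] {D E D₀ : H →ₗ.[ℂ] H}

/-- `Dom D` is a core for `D_v`, hence dense in `Dom D_v` for the graph norm. -/
theorem IsAdmissible.ext_VDom (hD : B.IsAdmissible D) {T S : B.VDom →L[ℂ] H}
    (h : ∀ ξ ∈ D.domain, B.evV T ξ = B.evV S ξ) : T = S := by
  ext x
  obtain ⟨y, hy, h1, h2⟩ := exists_seq_of_hasCore hD.isClosed_Dv hD.hasCore_Dv (B.incl_mem x)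
  have h3 : Tendsto (fun k => B.toVDom (y k) (hD.dom_le (hy k))) atTop (𝓝 x) := by
    rw [tendsto_iff_norm_sub_tendsto_zero]
    refine squeeze_zero (fun _ => norm_nonneg _) (fun k => B.norm_VDom_le _) ?_
    have h4 : ∀ k, ev B.Dv (y k - B.incl x) = ev B.Dv (y k) - ev B.Dv (B.incl x) := fun k =>
      ev_sub (hD.dom_le (hy k)) (B.incl_mem x)
    simp only [map_sub, incl_toVDom, h4]
    simpa using (tendsto_iff_norm_sub_tendsto_zero.1 h1).add (tendsto_iff_norm_sub_tendsto_zero.1 h2)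
  refine tendsto_nhds_unique ((T.continuous.tendsto _).comp h3)
    (((S.continuous.tendsto _).comp h3).congr fun k => ?_)
  have := h (y k) (hy k)
  rw [B.evV_of_mem _ (hD.dom_le (hy k)), B.evV_of_mem _ (hD.dom_le (hy k))] at this
  exact this.symm

theorem IsAdmissible.existsUnique_extendsTo (hD : B.IsAdmissible D) {M : H → H}
    (h : ∃ T, B.ExtendsTo D.domain M T) : ∃! T, B.ExtendsTo D.domain M T := by
  obtain ⟨T, hT⟩ := h
  refine ⟨T, hT, fun S hS => hD.ext_VDom fun ξ hξ => ?_⟩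
  rw [(extendsTo_iff hD.dom_le).1 hT ξ hξ, (extendsTo_iff hD.dom_le).1 hS ξ hξ]

theorem IsAdmissible.graph_bound (hD : B.IsAdmissible D) (T : B.VDom →L[ℂ] H) :
    ∃ C : ℝ, 0 ≤ C ∧ ∀ E : H →ₗ.[ℂ] H, E.domain = D.domain → Symm E → B.GInvariant E →
      (∀ X, ∀ ξ ∈ D.domain, ev E (B.cFlat X ξ) + B.cFlat X (ev E ξ) =
        ev D (B.cFlat X ξ) + B.cFlat X (ev D ξ)) →
      ∀ ξ ∈ D.domain, ‖B.evV T ξ‖ ≤ C * (‖ev E ξ‖ + ‖ξ‖) := by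
  obtain ⟨C, hC0, hC⟩ := hD.Dv_bound
  refine ⟨‖T‖ * (1 + C), by positivity, fun E h1 h2 h3 h4 ξ hξ => ?_⟩
  refine (B.norm_evV_le T (hD.dom_le hξ)).trans ?_
  rw [mul_assoc]
  refine mul_le_mul_of_nonneg_left ?_ (norm_nonneg _)
  have := hC E h1 h2 h3 h4 ξ hξ
  nlinarith [norm_nonneg (ev E ξ)]

theorem IsAdmissible.domain_le_of_comparable (hD : B.IsAdmissible D) (hE : B.IsAdmissible E)
    {V : Submodule ℂ H} (hV : D.HasCore V) (hVE : V ≤ E.domain) (T : B.VDom →L[ℂ] H)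
    (hT : ∀ ξ ∈ V, ev E ξ = ev D ξ + B.evV T ξ) : D.domain ≤ E.domain := by
  obtain ⟨C, hC0, hC⟩ := hD.graph_bound T
  refine domain_le_of_bound hD.isClosed hE.isClosed hV hVE (C := 1 + C) (by positivity)
    fun ξ hξ => ?_
  have h1 := hC D rfl hD.symm hD.triple.invariant (fun _ _ _ => rfl) ξ (hV.le_domain hξ)
  rw [hT ξ hξ]
  refine (norm_add_le _ _).trans ?_
  nlinarith [norm_nonneg ξ]

/-- `E - D` is bounded on `Dom D_v`, hence relatively bounded with respect to `D` and also to `E`.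
The two graph norms are thus equivalent on the joint core, and both operators are closed. -/
theorem GaugeComparable.domain_eq (h : B.GaugeComparable D E) (hD : B.IsAdmissible D)
    (hE : B.IsAdmissible E) : E.domain = D.domain := by
  obtain ⟨T, hT⟩ := h.exists_extendsTo
  have hT' := (extendsTo_iff hT.1).1 hT
  have hle : B.jointDom D E ≤ D.domain ⊓ E.domain := inf_le_left
  refine le_antisymm ?_ ?_
  · refine hE.domain_le_of_comparable hD h.core₂ (hle.trans inf_le_left) (-T) fun ξ hξ => ?_
    rw [B.neg_evV, hT' ξ hξ]; abel
  · refine hD.domain_le_of_comparable hE h.core₁ (hle.trans inf_le_right) T fun ξ hξ => ?_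
    rw [hT' ξ hξ]; abel

end Smooth

end Background

end NCGauge

end

noncomputable section

namespace NCGauge

namespace Background

variable {m n : ℕ} {G A H : Type*} [TopologicalSpace G]
  [ChartedSpace (EuclideanSpace ℝ (Fin m)) G] [Group G]
  [CStarAlgebra A] [PartialOrder A] [StarOrderedRing A]
  [NormedAddCommGroup H] [InnerProductSpace ℂ H] [CompleteSpace H]
  {B : Background m n G A H}

/-! ### Supercommuting operators -/

theorem Supercommutes.one (V : Submodule ℂ H) (M : H → H) : B.Supercommutes V M 1 :=
  fun ξ hξ => ⟨hξ, by rw [twist_one]; rfl⟩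

theorem Supercommutes.mul {V : Submodule ℂ H} {M : H → H} {S T : H →L[ℂ] H}
    (hS : B.Supercommutes V M S) (hT : B.Supercommutes V M T) : B.Supercommutes V M (S * T) :=
  fun ξ hξ => by
    obtain ⟨h1, h2⟩ := hT ξ hξ
    obtain ⟨h3, h4⟩ := hS _ h1
    refine ⟨h3, ?_⟩
    rw [twist_mul, mul_apply_eq_comp, mul_apply_eq_comp, h4, h2]

theorem Supercommutes.cliffordMonomial {V : Submodule ℂ H} {M : H → H} {k : ℕ}
    {e : Fin k → H →L[ℂ] H} (h : ∀ i, B.Supercommutes V M (e i)) (I : Finset (Fin k)) :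
    B.Supercommutes V M (cliffordMonomial e I) := by
  unfold NCGauge.cliffordMonomial
  induction I.sort (· ≤ ·) with
  | nil => simpa using Supercommutes.one V M
  | cons i l ih => simpa using (h i).mul ih

/-- Only the fact that the twist is a scalar multiple matters, because one-forms are a linear
subspace. -/
theorem twist_cliffordMonomial {k : ℕ} {e : Fin k → H →L[ℂ] H} (h : ∀ i, B.twist (e i) = -e i)
    (I : Finset (Fin k)) :
    ∃ s : ℂ, B.twist (cliffordMonomial e I) = s • cliffordMonomial e I := by
  unfold cliffordMonomial
  induction I.sort (· ≤ ·) with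
  | nil => exact ⟨1, by simp [twist_one]⟩
  | cons i l ih =>
    obtain ⟨s, hs⟩ := ih
    refine ⟨-s, ?_⟩
    rw [List.map_cons, List.prod_cons, twist_mul, hs, h]
    simp

/-- Multiplication of one-forms by Clifford monomials. -/
theorem monomial_mul_mem {D : H →ₗ.[ℂ] H} (I J : Finset (Fin m)) {K : H →L[ℂ] H}
    (hK : K ∈ B.oneForms D) :
    cliffordMonomial (fun i => B.R.e (Fin.castLE B.le i)) I * cliffordMonomial B.c₀ J * K ∈
      B.verticalOneForms D := by
  set v := cliffordMonomial (fun i => B.R.e (Fin.castLE B.le i)) I * cliffordMonomial B.c₀ J with hv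
  have hle : B.oneForms D ≤ (B.verticalOneForms D).comap (LinearMap.mulLeft ℂ v) := by
    refine Submodule.topologicalClosure_minimal _ (Submodule.span_le.2 ?_) ?_
    · rintro S ⟨a, b, K, hb, hK, rfl⟩
      refine Submodule.le_topologicalClosure _ (Submodule.subset_span
        ⟨v * B.R.π a, Submodule.subset_span ⟨I, J, a, trivial, rfl⟩, b, K, hb, hK, ?_⟩)
      simp [mul_assoc]
    · exact (Submodule.isClosed_topologicalClosure _).preimage (by
        change Continuous fun K => v * K
        fun_prop)
  exact hle hK

/-! ### Relative gauge potentials as elements of `L(Dom D_v, H)` -/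

/-- The conditions on an element of `L(Dom D_v, H)` under which its restriction to `Dom D` is a
relative gauge potential. -/
structure IsPotential (B : Background m n G A H) (D : H →ₗ.[ℂ] H) (T : B.VDom →L[ℂ] H) :
    Prop where
  odd : ∀ ξ ∈ D.domain, B.evV T (B.R.γ ξ) = -B.R.γ (B.evV T ξ)
  multigrading : ∀ i, ∀ ξ ∈ D.domain, B.evV T (B.R.e i ξ) = B.twist (B.R.e i) (B.evV T ξ)
  symmetric : ∀ ξ ∈ D.domain, ∀ η ∈ D.domain, ⟪B.evV T ξ, η⟫_ℂ = ⟪ξ, B.evV T η⟫_ℂ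
  invariant : ∀ g, ∀ ξ ∈ D.domain, B.evV T (B.u g ξ) = B.u g (B.evV T ξ)
  clifford : ∀ S ∈ B.clifford, ∀ ξ ∈ D.domain, B.evV T (S ξ) = B.twist S (B.evV T ξ)
  fixed : ∀ b, B.FixedA b → ∀ ξ ∈ D.domain,
    B.evV T (B.R.π b ξ) = B.twist (B.R.π b) (B.evV T ξ)
  commutator : ∀ a ∈ B.𝒜, ∃ K ∈ B.oneForms D, ∀ ξ ∈ D.domain,
    B.evV T (B.R.π a ξ) - B.twist (B.R.π a) (B.evV T ξ) = K ξ

/-- `E = D + T` with the same domain. -/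
structure IsShift (B : Background m n G A H) (D E : H →ₗ.[ℂ] H) (T : B.VDom →L[ℂ] H) : Prop where
  domain_eq : E.domain = D.domain
  ev_eq : ∀ ξ ∈ D.domain, ev E ξ = ev D ξ + B.evV T ξ

section Smooth

variable {D E : H →ₗ.[ℂ] H} {T T' : B.VDom →L[ℂ] H}

/-- The relative gauge potentials for `D`. -/
def potentials (B : Background m n G A H) (D : H →ₗ.[ℂ] H) : Submodule ℝ (B.VDom →L[ℂ] H) where
  carrier := {T | B.IsPotential D T}
  add_mem' {T S} hT hS :=
    { odd := fun ξ hξ => by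
        rw [B.add_evV, B.add_evV, hT.odd ξ hξ, hS.odd ξ hξ, map_add, neg_add]
      multigrading := fun i ξ hξ => by
        rw [B.add_evV, B.add_evV, hT.multigrading i ξ hξ, hS.multigrading i ξ hξ, map_add]
      symmetric := fun ξ hξ η hη => by
        rw [B.add_evV, B.add_evV, inner_add_left, inner_add_right, hT.symmetric ξ hξ η hη,
          hS.symmetric ξ hξ η hη]
      invariant := fun g ξ hξ => by
        rw [B.add_evV, B.add_evV, hT.invariant g ξ hξ, hS.invariant g ξ hξ, map_add]
      clifford := fun X hX ξ hξ => by
        rw [B.add_evV, B.add_evV, hT.clifford X hX ξ hξ, hS.clifford X hX ξ hξ, map_add]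
      fixed := fun b hb ξ hξ => by
        rw [B.add_evV, B.add_evV, hT.fixed b hb ξ hξ, hS.fixed b hb ξ hξ, map_add]
      commutator := fun a ha => by
        obtain ⟨K, hK, h1⟩ := hT.commutator a ha
        obtain ⟨L, hL, h2⟩ := hS.commutator a ha
        refine ⟨K + L, add_mem hK hL, fun ξ hξ => ?_⟩
        rw [add_apply, ← h1 ξ hξ, ← h2 ξ hξ, B.add_evV, B.add_evV, map_add]
        abel }
  zero_mem' :=
    { odd := fun ξ _ => by simp [B.zero_evV]
      multigrading := fun i ξ _ => by simp [B.zero_evV]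
      symmetric := fun ξ _ η _ => by simp [B.zero_evV]
      invariant := fun g ξ _ => by simp [B.zero_evV]
      clifford := fun X _ ξ _ => by simp [B.zero_evV]
      fixed := fun b _ ξ _ => by simp [B.zero_evV]
      commutator := fun a _ => ⟨0, zero_mem _, fun ξ _ => by simp [B.zero_evV]⟩ }
  smul_mem' s T hT :=
    { odd := fun ξ hξ => by
        rw [B.real_smul_evV, B.real_smul_evV, hT.odd ξ hξ, map_smul, smul_neg]
      multigrading := fun i ξ hξ => by
        rw [B.real_smul_evV, B.real_smul_evV, hT.multigrading i ξ hξ, map_smul]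
      symmetric := fun ξ hξ η hη => by
        rw [B.real_smul_evV, B.real_smul_evV, inner_smul_left, inner_smul_right,
          hT.symmetric ξ hξ η hη, Complex.conj_ofReal]
      invariant := fun g ξ hξ => by
        rw [B.real_smul_evV, B.real_smul_evV, hT.invariant g ξ hξ, map_smul]
      clifford := fun X hX ξ hξ => by
        rw [B.real_smul_evV, B.real_smul_evV, hT.clifford X hX ξ hξ, map_smul]
      fixed := fun b hb ξ hξ => by
        rw [B.real_smul_evV, B.real_smul_evV, hT.fixed b hb ξ hξ, map_smul]
      commutator := fun a ha => by
        obtain ⟨K, hK, h1⟩ := hT.commutator a ha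
        refine ⟨(s : ℂ) • K, Submodule.smul_mem _ _ hK, fun ξ hξ => ?_⟩
        rw [smul_apply, ← h1 ξ hξ, B.real_smul_evV, B.real_smul_evV, map_smul, smul_sub] }

theorem IsPotential.supercommutes_clifford (hD : B.IsAdmissible D) (hT : B.IsPotential D T)
    {S : H →L[ℂ] H} (hS : S ∈ B.clifford) : B.Supercommutes D.domain (B.evV T) S :=
  fun ξ hξ => ⟨hD.clifford_mem hS hξ, hT.clifford S hS ξ hξ⟩

theorem IsPotential.supercommutes_e (hD : B.IsAdmissible D) (hT : B.IsPotential D T) (i : Fin n) :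
    B.Supercommutes D.domain (B.evV T) (B.R.e i) :=
  fun ξ hξ => ⟨(hD.triple.nodd.2 i ξ hξ).1, hT.multigrading i ξ hξ⟩

theorem ev_Dh (hD : D.domain ≤ B.Dv.domain) {ξ : H} (hξ : ξ ∈ D.domain) :
    ξ ∈ (B.Dh D).domain ∧ ev (B.Dh D) ξ = ev D ξ - ev B.Dv ξ := by
  have hξ' : ξ ∈ D.domain ⊓ B.mulSpace ⊤ := by rwa [inf_mulSpace_top]
  have h1 : ξ ∈ (D - B.Dv).domain := ⟨hξ, hD hξ⟩
  have h2 : ξ ∈ ((D - B.Dv).domRestrict (D.domain ⊓ B.mulSpace ⊤)).domain := ⟨hξ', h1⟩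
  have hle := LinearPMap.le_closure ((D - B.Dv).domRestrict (D.domain ⊓ B.mulSpace ⊤))
  refine ⟨hle.1 h2, ?_⟩
  have := ev_of_le hle h2
  rw [ev_domRestrict hξ' h1, ev_sub_op hξ (hD hξ)] at this
  exact this

theorem supercommIs_Dh (hD : D.domain ≤ B.Dv.domain) {S K : H →L[ℂ] H}
    (h : ∀ ξ ∈ D.domain, S ξ ∈ D.domain ∧
      ev D (S ξ) - ev B.Dv (S ξ) - B.twist S (ev D ξ - ev B.Dv ξ) = K ξ) :
    B.SupercommIs (B.Dh D) S K := by
  refine SupercommIs.closure fun ξ hξ => ?_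
  have hξ' : ξ ∈ D.domain := hξ.2.1
  have hmem : ∀ η ∈ D.domain, η ∈ D.domain ⊓ B.mulSpace ⊤ := fun η hη => by
    rwa [inf_mulSpace_top]
  have hmem' : ∀ η ∈ D.domain, η ∈ (D - B.Dv).domain := fun η hη => ⟨hη, hD hη⟩
  obtain ⟨h1, h2⟩ := h ξ hξ'
  refine ⟨⟨hmem _ h1, hmem' _ h1⟩, ?_⟩
  rw [ev_domRestrict (hmem _ h1) (hmem' _ h1), ev_domRestrict (hmem _ hξ') (hmem' _ hξ'),
    ev_sub_op h1 (hD h1), ev_sub_op hξ' (hD hξ'), h2]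

theorem IsShift.supercommIs_iff (hs : B.IsShift D E T) {S K L : H →L[ℂ] H}
    (hS : ∀ ξ ∈ D.domain, S ξ ∈ D.domain)
    (h : ∀ ξ ∈ D.domain, B.evV T (S ξ) - B.twist S (B.evV T ξ) = L ξ) :
    B.SupercommIs E S (K + L) ↔ B.SupercommIs D S K := by
  simp only [SupercommIs, hs.domain_eq]
  refine forall₂_congr fun ξ hξ => and_congr_right fun _ => ?_
  rw [hs.ev_eq _ (hS ξ hξ), hs.ev_eq ξ hξ, map_add, add_apply, ← h ξ hξ, add_sub_add_comm,
    add_left_inj]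

theorem IsShift.supercommIs_fixed_iff (hs : B.IsShift D E T) (hD : B.IsAdmissible D)
    (hT : ∀ b, B.FixedA b → ∀ ξ ∈ D.domain,
      B.evV T (B.R.π b ξ) = B.twist (B.R.π b) (B.evV T ξ)) {b : A} (hb : B.FixedA b) {K : H →L[ℂ] H} :
    B.SupercommIs E (B.R.π b) K ↔ B.SupercommIs D (B.R.π b) K := by
  have := hs.supercommIs_iff (K := K) (L := 0) (fun ξ hξ => hD.π_mem hb.1 hξ) fun ξ hξ => by
    rw [hT b hb ξ hξ, sub_self]; rfl
  rwa [add_zero] at this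

/-- `[E, b] = [D, b]` for `b ∈ 𝒜^G`, since the shift supercommutes with `b`. -/
theorem IsShift.oneForms_eq (hs : B.IsShift D E T) (hD : B.IsAdmissible D)
    (hT : ∀ b, B.FixedA b → ∀ ξ ∈ D.domain,
      B.evV T (B.R.π b ξ) = B.twist (B.R.π b) (B.evV T ξ)) : B.oneForms E = B.oneForms D := by
  unfold oneForms
  congr 2
  ext S
  refine exists_congr fun a => exists_congr fun b => exists_congr fun K =>
    and_congr_right fun hb => ?_
  rw [hs.supercommIs_fixed_iff hD hT hb]

theorem IsShift.verticalOneForms_eq (hs : B.IsShift D E T) (hD : B.IsAdmissible D)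
    (hT : ∀ b, B.FixedA b → ∀ ξ ∈ D.domain,
      B.evV T (B.R.π b ξ) = B.twist (B.R.π b) (B.evV T ξ)) : B.verticalOneForms E = B.verticalOneForms D := by
  unfold verticalOneForms
  congr 2
  ext S
  refine exists_congr fun w => and_congr_right fun _ => exists_congr fun b =>
    exists_congr fun K => and_congr_right fun hb => ?_
  rw [hs.supercommIs_fixed_iff hD hT hb]

/-- The operator enters the conditions only through its domain and its one-forms, and a shift by a
potential changes neither. This makes the space of potentials the same at all points of the Atiyah
space. -/
theorem IsShift.isPotential_iff (hs : B.IsShift D E T) (hD : B.IsAdmissible D)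
    (hT : B.IsPotential D T) : B.IsPotential E T' ↔ B.IsPotential D T' := by
  constructor
  · rintro ⟨h1, h2, h3, h4, h5, h6, h7⟩
    simp only [hs.domain_eq, hs.oneForms_eq hD hT.fixed] at *
    exact ⟨h1, h2, h3, h4, h5, h6, h7⟩
  · rintro ⟨h1, h2, h3, h4, h5, h6, h7⟩
    simp only [← hs.domain_eq, ← hs.oneForms_eq hD hT.fixed] at *
    exact ⟨h1, h2, h3, h4, h5, h6, h7⟩

theorem LocBddAdequate.congr {V : Submodule ℂ H} {M M' : H → H}
    {tw : (H →L[ℂ] H) → H →L[ℂ] H} (h : ∀ ξ ∈ V, M ξ = M' ξ) (hM : B.LocBddAdequate V M tw) :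
    B.LocBddAdequate V M' tw := by
  obtain ⟨h1, ⟨C, h2⟩, h3⟩ := hM
  refine ⟨fun a ha => ?_, ⟨C, fun k ξ hξ => ?_⟩, fun f hf ξ hξ => ?_⟩
  · obtain ⟨K, hK⟩ := h1 a ha
    exact ⟨K, fun ξ hξ => ⟨(hK ξ hξ).1, by rw [← h _ (hK ξ hξ).1, (hK ξ hξ).2]⟩⟩
  · obtain ⟨K, hK⟩ := h1 _ (B.φ_mem k)
    rw [← h ξ hξ, ← h _ (hK ξ hξ).1]
    exact h2 k ξ hξ
  · refine ⟨(h3 f hf ξ hξ).1, ?_⟩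
    rw [← h ξ hξ, ← h _ (h3 f hf ξ hξ).1, (h3 f hf ξ hξ).2]

variable [LieGroup (𝓡 m) ∞ G]

theorem IsAdmissible.isPotential_of (hD : B.IsAdmissible D) {θ : H →ₗ.[ℂ] H}
    (hθ : B.IsRelGaugePotential D θ) (hT : B.ExtendsTo θ.domain (ev θ) T) :
    B.IsPotential D T := by
  have hdom : θ.domain = D.domain := hθ.domain_eq.trans hD.smoothDom_eq
  have hev := (extendsTo_iff hT.1).1 hT
  rw [hdom] at hev
  obtain ⟨-, hodd, hsymm, hinv, hsup, hcomm, -⟩ := hθ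
  simp only [NOdd, GInvariant, SupercommutesBase, SupercommIs, Supercommutes, hdom] at *
  exact
    { odd := fun ξ hξ => by rw [hev _ (hodd.1 ξ hξ).1, hev ξ hξ, (hodd.1 ξ hξ).2]
      multigrading := fun i ξ hξ => by
        rw [hev _ (hodd.2 i ξ hξ).1, hev ξ hξ, (hodd.2 i ξ hξ).2]
      symmetric := fun ξ hξ η hη => by rw [hev ξ hξ, hev η hη, hsymm ξ hξ η hη]
      invariant := fun g ξ hξ => by rw [hev _ (hinv g ξ hξ).1, hev ξ hξ, (hinv g ξ hξ).2]
      clifford := fun S hS ξ hξ => by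
        rw [hev _ (hsup.1 S hS ξ hξ).1, hev ξ hξ, (hsup.1 S hS ξ hξ).2]
      fixed := fun b hb ξ hξ => by
        rw [hev _ (hsup.2 b hb ξ hξ).1, hev ξ hξ, (hsup.2 b hb ξ hξ).2]
      commutator := fun a ha => by
        obtain ⟨K, hK, h⟩ := hcomm a ha
        exact ⟨K, hK, fun ξ hξ => by rw [hev _ (h ξ hξ).1, hev ξ hξ, (h ξ hξ).2]⟩ }

/-- Local boundedness is missing from `IsPotential` because it is automatic: `𝒜` acts boundedly on
`Dom D_v`, so `T` can be composed with each `a`. -/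
theorem IsAdmissible.isPotential_iff (hD : B.IsAdmissible D) : B.IsPotential D T ↔
    ∃ θ, B.IsRelGaugePotential D θ ∧ B.ExtendsTo θ.domain (ev θ) T := by
  refine ⟨fun hT => ?_, fun ⟨θ, h1, h2⟩ => hD.isPotential_of h1 h2⟩
  set θ := (B.toPMap T).domRestrict D.domain with hθ
  have hdom : θ.domain = D.domain := inf_eq_left.2 hD.dom_le
  have hev : ∀ ξ ∈ D.domain, ev θ ξ = B.evV T ξ := fun ξ hξ =>
    ev_domRestrict hξ (hD.dom_le hξ)
  obtain ⟨hγ, he⟩ := hD.triple.nodd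
  have hs : ∀ (S : H →L[ℂ] H), (∀ ξ ∈ D.domain, S ξ ∈ D.domain) →
      (∀ ξ ∈ D.domain, B.evV T (S ξ) = B.twist S (B.evV T ξ)) →
      B.Supercommutes θ.domain (ev θ) S := fun S h1 h2 ξ hξ => by
    rw [hdom] at hξ ⊢
    exact ⟨h1 ξ hξ, by rw [hev _ (h1 ξ hξ), hev ξ hξ, h2 ξ hξ]⟩
  refine ⟨θ, ⟨hdom.trans hD.smoothDom_eq.symm, ⟨fun ξ hξ => ?_, fun i => ?_⟩, fun ξ hξ η hη => ?_,
    fun g ξ hξ => ?_, ⟨fun S hS => ?_, fun b hb => ?_⟩, fun a ha => ?_, fun a ha => ?_⟩, ?_⟩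
  · rw [hdom] at hξ ⊢
    exact ⟨(hγ ξ hξ).1, by rw [hev _ (hγ ξ hξ).1, hev ξ hξ, hT.odd ξ hξ]⟩
  · exact hs _ (fun ξ hξ => (he i ξ hξ).1) (hT.multigrading i)
  · rw [hdom] at hξ hη
    rw [hev ξ hξ, hev η hη, hT.symmetric ξ hξ η hη]
  · rw [hdom] at hξ ⊢
    have h := (hD.triple.invariant g ξ hξ).1
    exact ⟨h, by rw [hev _ h, hev ξ hξ, hT.invariant g ξ hξ]⟩
  · exact hs _ (fun ξ hξ => hD.clifford_mem hS hξ) (hT.clifford S hS)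
  · exact hs _ (fun ξ hξ => hD.π_mem hb.1 hξ) (hT.fixed b hb)
  · obtain ⟨K, hK, h⟩ := hT.commutator a ha
    refine ⟨K, hK, fun ξ hξ => ?_⟩
    rw [hdom] at hξ ⊢
    have h1 := hD.π_mem ha hξ
    exact ⟨h1, by rw [hev _ h1, hev ξ hξ, h ξ hξ]⟩
  · refine ⟨T.comp (vmap (hD.supercommIs_Dv_π ha)), (extendsTo_iff (hdom.trans_le hD.dom_le)).2
      fun ξ hξ => ?_⟩
    rw [hdom] at hξ
    rw [evV_comp_vmap _ _ (hD.dom_le hξ), hev _ (hD.π_mem ha hξ)]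
  · exact (extendsTo_iff (hdom.trans_le hD.dom_le)).2 fun ξ hξ => (hev ξ (hdom ▸ hξ)).symm

theorem IsAdmissible.existsUnique_extension (hD : B.IsAdmissible D) {θ : H →ₗ.[ℂ] H}
    (hθ : B.IsRelGaugePotential D θ) : ∃! T, B.ExtendsTo θ.domain (ev θ) T := by
  have hdom : θ.domain = D.domain := hθ.domain_eq.trans hD.smoothDom_eq
  have := exists_extendsTo hθ.supercommutes.2 hθ.bounded
  rw [hdom] at this ⊢
  exact hD.existsUnique_extendsTo this

/-! ### Shifts of an admissible operator by a relative gauge potential -/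

/-- On a generator `va`, with `v` a product of Clifford monomials, `v` supercommutes with `T`, and
so `[T, va]` is a scalar multiple of `v[T, a]`. -/
theorem IsPotential.commutator_vertical (hD : B.IsAdmissible D) (hT : B.IsPotential D T)
    {w : H →L[ℂ] H} (hw : w ∈ B.V𝒜) : ∃ K ∈ B.verticalOneForms D, ∀ ξ ∈ D.domain,
      w ξ ∈ D.domain ∧ B.evV T (w ξ) - B.twist w (B.evV T ξ) = K ξ := by
  refine Submodule.span_induction ?_ ?_ ?_ ?_ hw
  · rintro w ⟨I, J, a, ha, rfl⟩
    obtain ⟨K, hK, h⟩ := hT.commutator a ha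
    obtain ⟨s, hs⟩ := B.twist_cliffordMonomial (e := fun i => B.R.e (Fin.castLE B.le i))
      (fun i => B.twist_e _) I
    obtain ⟨t, ht⟩ := B.twist_cliffordMonomial B.twist_c₀ J
    set v := cliffordMonomial (fun i => B.R.e (Fin.castLE B.le i)) I * cliffordMonomial B.c₀ J
      with hv
    have hvs : B.Supercommutes D.domain (B.evV T) v :=
      (Supercommutes.cliffordMonomial (fun i => hT.supercommutes_e hD _) I).mul
        (Supercommutes.cliffordMonomial
          (fun j => hT.supercommutes_clifford hD (B.c₀_mem_clifford j)) J)
    have hvt : B.twist v = (s * t) • v := by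
      rw [hv, twist_mul, hs, ht, smul_mul_smul_comm]
    refine ⟨(s * t) • (v * K), Submodule.smul_mem _ _ (monomial_mul_mem I J hK), fun ξ hξ => ?_⟩
    have h1 := hvs _ (hD.π_mem ha hξ)
    refine ⟨h1.1, ?_⟩
    rw [twist_mul, mul_apply_eq_comp, mul_apply_eq_comp (B.twist v), h1.2, ← map_sub, h ξ hξ, hvt]
    rfl
  · exact ⟨0, zero_mem _, fun ξ _ => ⟨by simp, by
      rw [twist_zero, zero_apply, zero_apply, sub_zero, ← ev_toPMap, ev_zero]⟩⟩
  · rintro w z - - ⟨K, hK, h1⟩ ⟨L, hL, h2⟩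
    refine ⟨K + L, add_mem hK hL, fun ξ hξ => ⟨add_mem (h1 ξ hξ).1 (h2 ξ hξ).1, ?_⟩⟩
    rw [add_apply, B.evV_add T (hD.dom_le (h1 ξ hξ).1) (hD.dom_le (h2 ξ hξ).1), add_apply,
      ← (h1 ξ hξ).2, ← (h2 ξ hξ).2, twist_add, add_apply]
    abel
  · rintro s w - ⟨K, hK, h1⟩
    refine ⟨s • K, Submodule.smul_mem _ _ hK, fun ξ hξ =>
      ⟨Submodule.smul_mem _ _ (h1 ξ hξ).1, ?_⟩⟩
    rw [smul_apply, B.evV_smul T s (hD.dom_le (h1 ξ hξ).1), smul_apply, ← (h1 ξ hξ).2, twist_smul,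
      smul_apply, smul_sub]

/-- `D_v` is common to both operators, so the shift of `D` is a shift of the horizontal part by the
same `T`. -/
theorem IsShift.supercommIs_Dh (hs : B.IsShift D E T) (hD : B.IsAdmissible D) {S K L : H →L[ℂ] H}
    (hS : ∀ ξ ∈ D.domain, S ξ ∈ D.domain ∧ B.evV T (S ξ) - B.twist S (B.evV T ξ) = L ξ)
    (h : B.SupercommIs (B.Dh D) S K) : B.SupercommIs (B.Dh E) S (K + L) := by
  refine Background.supercommIs_Dh (hs.domain_eq.trans_le hD.dom_le) fun ξ hξ => ?_
  rw [hs.domain_eq] at hξ ⊢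
  obtain ⟨h1, h2⟩ := hS ξ hξ
  have h3 := (h ξ (ev_Dh hD.dom_le hξ).1).2
  rw [(ev_Dh hD.dom_le hξ).2, (ev_Dh hD.dom_le h1).2] at h3
  refine ⟨h1, ?_⟩
  rw [hs.ev_eq _ h1, hs.ev_eq ξ hξ, add_apply, ← h2, ← h3]
  simp only [map_add, map_sub]
  abel

end Smooth

end Background

end NCGauge

end

noncomputable section

namespace NCGauge

namespace Background

variable {m n : ℕ} {G A H : Type*} [TopologicalSpace G]
  [ChartedSpace (EuclideanSpace ℝ (Fin m)) G] [Group G]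
  [CStarAlgebra A] [PartialOrder A] [StarOrderedRing A]
  [NormedAddCommGroup H] [InnerProductSpace ℂ H] [CompleteSpace H]
  {B : Background m n G A H} {D E : H →ₗ.[ℂ] H} {T T' : B.VDom →L[ℂ] H}

/-! ### Admissibility of shifts -/

/-- `T` supercommutes with the odd Clifford element `c(X^♭)`. Shifts therefore have the same moment
map and meet the hypothesis of the estimate `IsAdmissible.dU_bound`. -/
theorem IsShift.anticomm_cFlat (hs : B.IsShift D E T) (hD : B.IsAdmissible D)
    (hT : B.IsPotential D T) (X : Lie m G) {ξ : H} (hξ : ξ ∈ D.domain) :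
    ev E (B.cFlat X ξ) + B.cFlat X (ev E ξ) = ev D (B.cFlat X ξ) + B.cFlat X (ev D ξ) := by
  have hX := B.cFlat_mem_clifford X
  rw [hs.ev_eq _ (hD.clifford_mem hX hξ), hs.ev_eq ξ hξ, hT.clifford _ hX ξ hξ, twist_cFlat,
    map_add, neg_apply]
  abel

theorem IsShift.symm (hs : B.IsShift D E T) (hD : B.IsAdmissible D) (hT : B.IsPotential D T) :
    Symm E := fun ξ hξ η hη => by
  rw [hs.domain_eq] at hξ hη
  rw [hs.ev_eq ξ hξ, hs.ev_eq η hη, inner_add_left, inner_add_right, hD.symm ξ hξ η hη,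
    hT.symmetric ξ hξ η hη]

theorem IsShift.invariant (hs : B.IsShift D E T) (hD : B.IsAdmissible D)
    (hT : B.IsPotential D T) : B.GInvariant E := fun g ξ hξ => by
  rw [hs.domain_eq] at hξ ⊢
  have h := hD.triple.invariant g ξ hξ
  exact ⟨h.1, by rw [hs.ev_eq _ h.1, hs.ev_eq ξ hξ, h.2, hT.invariant g ξ hξ, map_add]⟩

theorem IsShift.nodd (hs : B.IsShift D E T) (hD : B.IsAdmissible D) (hT : B.IsPotential D T) :
    B.NOdd E := by
  refine ⟨fun ξ hξ => ?_, fun i ξ hξ => ?_⟩ <;> rw [hs.domain_eq] at hξ ⊢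
  · have h := hD.triple.nodd.1 ξ hξ
    refine ⟨h.1, ?_⟩
    rw [hs.ev_eq _ h.1, hs.ev_eq ξ hξ, h.2, hT.odd ξ hξ, map_add, neg_add]
  · have h := hD.triple.nodd.2 i ξ hξ
    exact ⟨h.1, by rw [hs.ev_eq _ h.1, hs.ev_eq ξ hξ, h.2, hT.multigrading i ξ hξ, map_add]⟩

theorem IsShift.isVerticalGeometry (hs : B.IsShift D E T) (hD : B.IsAdmissible D)
    (hT : B.IsPotential D T) : B.IsVerticalGeometry E := by
  have hg := hD.geometry
  have hdom : E.domain ⊓ B.mulSpace ⊤ = D.domain ⊓ B.mulSpace ⊤ := by rw [hs.domain_eq]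
  refine ⟨?_, fun f hf => ?_, ?_, fun X => ?_⟩
  · rw [hs.domain_eq]; exact hg.coeff_dom
  · rw [hdom]
    refine LocBddAdequate.congr (fun ξ hξ => ?_) (hg.coeff_comm f hf)
    rw [inf_mulSpace_top] at hξ
    have hS := B.π_mem_clifford hf
    rw [hs.ev_eq _ (hD.clifford_mem hS hξ), hs.ev_eq ξ hξ, hT.clifford _ hS ξ hξ,
      B.twist_π_coeff hf, map_add]
    abel
  · rw [hs.domain_eq]; exact hg.clifford_dom
  · rw [hdom]
    refine LocBddAdequate.congr (fun ξ hξ => ?_) (hg.moment_bdd X)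
    rw [inf_mulSpace_top] at hξ
    rw [moment, moment, hs.anticomm_cFlat hD hT X hξ]

variable [LieGroup (𝓡 m) ∞ G]

theorem isShift_add (hD : B.IsAdmissible D) (T : B.VDom →L[ℂ] H) :
    B.IsShift D (D + B.toPMap T) T where
  domain_eq := inf_eq_left.2 hD.dom_le
  ev_eq _ hξ := ev_add_op (S := B.toPMap T) hξ (hD.dom_le hξ)

/-- Each `tT` is again a potential, so the whole path `D + tT` satisfies the Gårding estimate with
the constant of `D`. This uniformity is what the continuity method requires. -/
theorem IsPotential.bound (hD : B.IsAdmissible D) (hT : B.IsPotential D T) :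
    ∃ C : ℝ, 0 ≤ C ∧ ∀ t : ℝ, ∀ ξ ∈ D.domain,
      ‖B.evV T ξ‖ ≤ C * (‖ev D ξ + (t : ℂ) • B.evV T ξ‖ + ‖ξ‖) := by
  obtain ⟨C, hC0, hC⟩ := hD.graph_bound T
  refine ⟨C, hC0, fun t ξ hξ => ?_⟩
  have hs := isShift_add hD (t • T)
  have ht : B.IsPotential D (t • T) := (B.potentials D).smul_mem t hT
  have := hC _ hs.domain_eq (hs.symm hD ht) (hs.invariant hD ht)
    (fun X ξ hξ => hs.anticomm_cFlat hD ht X hξ) ξ hξ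
  rwa [hs.ev_eq ξ hξ, B.real_smul_evV] at this

theorem IsShift.surjI (hs : B.IsShift D E T) (hD : B.IsAdmissible D) (hT : B.IsPotential D T) :
    SurjI E := by
  obtain ⟨C, hC0, hC⟩ := hT.bound hD
  have h := hD.symm.surjI_of_uniform_bound hD.surjI (W := B.toPMap T) hD.dom_le hT.symmetric hC0
    fun t _ _ ξ hξ => hC t ξ hξ
  have h' := isShift_add hD T
  intro η
  obtain ⟨ξ, hξ, e⟩ := h η
  rw [h'.domain_eq] at hξ
  refine ⟨ξ, hs.domain_eq ▸ hξ, ?_⟩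
  rw [← e, h'.ev_eq ξ hξ, hs.ev_eq ξ hξ]

theorem IsShift.isSelfAdjoint (hs : B.IsShift D E T) (hD : B.IsAdmissible D)
    (hT : B.IsPotential D T) : IsSelfAdjoint E := by
  refine (hs.symm hD hT).isSelfAdjoint (hs.domain_eq ▸ hD.triple.dense) (hs.surjI hD hT)
    fun η => ?_
  -- Oddness exchanges `i` and `-i`: `(E - i)γξ = -γ(E + i)ξ = η`.
  obtain ⟨ξ, hξ, e⟩ := hs.surjI hD hT (-B.R.γ η)
  obtain ⟨h1, h2⟩ := (hs.nodd hD hT).1 ξ hξ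
  refine ⟨B.R.γ ξ, h1, ?_⟩
  rw [h2, ← map_smul, ← neg_add', ← map_add, e, map_neg, neg_neg, γ_apply_γ]

theorem IsShift.isSpectralTriple (hs : B.IsShift D E T) (hD : B.IsAdmissible D)
    (hT : B.IsPotential D T) : B.IsSpectralTriple E where
  dense := hs.domain_eq ▸ hD.triple.dense
  selfAdjoint := hs.isSelfAdjoint hD hT
  nodd := hs.nodd hD hT
  lipschitz a ha := by
    obtain ⟨K, hK⟩ := hD.triple.lipschitz a ha
    obtain ⟨L, -, hL⟩ := hT.commutator a ha
    exact ⟨K + L, (hs.supercommIs_iff (fun ξ hξ => hD.π_mem ha hξ) hL).2 hK⟩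
  resolvent := by
    obtain ⟨Q, hQ, hcomp⟩ := hD.triple.resolvent
    have hsym := hs.symm hD hT
    obtain ⟨R, hR⟩ := hsym.exists_resolvent (hs.surjI hD hT)
    refine ⟨R, hR, fun a ha => ?_⟩
    obtain ⟨C, hC0, hC⟩ := hT.bound hD
    have hRD : ∀ η, R η ∈ D.domain := fun η => hs.domain_eq ▸ (hR η).1
    -- `W = T(E + i)⁻¹` is bounded by the relative bound at `t = 1`. The resolvent identity `(E +
    -- i)⁻¹ = (D + i)⁻¹(1 - W)` then carries compactness over from `D`.
    let W : H →L[ℂ] H := LinearMap.mkContinuous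
      { toFun := fun η => B.evV T (R η)
        map_add' := fun x y => by
          rw [map_add, B.evV_add T (hD.dom_le (hRD x)) (hD.dom_le (hRD y))]
        map_smul' := fun c x => by
          rw [map_smul, B.evV_smul T c (hD.dom_le (hRD x)), RingHom.id_apply] } (C * 2) fun η => by
        have h1 := hsym.norm_le (hR η).1
        rw [(hR η).2, hs.ev_eq _ (hRD η)] at h1
        have h2 := hC 1 _ (hRD η)
        rw [Complex.ofReal_one, one_smul] at h2
        refine h2.trans ?_
        rw [mul_assoc]
        exact mul_le_mul_of_nonneg_left (by linarith [h1.1, h1.2]) hC0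
    have hRQ : ∀ η, R η = Q (η - W η) := fun η => by
      refine hD.symm.injective (hRD η) (hQ _).1 ?_
      rw [(hQ _).2, eq_sub_iff_add_eq]
      have h1 := (hR η).2
      rw [hs.ev_eq _ (hRD η)] at h1
      change ev D (R η) + Complex.I • R η + B.evV T (R η) = η
      exact (add_right_comm _ _ _).trans h1
    have e : (⇑(B.R.π a * R) : H → H) = ⇑(B.R.π a * Q) ∘ ⇑((1 : H →L[ℂ] H) - W) := by
      funext η
      exact congrArg (B.R.π a) (hRQ η)
    rw [e]
    exact (hcomp a ha).comp_clm _
  complete := by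
    obtain ⟨C, hC⟩ := hD.triple.complete
    refine ⟨C, fun k => ?_⟩
    obtain ⟨K, hK, hKC⟩ := hC k
    exact ⟨K, (hs.supercommIs_fixed_iff hD hT.fixed ⟨B.φ_mem k, B.φ_fixed k⟩).2 hK, hKC⟩
  invariant := hs.invariant hD hT
  core := by
    rw [inf_mulSpace_top]
    exact hasCore_domain (hs.isSelfAdjoint hD hT).isClosed
  C1 := by
    rw [inf_mulSpace_top, hs.domain_eq]
    exact hD.dom_le_C1

/-- An element `b` of `𝒜^G` belongs to `(V_ρ 𝒜)^G`, and `[D_v, b] = 0`, so `[E_h, b] = [E, b]`. The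
admissibility condition thus implies the vertical half of exact principality. -/
theorem verticalOneForms_le (hD : B.IsAdmissible D) (hE : E.domain = D.domain) :
    B.verticalOneForms E ≤ B.verticalOneFormsV (B.Dh E) := by
  refine Submodule.topologicalClosure_mono (Submodule.span_mono ?_)
  rintro S ⟨w, hw, b, K, hb, hK, rfl⟩
  refine ⟨w, hw, B.R.π b, Submodule.subset_span ⟨∅, ∅, b, hb.1, ?_⟩, K, fun g => ?_,
    supercommIs_Dh (hE.trans_le hD.dom_le) fun ξ hξ => ?_, rfl⟩
  · simp [cliffordMonomial]
  · rw [← B.commute_π_of_fixed hb.2, mul_assoc, u_mul_star, mul_one]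
  · have h1 := (hD.supercommIs_Dv_fixed hb.2 ξ (hD.dom_le (hE ▸ hξ))).2
    obtain ⟨h2, h3⟩ := hK ξ hξ
    refine ⟨h2, ?_⟩
    rw [← h3, map_sub, sub_sub_sub_comm, h1, zero_apply, sub_zero]

theorem IsShift.isAdmissible (hs : B.IsShift D E T) (hD : B.IsAdmissible D)
    (hT : B.IsPotential D T) : B.IsAdmissible E := by
  have hadm : ∀ w ∈ B.V𝒜, ∃ K ∈ B.verticalOneForms E, B.SupercommIs (B.Dh E) w K := by
    intro w hw
    obtain ⟨K, hK, h1⟩ := hD.admissible w hw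
    obtain ⟨L, hL, h2⟩ := hT.commutator_vertical hD hw
    rw [hs.verticalOneForms_eq hD hT.fixed]
    exact ⟨K + L, add_mem hK hL, hs.supercommIs_Dh hD h2 h1⟩
  refine
    { triple := hs.isSpectralTriple hD hT
      geometry := hs.isVerticalGeometry hD hT
      principal :=
        { fixed_dense := hD.principal.fixed_dense
          generates := hD.principal.generates
          faithful := hD.principal.faithful
          horizontal := fun a ha => ?_
          horizontal_vertical := fun w hw => ?_ }
      core := ?_
      admissible := hadm }
  · obtain ⟨K, hK, h1⟩ := hD.principal.horizontal a ha
    obtain ⟨L, hL, h2⟩ := hT.commutator a ha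
    rw [hs.oneForms_eq hD hT.fixed]
    exact ⟨K + L, add_mem hK hL,
      hs.supercommIs_Dh hD (fun ξ hξ => ⟨hD.π_mem ha hξ, h2 ξ hξ⟩) h1⟩
  · obtain ⟨K, hK, h1⟩ := hadm w hw
    exact ⟨K, verticalOneForms_le hD hs.domain_eq hK, h1⟩
  · have h : B.smoothDom E = E.domain := by
      rw [smoothDom, hs.domain_eq]
      exact hD.smoothDom_eq
    rw [h]
    exact hasCore_domain (hs.isSelfAdjoint hD hT).isClosed

/-! ### Gauge comparability and relative gauge potentials -/

theorem IsShift.jointDom_eq (hs : B.IsShift D E T) (hD : B.IsAdmissible D) :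
    B.jointDom D E = D.domain := by
  rw [hD.jointDom_eq, hs.domain_eq, inf_idem]

theorem IsShift.gaugeComparable (hs : B.IsShift D E T) (hD : B.IsAdmissible D)
    (hT : B.IsPotential D T) : B.GaugeComparable D E := by
  have hev : ∀ ξ ∈ D.domain, ev D ξ - ev E ξ = -B.evV T ξ := fun ξ hξ => by
    rw [hs.ev_eq ξ hξ]; abel
  have hsc : ∀ S : H →L[ℂ] H, (∀ ξ ∈ D.domain, S ξ ∈ D.domain) →
      (∀ ξ ∈ D.domain, B.evV T (S ξ) = B.twist S (B.evV T ξ)) →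
      B.Supercommutes D.domain (fun ξ => ev D ξ - ev E ξ) S := fun S h1 h2 ξ hξ => by
    refine ⟨h1 ξ hξ, ?_⟩
    beta_reduce
    rw [hev _ (h1 ξ hξ), hev ξ hξ, h2 ξ hξ, map_neg]
  constructor <;> rw [hs.jointDom_eq hD]
  · exact hasCore_domain hD.isClosed
  · rw [← hs.domain_eq]
    exact hasCore_domain (hs.isSelfAdjoint hD hT).isClosed
  · exact hD.hasCore_Dv
  · intro a ha
    refine ⟨-T.comp (vmap (hD.supercommIs_Dv_π ha)), (extendsTo_iff hD.dom_le).2 fun ξ hξ => ?_⟩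
    rw [B.neg_evV, evV_comp_vmap _ _ (hD.dom_le hξ), hev _ (hD.π_mem ha hξ)]
  · exact ⟨fun S hS => hsc S (fun ξ hξ => hD.clifford_mem hS hξ) (hT.clifford S hS),
      fun b hb => hsc _ (fun ξ hξ => hD.π_mem hb.1 hξ) (hT.fixed b hb)⟩

theorem GaugeComparable.exists_isShift (h : B.GaugeComparable D E) (hD : B.IsAdmissible D)
    (hE : B.IsAdmissible E) : ∃ T, B.IsPotential D T ∧ B.IsShift D E T := by
  have hdom := h.domain_eq hD hE
  have hj : B.jointDom D E = D.domain := by rw [hD.jointDom_eq, hdom, inf_idem]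
  obtain ⟨T, hT⟩ := h.exists_extendsTo
  rw [hj] at hT
  have hev := (extendsTo_iff hD.dom_le).1 hT
  have hs : B.IsShift D E T := ⟨hdom, fun ξ hξ => by rw [hev ξ hξ]; abel⟩
  have hsup := h.supercommutes
  rw [hj] at hsup
  have hsc : ∀ S : H →L[ℂ] H, B.Supercommutes D.domain (fun ξ => ev D ξ - ev E ξ) S →
      ∀ ξ ∈ D.domain, B.evV T (S ξ) = B.twist S (B.evV T ξ) := fun S hS ξ hξ => by
    obtain ⟨h1, h2⟩ := hS ξ hξ
    rw [hev _ h1, hev ξ hξ, ← neg_sub (ev D (S ξ)), ← neg_sub (ev D ξ), map_neg, ← h2]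
  have hfix : ∀ b, B.FixedA b → ∀ ξ ∈ D.domain,
      B.evV T (B.R.π b ξ) = B.twist (B.R.π b) (B.evV T ξ) := fun b hb => hsc _ (hsup.2 b hb)
  refine ⟨T, ⟨fun ξ hξ => ?_, fun i ξ hξ => ?_, fun ξ hξ η hη => ?_, fun g ξ hξ => ?_,
    fun S hS => hsc S (hsup.1 S hS), hfix, fun a ha => ?_⟩, hs⟩
  · have h1 := hD.triple.nodd.1 ξ hξ
    have h2 := hE.triple.nodd.1 ξ (hdom ▸ hξ)
    rw [hev _ h1.1, hev ξ hξ, h1.2, h2.2, map_sub]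
    abel
  · have h1 := hD.triple.nodd.2 i ξ hξ
    have h2 := hE.triple.nodd.2 i ξ (hdom ▸ hξ)
    rw [hev _ h1.1, hev ξ hξ, h1.2, h2.2, map_sub]
  · rw [hev ξ hξ, hev η hη, inner_sub_left, inner_sub_right, hD.symm ξ hξ η hη,
      hE.symm ξ (hdom ▸ hξ) η (hdom ▸ hη)]
  · have h1 := hD.triple.invariant g ξ hξ
    have h2 := hE.triple.invariant g ξ (hdom ▸ hξ)
    rw [hev _ h1.1, hev ξ hξ, h1.2, h2.2, map_sub]
  -- `[D, a]` itself need not be a one-form, but `[D_h, a]` and `[E_h, a]` are; in their difference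
  -- `D_v` cancels and `[T, a]` remains.
  · obtain ⟨K, hK, h1⟩ := hD.principal.horizontal a ha
    obtain ⟨L, hL, h2⟩ := hE.principal.horizontal a ha
    have hone : B.oneForms E = B.oneForms D := hs.oneForms_eq hD hfix
    rw [hone] at hL
    refine ⟨L - K, sub_mem hL hK, fun ξ hξ => ?_⟩
    have hξE : ξ ∈ E.domain := hdom ▸ hξ
    have ha1 := hD.π_mem ha hξ
    have ha2 := hE.π_mem ha hξE
    have h3 := (h1 ξ (ev_Dh hD.dom_le hξ).1).2
    have h4 := (h2 ξ (ev_Dh hE.dom_le hξE).1).2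
    rw [(ev_Dh hD.dom_le hξ).2, (ev_Dh hD.dom_le ha1).2] at h3
    rw [(ev_Dh hE.dom_le hξE).2, (ev_Dh hE.dom_le ha2).2] at h4
    rw [sub_apply, ← h3, ← h4, hev _ ha1, hev ξ hξ]
    simp only [map_sub]
    abel

end Background

end NCGauge

end

noncomputable section

namespace NCGauge

namespace Background

variable {m n : ℕ} {G A H : Type*} [TopologicalSpace G]
  [ChartedSpace (EuclideanSpace ℝ (Fin m)) G] [Group G]
  [CStarAlgebra A] [PartialOrder A] [StarOrderedRing A]
  [NormedAddCommGroup H] [InnerProductSpace ℂ H] [CompleteSpace H]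
  {B : Background m n G A H} {D E E' D₀ : H →ₗ.[ℂ] H} {T T' : B.VDom →L[ℂ] H}

/-! ### The Atiyah space as a torsor -/

theorem IsShift.unique_operator (h : B.IsShift D E T) (h' : B.IsShift D E' T) : E = E' :=
  ext_of_ev (h.domain_eq.trans h'.domain_eq.symm) fun ξ hξ => by
    rw [h.domain_eq] at hξ
    rw [h.ev_eq ξ hξ, h'.ev_eq ξ hξ]

theorem IsShift.trans (h : B.IsShift D E T) (h' : B.IsShift E E' T') :
    B.IsShift D E' (T + T') where
  domain_eq := h'.domain_eq.trans h.domain_eq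
  ev_eq ξ hξ := by
    rw [h'.ev_eq ξ (h.domain_eq ▸ hξ), h.ev_eq ξ hξ, B.add_evV, add_assoc]

theorem IsShift.reverse (h : B.IsShift D E T) : B.IsShift E D (-T) where
  domain_eq := h.domain_eq.symm
  ev_eq ξ hξ := by
    rw [h.domain_eq] at hξ
    rw [h.ev_eq ξ hξ, B.neg_evV, add_neg_cancel_right]

variable [LieGroup (𝓡 m) ∞ G]

theorem IsShift.unique (hD : B.IsAdmissible D) (h : B.IsShift D E T) (h' : B.IsShift D E T') :
    T = T' := hD.ext_VDom fun ξ hξ => by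
  have := h.ev_eq ξ hξ
  rw [h'.ev_eq ξ hξ] at this
  exact (add_left_cancel this).symm

/-- `extension` chooses an arbitrary extension; density of `Dom D` in `Dom D_v` leaves only one. -/
theorem IsAdmissible.extension_eq (hD : B.IsAdmissible D) {V : Submodule ℂ H} {M : H → H}
    (hV : D.domain ≤ V) (h : B.ExtendsTo V M T) : B.extension V M = T := by
  have hex : ∃ S, B.ExtendsTo V M S := ⟨T, h⟩
  have e : B.extension V M = hex.choose := dif_pos hex
  rw [e]
  have h1 := (extendsTo_iff h.1).1 h
  have h2 := (extendsTo_iff h.1).1 hex.choose_spec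
  exact hD.ext_VDom fun ξ hξ => by rw [h1 ξ (hV hξ), h2 ξ (hV hξ)]

/-- The point of the Atiyah space at which the difference with the base point is `T`. -/
def atiyahPoint (hD₀ : B.IsAdmissible D₀) (T : B.potentials D₀) : B.Atiyah D₀ :=
  ⟨D₀ + B.toPMap T.1, (isShift_add hD₀ T.1).isAdmissible hD₀ T.2,
    (isShift_add hD₀ T.1).gaugeComparable hD₀ T.2⟩

theorem Atiyah.exists_isShift (hD₀ : B.IsAdmissible D₀) (D : B.Atiyah D₀) :
    ∃ T : B.potentials D₀, B.IsShift D₀ D.1 T.1 := by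
  obtain ⟨T, h1, h2⟩ := D.2.2.exists_isShift hD₀ D.2.1
  exact ⟨⟨T, h1⟩, h2⟩

/-- The bijection between the Atiyah space and the space of relative gauge potentials given by the
difference with the base point. -/
def atiyahEquiv (hD₀ : B.IsAdmissible D₀) : B.Atiyah D₀ ≃ B.potentials D₀ where
  toFun D := (Atiyah.exists_isShift hD₀ D).choose
  invFun T := atiyahPoint hD₀ T
  left_inv D := Subtype.ext ((isShift_add hD₀ _).unique_operator
    (Atiyah.exists_isShift hD₀ D).choose_spec)
  right_inv T := Subtype.ext (IsShift.unique hD₀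
    (Atiyah.exists_isShift hD₀ (atiyahPoint hD₀ T)).choose_spec (isShift_add hD₀ T.1))

theorem isShift_atiyahEquiv (hD₀ : B.IsAdmissible D₀) (D : B.Atiyah D₀) :
    B.IsShift D₀ D.1 (atiyahEquiv hD₀ D).1 :=
  (Atiyah.exists_isShift hD₀ D).choose_spec

/-- The affine structure of the Atiyah space. -/
abbrev atiyahTorsor (hD₀ : B.IsAdmissible D₀) : AddTorsor (B.potentials D₀) (B.Atiyah D₀) where
  vadd T D := (atiyahEquiv hD₀).symm (T + atiyahEquiv hD₀ D)
  zero_vadd D := by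
    change (atiyahEquiv hD₀).symm (0 + atiyahEquiv hD₀ D) = D
    rw [zero_add, Equiv.symm_apply_apply]
  add_vadd T S D := by
    change (atiyahEquiv hD₀).symm (T + S + atiyahEquiv hD₀ D) =
      (atiyahEquiv hD₀).symm (T + atiyahEquiv hD₀ ((atiyahEquiv hD₀).symm (S + atiyahEquiv hD₀ D)))
    rw [Equiv.apply_symm_apply, add_assoc]
  vsub D E := atiyahEquiv hD₀ D - atiyahEquiv hD₀ E
  nonempty := ⟨(atiyahEquiv hD₀).symm 0⟩
  vsub_vadd' D E := by
    change (atiyahEquiv hD₀).symm (atiyahEquiv hD₀ D - atiyahEquiv hD₀ E + atiyahEquiv hD₀ E) = D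
    rw [sub_add_cancel, Equiv.symm_apply_apply]
  vadd_vsub' T D := by
    change atiyahEquiv hD₀ ((atiyahEquiv hD₀).symm (T + atiyahEquiv hD₀ D)) - atiyahEquiv hD₀ D = T
    rw [Equiv.apply_symm_apply, add_sub_cancel_right]

theorem Atiyah.isShift_sub (hD₀ : B.IsAdmissible D₀) (D E : B.Atiyah D₀) :
    B.IsShift E.1 D.1 (atiyahEquiv hD₀ D - atiyahEquiv hD₀ E : B.potentials D₀).1 := by
  have h := (isShift_atiyahEquiv hD₀ E).reverse.trans (isShift_atiyahEquiv hD₀ D)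
  rwa [neg_add_eq_sub] at h

theorem Atiyah.isPotential_iff (hD₀ : B.IsAdmissible D₀) (D : B.Atiyah D₀) :
    B.IsPotential D.1 T ↔ T ∈ B.potentials D₀ :=
  (isShift_atiyahEquiv hD₀ D).isPotential_iff hD₀ (atiyahEquiv hD₀ D).2

theorem Atiyah.domain_eq (hD₀ : B.IsAdmissible D₀) (D : B.Atiyah D₀) :
    D.1.domain = D₀.domain := (isShift_atiyahEquiv hD₀ D).domain_eq

/-- `E - D` is symmetric with dense domain, hence closable. Vectors of `Dom D` approaching `x` in
the graph norm of `D_v` have images under `E - D` that converge to `T x`. -/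
theorem IsShift.closure_sub (h : B.IsShift D E T) (hD : B.IsAdmissible D) (hT : B.IsPotential D T)
    (x : B.VDom) :
    ∃ h : B.incl x ∈ (E - D).closure.domain, T x = (E - D).closure ⟨B.incl x, h⟩ := by
  have hdom : (E - D).domain = D.domain := by
    change E.domain ⊓ D.domain = _
    rw [h.domain_eq, inf_idem]
  have hev : ∀ ξ ∈ D.domain, ev (E - D) ξ = B.evV T ξ := fun ξ hξ => by
    rw [ev_sub_op (h.domain_eq ▸ hξ) hξ, h.ev_eq ξ hξ, add_sub_cancel_left]
  have hcl : (E - D).IsClosable := isClosable_of_formal_adjoint hD.triple.dense fun y hy =>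
    ⟨B.evV T y, fun ξ hξ => by
      rw [hdom] at hξ
      rw [hev ξ hξ, hT.symmetric y hy ξ hξ]⟩
  obtain ⟨y, hy, h1, h2⟩ := exists_seq_of_hasCore hD.isClosed_Dv hD.hasCore_Dv (B.incl_mem x)
  have h3 : Tendsto (fun k => ev (E - D) (y k)) atTop (𝓝 (T x)) := by
    rw [tendsto_iff_norm_sub_tendsto_zero]
    have h4 : ∀ k, ‖ev (E - D) (y k) - T x‖ ≤
        ‖T‖ * (‖y k - B.incl x‖ + ‖ev B.Dv (y k) - ev B.Dv (B.incl x)‖) := fun k => by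
      have hyk := hD.dom_le (hy k)
      have h5 := B.norm_evV_le T (sub_mem hyk (B.incl_mem x))
      rw [ev_sub hyk (B.incl_mem x)] at h5
      rwa [hev _ (hy k), ← B.evV_incl T x, ← ev_toPMap, ← ev_toPMap,
        ← ev_sub (T := B.toPMap T) hyk (B.incl_mem x)]
    refine squeeze_zero (fun _ => norm_nonneg _) h4 ?_
    simpa using ((tendsto_iff_norm_sub_tendsto_zero.1 h1).add
      (tendsto_iff_norm_sub_tendsto_zero.1 h2)).const_mul ‖T‖
  have h6 := mem_closure_of_closable hcl (ξ := B.incl x) (η := T x)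
    (mem_closure_of_tendsto (h1.prodMk_nhds h3) (Eventually.of_forall fun k =>
      mem_graph_iff_ev.2 ⟨hdom ▸ hy k, rfl⟩))
  exact ⟨h6.1, h6.2.symm.trans (ev_of_mem h6.1)⟩

/-! ### The topologies -/

/-- Composition with `φ_k` on `L(Dom D_v, H)`. -/
def compφ (hD : B.IsAdmissible D) (k : ℕ) (T : B.VDom →L[ℂ] H) : B.VDom →L[ℂ] H :=
  T.comp (vmap (hD.supercommIs_Dv_fixed (B.φ_fixed k)))

theorem continuous_compφ (hD : B.IsAdmissible D) (k : ℕ) :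
    Continuous (compφ hD k : (B.VDom →L[ℂ] H) → B.VDom →L[ℂ] H) := by
  unfold compφ
  fun_prop

theorem evV_compφ (hD : B.IsAdmissible D) (k : ℕ) (T : B.VDom →L[ℂ] H) {ξ : H}
    (hξ : ξ ∈ B.Dv.domain) : B.evV (compφ hD k T) ξ = B.evV T (B.R.π (B.φ k) ξ) :=
  evV_comp_vmap _ T hξ

theorem IsPotential.eq_comp_compφ (hD : B.IsAdmissible D) (hT : B.IsPotential D T) :
    T = (B.R.π (B.P.gr B.ψu)).comp (compφ hD B.unitIndex T) := hD.ext_VDom fun ξ hξ => by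
  have h1 : B.evV T (B.R.π (B.φ B.unitIndex) ξ) = B.R.π (B.P.gr B.φu) (B.evV T ξ) := by
    have := hT.fixed _ ⟨B.φu_mem, B.φu_fixed⟩ ξ hξ
    rwa [twist_π] at this
  rw [evV_clm_comp _ _ (hD.dom_le hξ), evV_compφ hD _ _ (hD.dom_le hξ), h1, π_gr_ψu_φu]

theorem potentials_topology (hD : B.IsAdmissible D) :
    (inferInstance : TopologicalSpace (B.potentials D)) =
      ⨅ k, TopologicalSpace.induced (fun T : B.potentials D => compφ hD k T.1) inferInstance := by
  refine le_antisymm (le_iInf fun k => ?_) (iInf_le_of_le B.unitIndex ?_)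
  · exact continuous_iff_le_induced.1 ((continuous_compφ hD k).comp continuous_subtype_val)
  -- The single seminorm at `unitIndex` already dominates the norm, because `T` is recovered
  -- continuously from `T φu`.
  · have e : (Subtype.val : B.potentials D → B.VDom →L[ℂ] H) =
        (fun S => (B.R.π (B.P.gr B.ψu)).comp S) ∘ fun T => compφ hD B.unitIndex T.1 := by
      funext T
      exact IsPotential.eq_comp_compφ hD T.2
    have hc : Continuous fun S : B.VDom →L[ℂ] H => (B.R.π (B.P.gr B.ψu)).comp S := by fun_prop
    refine le_trans ?_ (congrArg (TopologicalSpace.induced · inferInstance) e).ge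
    rw [← induced_compose]
    exact induced_mono (continuous_iff_le_induced.1 hc)

theorem extension_evV_φ (hD : B.IsAdmissible D) (k : ℕ) (T : B.VDom →L[ℂ] H) :
    (B.extension B.Dv.domain fun ξ => B.evV T (B.R.π (B.φ k) ξ)) = compφ hD k T :=
  hD.extension_eq hD.dom_le ((extendsTo_iff le_rfl).2 fun _ hξ => evV_compφ hD k T hξ)

theorem ν_eq (hD₀ : B.IsAdmissible D₀) (k : ℕ) (D : B.Atiyah D₀) :
    B.ν D₀ k D = compφ hD₀ k (atiyahEquiv hD₀ D).1 := by
  have hj : B.jointDom D.1 D₀ = D₀.domain := by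
    rw [D.2.1.jointDom_eq, Atiyah.domain_eq hD₀ D, inf_idem]
  unfold ν
  rw [hj]
  refine hD₀.extension_eq le_rfl ((extendsTo_iff hD₀.dom_le).2 fun ξ hξ => ?_)
  rw [evV_compφ hD₀ k _ (hD₀.dom_le hξ),
    (isShift_atiyahEquiv hD₀ D).ev_eq _ (hD₀.π_mem (B.φ_mem k) hξ), add_sub_cancel_left]

theorem isInducing_atiyahEquiv (hD₀ : B.IsAdmissible D₀) : IsInducing (atiyahEquiv hD₀) := by
  refine ⟨?_⟩
  change _ = TopologicalSpace.induced (atiyahEquiv hD₀)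
    (inferInstance : TopologicalSpace (B.potentials D₀))
  rw [potentials_topology hD₀, induced_iInf]
  refine iInf_congr fun k => ?_
  rw [induced_compose]
  congr 1
  funext D
  exact ν_eq hD₀ k D

/-- The Atiyah space is homeomorphic to the space of relative gauge potentials. -/
def atiyahHomeomorph (hD₀ : B.IsAdmissible D₀) : B.Atiyah D₀ ≃ₜ B.potentials D₀ :=
  (atiyahEquiv hD₀).toHomeomorphOfIsInducing (isInducing_atiyahEquiv hD₀)

theorem isTopologicalAddTorsor_atiyah (hD₀ : B.IsAdmissible D₀) :
    let _ := atiyahTorsor hD₀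
    IsTopologicalAddTorsor (B.Atiyah D₀) := by
  let _ := atiyahTorsor hD₀
  have h1 : Continuous fun p : B.potentials D₀ × B.Atiyah D₀ =>
      (atiyahHomeomorph hD₀).symm (p.1 + atiyahHomeomorph hD₀ p.2) := by fun_prop
  have h2 : Continuous fun p : B.Atiyah D₀ × B.Atiyah D₀ =>
      atiyahHomeomorph hD₀ p.1 - atiyahHomeomorph hD₀ p.2 := by fun_prop
  exact { continuous_vadd := h1, continuous_vsub := h2 }

theorem isHomeomorph_sub (hD₀ : B.IsAdmissible D₀) (D : B.Atiyah D₀) :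
    IsHomeomorph fun E : B.Atiyah D₀ => atiyahEquiv hD₀ E - atiyahEquiv hD₀ D :=
  ((atiyahHomeomorph hD₀).trans (Homeomorph.subRight (atiyahEquiv hD₀ D))).isHomeomorph

end Background

end NCGauge

end

noncomputable section

namespace NCGauge

/-! ### Conjugation of unbounded operators by unitaries. -/

section Unitary

variable {H : Type*} [NormedAddCommGroup H] [InnerProductSpace ℂ H] [CompleteSpace H]
  (S : unitary (H →L[ℂ] H))

theorem star_unitary_apply (ξ : H) : star (S : H →L[ℂ] H) ((S : H →L[ℂ] H) ξ) = ξ :=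
  DFunLike.congr_fun (Unitary.coe_star_mul_self S) ξ

theorem unitary_star_apply (ξ : H) : (S : H →L[ℂ] H) (star (S : H →L[ℂ] H) ξ) = ξ :=
  DFunLike.congr_fun (Unitary.coe_mul_star_self S) ξ

theorem unitary_mul_star : (S : H →L[ℂ] H) * star (S : H →L[ℂ] H) = 1 :=
  Unitary.coe_mul_star_self S

theorem inner_star_unitary (ξ η : H) :
    ⟪star (S : H →L[ℂ] H) ξ, η⟫_ℂ = ⟪ξ, (S : H →L[ℂ] H) η⟫_ℂ := by
  rw [ContinuousLinearMap.star_eq_adjoint, ContinuousLinearMap.adjoint_inner_left]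

theorem inner_unitary (ξ η : H) : ⟪(S : H →L[ℂ] H) ξ, η⟫_ℂ = ⟪ξ, star (S : H →L[ℂ] H) η⟫_ℂ := by
  rw [ContinuousLinearMap.star_eq_adjoint, ContinuousLinearMap.adjoint_inner_right]

theorem norm_unitary_apply (ξ : H) : ‖(S : H →L[ℂ] H) ξ‖ = ‖ξ‖ := by
  have h : ⟪(S : H →L[ℂ] H) ξ, (S : H →L[ℂ] H) ξ⟫_ℂ = ⟪ξ, ξ⟫_ℂ := by
    rw [inner_unitary, star_unitary_apply]
  rw [inner_self_eq_norm_sq_to_K, inner_self_eq_norm_sq_to_K] at h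
  exact (pow_left_inj₀ (norm_nonneg _) (norm_nonneg _) two_ne_zero).1 (by exact_mod_cast h)

theorem coe_inv_unitary : ((S⁻¹ : unitary (H →L[ℂ] H)) : H →L[ℂ] H) = star (S : H →L[ℂ] H) := by
  rw [← Unitary.star_eq_inv, Unitary.coe_star]

variable {S}

theorem star_unitary_commute {X : H →L[ℂ] H} (h : (S : H →L[ℂ] H) * X = X * S) :
    star (S : H →L[ℂ] H) * X = X * star (S : H →L[ℂ] H) := by
  calc star (S : H →L[ℂ] H) * X = star (S : H →L[ℂ] H) * (X * S) * star (S : H →L[ℂ] H) := by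
        rw [mul_assoc, mul_assoc, unitary_mul_star, mul_one]
    _ = X * star (S : H →L[ℂ] H) := by
        rw [← h, ← mul_assoc, Unitary.coe_star_mul_self, one_mul]

theorem mem_conj_domain {D : H →ₗ.[ℂ] H} {ξ : H} :
    ξ ∈ (conj S D).domain ↔ star (S : H →L[ℂ] H) ξ ∈ D.domain := Iff.rfl

theorem ev_conj {D : H →ₗ.[ℂ] H} {ξ : H} (h : star (S : H →L[ℂ] H) ξ ∈ D.domain) :
    ev (conj S D) ξ = (S : H →L[ℂ] H) (ev D (star (S : H →L[ℂ] H) ξ)) := by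
  rw [ev_of_mem (T := conj S D) h, ev_of_mem h]; rfl

theorem conj_one (D : H →ₗ.[ℂ] H) : conj 1 D = D := by
  have h1 : ∀ ξ : H, star ((1 : unitary (H →L[ℂ] H)) : H →L[ℂ] H) ξ = ξ := fun ξ => by simp
  have hdom : (conj 1 D).domain = D.domain := by
    ext ξ
    rw [mem_conj_domain, h1]
  refine ext_of_ev hdom fun ξ hξ => ?_
  rw [ev_conj hξ, h1]; rfl

theorem conj_mul (S R : unitary (H →L[ℂ] H)) (D : H →ₗ.[ℂ] H) :
    conj (S * R) D = conj S (conj R D) := by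
  have h1 : ∀ ξ : H, star ((S * R : unitary (H →L[ℂ] H)) : H →L[ℂ] H) ξ =
      star (R : H →L[ℂ] H) (star (S : H →L[ℂ] H) ξ) := fun ξ => by
    rw [Submonoid.coe_mul, star_mul]; rfl
  refine ext_of_ev ?_ fun ξ hξ => ?_
  · ext ξ
    rw [mem_conj_domain, mem_conj_domain, mem_conj_domain, h1]
  · have h2 : star (R : H →L[ℂ] H) (star (S : H →L[ℂ] H) ξ) ∈ D.domain := by
      rw [← h1]; exact hξ
    rw [ev_conj hξ, ev_conj (S := S) (D := conj R D) h2, ev_conj h2, h1]; rfl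

end Unitary

namespace Background

variable {m n : ℕ} {G A H : Type*} [TopologicalSpace G]
  [ChartedSpace (EuclideanSpace ℝ (Fin m)) G] [Group G]
  [CStarAlgebra A] [PartialOrder A] [StarOrderedRing A]
  [NormedAddCommGroup H] [InnerProductSpace ℂ H] [CompleteSpace H]
  {B : Background m n G A H} {D E D₀ : H →ₗ.[ℂ] H} {T : B.VDom →L[ℂ] H}
  {S R : unitary (H →L[ℂ] H)}

/-! ### Gauge transformations -/

/-- An unlocalised form of the conditions for a gauge transformation. -/
structure IsGauge (B : Background m n G A H) (D : H →ₗ.[ℂ] H) (S : unitary (H →L[ℂ] H)) :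
    Prop where
  even : (S : H →L[ℂ] H) * B.R.γ = B.R.γ * S
  invariant : ∀ g, (S : H →L[ℂ] H) * B.u g = B.u g * S
  multigrading : ∀ i, (S : H →L[ℂ] H) * B.R.e i = B.R.e i * S
  clifford : ∀ X ∈ B.clifford, (S : H →L[ℂ] H) * X = X * S
  fixed : ∀ a, B.P.Fixed a → (S : H →L[ℂ] H) * B.R.π a = B.R.π a * S
  algebra : ∀ a ∈ B.𝒜, ∃ b ∈ B.𝒜, (S : H →L[ℂ] H) * B.R.π a = B.R.π b * S
  algebra' : ∀ b ∈ B.𝒜, ∃ a ∈ B.𝒜, (S : H →L[ℂ] H) * B.R.π a = B.R.π b * S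
  dom : ∀ ξ ∈ D.domain, (S : H →L[ℂ] H) ξ ∈ D.domain
  dom' : ∀ ξ ∈ D.domain, star (S : H →L[ℂ] H) ξ ∈ D.domain
  bounded : ∃ T : B.VDom →L[ℂ] H, ∀ ξ ∈ D.domain, B.evV T ξ = comm D S ξ
  comm_clifford : ∀ X ∈ B.clifford, ∀ ξ ∈ D.domain,
    comm D S (X ξ) = B.twist X (comm D S ξ)
  comm_fixed : ∀ b, B.FixedA b → ∀ ξ ∈ D.domain,
    comm D S (B.R.π b ξ) = B.twist (B.R.π b) (comm D S ξ)

theorem IsGauge.twist_eq (h : B.IsGauge D S) : B.twist (S : H →L[ℂ] H) = S :=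
  B.twist_of_even h.even

theorem IsGauge.mul_twist (h : B.IsGauge D S) {X Y : H →L[ℂ] H}
    (hX : (S : H →L[ℂ] H) * X = Y * S) : (S : H →L[ℂ] H) * B.twist X = B.twist Y * S := by
  have := congrArg B.twist hX
  rwa [twist_mul, twist_mul, h.twist_eq] at this

theorem IsGauge.one (D : H →ₗ.[ℂ] H) : B.IsGauge D 1 := by
  have hc : ∀ ξ, comm D ((1 : unitary (H →L[ℂ] H)) : H →L[ℂ] H) ξ = 0 := fun ξ => by
    simp [comm]
  exact
    { even := by simp
      invariant := by simp
      multigrading := by simp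
      clifford := by simp
      fixed := by simp
      algebra := fun a ha => ⟨a, ha, by simp⟩
      algebra' := fun a ha => ⟨a, ha, by simp⟩
      dom := by simp
      dom' := by simp
      bounded := ⟨0, fun ξ _ => by rw [hc, B.zero_evV]⟩
      comm_clifford := fun X _ ξ _ => by rw [hc, hc, map_zero]
      comm_fixed := fun b _ ξ _ => by rw [hc, hc, map_zero] }

theorem IsGauge.ev_conj (h : B.IsGauge D S) {ξ : H} (hξ : ξ ∈ D.domain) :
    ev (conj S D) ξ = ev D ξ + (S : H →L[ℂ] H) (comm D (star (S : H →L[ℂ] H)) ξ) := by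
  rw [NCGauge.ev_conj (h.dom' ξ hξ), comm, map_sub, unitary_star_apply, add_sub_cancel]

variable [LieGroup (𝓡 m) ∞ G]

/-- `D_v` is built from `U`, `c` and `ρ` alone, and `S` commutes with all of these. -/
theorem IsGauge.supercommIs_Dv (h : B.IsGauge D S) (hD : B.IsAdmissible D) :
    B.SupercommIs B.Dv (S : H →L[ℂ] H) 0 :=
  hD.supercommIs_Dv_of_commute h.twist_eq h.invariant
    (fun _ => (h.clifford _ (B.c_mem_clifford _)).symm) (h.clifford _ B.cubic_mem_clifford).symm

theorem isGauge_of (hD : B.IsAdmissible D) (h : B.IsGaugeTransformation D S) : B.IsGauge D S := by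
  obtain ⟨h1, h2, h3, h4, h5, h6, h7, h8, h9⟩ := h
  rw [hD.smoothDom_eq] at h7 h8 h9
  refine ⟨h1, h2, h3, h4, h5, fun a ha => ?_, fun b hb => ?_, fun ξ hξ => ?_, fun ξ hξ => ?_, ?_,
    fun X hX ξ hξ => (h9.1 X hX ξ hξ).2, fun b hb ξ hξ => (h9.2 b hb ξ hξ).2⟩
  · obtain ⟨b, hb, e⟩ := h6.subset ⟨a, ha, rfl⟩
    refine ⟨b, hb, ?_⟩
    rw [← e, mul_assoc, Unitary.coe_star_mul_self, mul_one]
  · obtain ⟨a, ha, e⟩ := h6.superset ⟨b, hb, rfl⟩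
    refine ⟨a, ha, ?_⟩
    rw [e, mul_assoc, Unitary.coe_star_mul_self, mul_one]
  · rw [← h7]; exact ⟨ξ, hξ, rfl⟩
  · rw [← h7] at hξ
    obtain ⟨η, hη, rfl⟩ := hξ
    have : star (S : H →L[ℂ] H) ((S : H →L[ℂ] H) η) ∈ D.domain := by
      rwa [star_unitary_apply]
    exact this
  · obtain ⟨T, hT⟩ := exists_extendsTo h9.2 h8
    exact ⟨T, (extendsTo_iff hD.dom_le).1 hT⟩

theorem isGauge_iff (hD : B.IsAdmissible D) : B.IsGaugeTransformation D S ↔ B.IsGauge D S := by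
  refine ⟨isGauge_of hD, fun h => ?_⟩
  obtain ⟨T, hT⟩ := h.bounded
  refine ⟨h.even, h.invariant, h.multigrading, h.clifford, h.fixed, ?_, ?_, fun a ha => ?_, ?_⟩
  · ext X
    constructor
    · rintro ⟨a, ha, rfl⟩
      obtain ⟨b, hb, e⟩ := h.algebra a ha
      exact ⟨b, hb, by rw [e, mul_assoc, unitary_mul_star, mul_one]⟩
    · rintro ⟨b, hb, rfl⟩
      obtain ⟨a, ha, e⟩ := h.algebra' b hb
      exact ⟨a, ha, by rw [e, mul_assoc, unitary_mul_star, mul_one]⟩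
  · rw [hD.smoothDom_eq]
    ext ξ
    constructor
    · rintro ⟨η, hη, rfl⟩
      exact h.dom η hη
    · exact fun hξ => ⟨_, h.dom' ξ hξ, unitary_star_apply S ξ⟩
  · rw [hD.smoothDom_eq]
    refine ⟨T.comp (vmap (hD.supercommIs_Dv_π ha)), (extendsTo_iff hD.dom_le).2 fun ξ hξ => ?_⟩
    rw [evV_comp_vmap _ _ (hD.dom_le hξ), hT _ (hD.π_mem ha hξ)]
  · rw [hD.smoothDom_eq]
    exact ⟨fun X hX ξ hξ => ⟨hD.clifford_mem hX hξ, h.comm_clifford X hX ξ hξ⟩,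
      fun b hb ξ hξ => ⟨hD.π_mem hb.1 hξ, h.comm_fixed b hb ξ hξ⟩⟩

theorem IsGauge.mul (hD : B.IsAdmissible D) (hS : B.IsGauge D S) (hR : B.IsGauge D R) :
    B.IsGauge D (S * R) := by
  have hcomm : ∀ {X : H →L[ℂ] H}, (S : H →L[ℂ] H) * X = X * S → (R : H →L[ℂ] H) * X = X * R →
      ((S * R : unitary (H →L[ℂ] H)) : H →L[ℂ] H) * X =
        X * ((S * R : unitary (H →L[ℂ] H)) : H →L[ℂ] H) := fun {X} h1 h2 => by
    rw [Submonoid.coe_mul, mul_assoc, h2, ← mul_assoc, h1, mul_assoc]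
  -- The Leibniz rule `[D, SR] = [D, S]R + S[D, R]`.
  have hc : ∀ ξ, comm D ((S * R : unitary (H →L[ℂ] H)) : H →L[ℂ] H) ξ =
      comm D S ((R : H →L[ℂ] H) ξ) + (S : H →L[ℂ] H) (comm D R ξ) := fun ξ => by
    simp only [comm, Submonoid.coe_mul, mul_apply_eq_comp, map_sub]
    abel
  have hcc : ∀ {X : H →L[ℂ] H}, (S : H →L[ℂ] H) * X = X * S → (R : H →L[ℂ] H) * X = X * R →
      (∀ ξ ∈ D.domain, comm D S (X ξ) = B.twist X (comm D S ξ)) →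
      (∀ ξ ∈ D.domain, comm D R (X ξ) = B.twist X (comm D R ξ)) →
      ∀ ξ ∈ D.domain, comm D ((S * R : unitary (H →L[ℂ] H)) : H →L[ℂ] H) (X ξ) =
        B.twist X (comm D ((S * R : unitary (H →L[ℂ] H)) : H →L[ℂ] H) ξ) := by
    intro X h1 h2 h3 h4 ξ hξ
    have h5 : (R : H →L[ℂ] H) (X ξ) = X ((R : H →L[ℂ] H) ξ) := DFunLike.congr_fun h2 ξ
    have h6 : ∀ ζ, (S : H →L[ℂ] H) (B.twist X ζ) = B.twist X ((S : H →L[ℂ] H) ζ) :=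
      fun ζ => DFunLike.congr_fun (hS.mul_twist h1) ζ
    rw [hc, hc, h5, h3 _ (hR.dom ξ hξ), h4 ξ hξ, h6, map_add]
  obtain ⟨TS, hTS⟩ := hS.bounded
  obtain ⟨TR, hTR⟩ := hR.bounded
  refine
    { even := hcomm hS.even hR.even
      invariant := fun g => hcomm (hS.invariant g) (hR.invariant g)
      multigrading := fun i => hcomm (hS.multigrading i) (hR.multigrading i)
      clifford := fun X hX => hcomm (hS.clifford X hX) (hR.clifford X hX)
      fixed := fun a ha => hcomm (hS.fixed a ha) (hR.fixed a ha)
      algebra := fun a ha => ?_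
      algebra' := fun b hb => ?_
      dom := fun ξ hξ => hS.dom _ (hR.dom ξ hξ)
      dom' := fun ξ hξ => ?_
      bounded := ⟨TS.comp (vmap (hR.supercommIs_Dv hD)) + (S : H →L[ℂ] H).comp TR, fun ξ hξ => ?_⟩
      comm_clifford := fun X hX =>
        hcc (hS.clifford X hX) (hR.clifford X hX) (hS.comm_clifford X hX) (hR.comm_clifford X hX)
      comm_fixed := fun b hb =>
        hcc (hS.fixed b hb.2) (hR.fixed b hb.2) (hS.comm_fixed b hb) (hR.comm_fixed b hb) }
  · obtain ⟨b, hb, e⟩ := hR.algebra a ha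
    obtain ⟨c, hc, e'⟩ := hS.algebra b hb
    exact ⟨c, hc, by rw [Submonoid.coe_mul, mul_assoc, e, ← mul_assoc, e', mul_assoc]⟩
  · obtain ⟨c, hc, e'⟩ := hS.algebra' b hb
    obtain ⟨a, ha, e⟩ := hR.algebra' c hc
    exact ⟨a, ha, by rw [Submonoid.coe_mul, mul_assoc, e, ← mul_assoc, e', mul_assoc]⟩
  · rw [Submonoid.coe_mul, star_mul]
    exact hR.dom' _ (hS.dom' ξ hξ)
  · rw [B.add_evV, evV_comp_vmap _ _ (hD.dom_le hξ), evV_clm_comp _ _ (hD.dom_le hξ),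
      hTS _ (hR.dom ξ hξ), hTR ξ hξ, hc]

theorem comm_star (D : H →ₗ.[ℂ] H) (S : unitary (H →L[ℂ] H)) (ξ : H) :
    comm D (star (S : H →L[ℂ] H)) ξ =
      -star (S : H →L[ℂ] H) (comm D S (star (S : H →L[ℂ] H) ξ)) := by
  simp only [comm, map_sub, star_unitary_apply, unitary_star_apply, neg_sub]

theorem IsGauge.inv (hD : B.IsAdmissible D) (h : B.IsGauge D S) : B.IsGauge D S⁻¹ := by
  have hcc : ∀ {X : H →L[ℂ] H}, (S : H →L[ℂ] H) * X = X * S →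
      (∀ ξ ∈ D.domain, comm D S (X ξ) = B.twist X (comm D S ξ)) →
      ∀ ξ ∈ D.domain, comm D (star (S : H →L[ℂ] H)) (X ξ) =
        B.twist X (comm D (star (S : H →L[ℂ] H)) ξ) := by
    intro X h1 h3 ξ hξ
    have h5 : star (S : H →L[ℂ] H) (X ξ) = X (star (S : H →L[ℂ] H) ξ) :=
      DFunLike.congr_fun (star_unitary_commute h1) ξ
    have h6 : ∀ ζ, star (S : H →L[ℂ] H) (B.twist X ζ) = B.twist X (star (S : H →L[ℂ] H) ζ) :=
      fun ζ => DFunLike.congr_fun (star_unitary_commute (h.mul_twist h1)) ζ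
    rw [comm_star, comm_star, h5, h3 _ (h.dom' ξ hξ), h6, map_neg]
  -- Passing to the inverse interchanges the roles of `algebra` and `algebra'`.
  have hflip : ∀ {X Y : H →L[ℂ] H}, (S : H →L[ℂ] H) * X = Y * S →
      star (S : H →L[ℂ] H) * Y = X * star (S : H →L[ℂ] H) := fun {X Y} e => by
    calc star (S : H →L[ℂ] H) * Y = star (S : H →L[ℂ] H) * (Y * S) * star (S : H →L[ℂ] H) := by
          rw [mul_assoc, mul_assoc, unitary_mul_star, mul_one]
      _ = X * star (S : H →L[ℂ] H) := by
          rw [← e, ← mul_assoc, Unitary.coe_star_mul_self, one_mul]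
  have htw : B.twist (star (S : H →L[ℂ] H)) = star (S : H →L[ℂ] H) := by
    rw [twist_star, h.twist_eq]
  have hDv : B.SupercommIs B.Dv (star (S : H →L[ℂ] H)) 0 :=
    hD.supercommIs_Dv_of_commute htw (fun g => star_unitary_commute (h.invariant g))
      (fun _ => (star_unitary_commute (h.clifford _ (B.c_mem_clifford _))).symm)
      (star_unitary_commute (h.clifford _ B.cubic_mem_clifford)).symm
  obtain ⟨T, hT⟩ := h.bounded
  constructor <;> rw [coe_inv_unitary]
  · exact star_unitary_commute h.even
  · exact fun g => star_unitary_commute (h.invariant g)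
  · exact fun i => star_unitary_commute (h.multigrading i)
  · exact fun X hX => star_unitary_commute (h.clifford X hX)
  · exact fun a ha => star_unitary_commute (h.fixed a ha)
  · intro b hb
    obtain ⟨a, ha, e⟩ := h.algebra' b hb
    exact ⟨a, ha, hflip e⟩
  · intro a ha
    obtain ⟨b, hb, e⟩ := h.algebra a ha
    exact ⟨b, hb, hflip e⟩
  · exact h.dom'
  · rw [star_star]; exact h.dom
  · refine ⟨-(star (S : H →L[ℂ] H)).comp (T.comp (vmap hDv)), fun ξ hξ => ?_⟩
    rw [B.neg_evV, evV_clm_comp _ _ (hD.dom_le hξ), evV_comp_vmap _ _ (hD.dom_le hξ),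
      hT _ (h.dom' ξ hξ), comm_star]
  · exact fun X hX => hcc (h.clifford X hX) (h.comm_clifford X hX)
  · exact fun b hb => hcc (h.fixed b hb.2) (h.comm_fixed b hb)

/-- `[D + T, S] = [D, S] + [T, S]`, and `[T, S]` is bounded on `Dom D_v` because `S` acts boundedly
there. -/
theorem IsGauge.shift (hS : B.IsGauge D S) (hs : B.IsShift D E T) (hD : B.IsAdmissible D)
    (hT : B.IsPotential D T) : B.IsGauge E S := by
  have hc : ∀ ξ ∈ D.domain, comm E S ξ =
      comm D S ξ + (B.evV T ((S : H →L[ℂ] H) ξ) - (S : H →L[ℂ] H) (B.evV T ξ)) := fun ξ hξ => by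
    simp only [comm, hs.ev_eq ξ hξ, hs.ev_eq _ (hS.dom ξ hξ), map_add]
    abel
  have hcc : ∀ {X : H →L[ℂ] H}, (S : H →L[ℂ] H) * X = X * S →
      (∀ ξ ∈ D.domain, X ξ ∈ D.domain) →
      (∀ ξ ∈ D.domain, comm D S (X ξ) = B.twist X (comm D S ξ)) →
      (∀ ξ ∈ D.domain, B.evV T (X ξ) = B.twist X (B.evV T ξ)) →
      ∀ ξ ∈ E.domain, comm E S (X ξ) = B.twist X (comm E S ξ) := by
    intro X h1 h2 h3 h4 ξ hξ
    rw [hs.domain_eq] at hξ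
    have h5 : (S : H →L[ℂ] H) (X ξ) = X ((S : H →L[ℂ] H) ξ) := DFunLike.congr_fun h1 ξ
    have h6 : ∀ ζ, (S : H →L[ℂ] H) (B.twist X ζ) = B.twist X ((S : H →L[ℂ] H) ζ) :=
      fun ζ => DFunLike.congr_fun (hS.mul_twist h1) ζ
    rw [hc _ (h2 ξ hξ), hc ξ hξ, h5, h3 ξ hξ, h4 _ (hS.dom ξ hξ), h4 ξ hξ, h6, map_add, map_sub]
  obtain ⟨W, hW⟩ := hS.bounded
  exact
    { even := hS.even
      invariant := hS.invariant
      multigrading := hS.multigrading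
      clifford := hS.clifford
      fixed := hS.fixed
      algebra := hS.algebra
      algebra' := hS.algebra'
      dom := hs.domain_eq ▸ hS.dom
      dom' := hs.domain_eq ▸ hS.dom'
      bounded := by
        refine ⟨W + (T.comp (vmap (hS.supercommIs_Dv hD)) + -(S : H →L[ℂ] H).comp T),
          fun ξ hξ => ?_⟩
        rw [hs.domain_eq] at hξ
        rw [B.add_evV, B.add_evV, B.neg_evV, evV_comp_vmap _ _ (hD.dom_le hξ),
          evV_clm_comp _ _ (hD.dom_le hξ), hc ξ hξ, hW ξ hξ, sub_eq_add_neg]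
      comm_clifford := fun X hX => hcc (hS.clifford X hX) (fun ξ hξ => hD.clifford_mem hX hξ)
        (hS.comm_clifford X hX) (hT.clifford X hX)
      comm_fixed := fun b hb => hcc (hS.fixed b hb.2) (fun ξ hξ => hD.π_mem hb.1 hξ)
        (hS.comm_fixed b hb) (hT.fixed b hb) }

/-! ### Conjugation by gauge transformations -/

theorem IsGauge.comm_star_fixed (hD : B.IsAdmissible D) (h : B.IsGauge D S) {b : A}
    (hb : B.FixedA b) {ξ : H} (hξ : ξ ∈ D.domain) :
    comm D (star (S : H →L[ℂ] H)) (B.R.π b ξ) =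
      B.twist (B.R.π b) (comm D (star (S : H →L[ℂ] H)) ξ) := by
  have := (h.inv hD).comm_fixed b hb ξ hξ
  rwa [coe_inv_unitary] at this

theorem IsGauge.conj_mem_oneForms (hD : B.IsAdmissible D) (h : B.IsGauge D S) {K : H →L[ℂ] H}
    (hK : K ∈ B.oneForms D) :
    (S : H →L[ℂ] H) * K * star (S : H →L[ℂ] H) ∈ B.oneForms D := by
  have hle : B.oneForms D ≤ (B.oneForms D).comap
      (LinearMap.mulLeftRight ℂ ((S : H →L[ℂ] H), star (S : H →L[ℂ] H))) := by
    refine Submodule.topologicalClosure_minimal _ (Submodule.span_le.2 ?_) ?_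
    · rintro X ⟨a, b, K, hb, hK, rfl⟩
      have hSb := h.fixed b hb.2
      -- `K = [D, b]` is invariant under conjugation: `S[D, b]S* = [S D S*, b] = [D, b] + [S[D, S*],
      -- b]`, and the last term vanishes because `S[D, S*]` supercommutes with `b`.
      have hK' : (S : H →L[ℂ] H) * K * star (S : H →L[ℂ] H) = K := by
        refine ContinuousLinearMap.ext fun ξ => ?_
        refine congrFun (Continuous.ext_on hD.triple.dense
          ((S : H →L[ℂ] H) * K * star (S : H →L[ℂ] H)).continuous K.continuous
          fun ξ hξ => ?_) ξ
        have hζ := h.dom' ξ hξ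
        have h1 : star (S : H →L[ℂ] H) (B.R.π b ξ) = B.R.π b (star (S : H →L[ℂ] H) ξ) :=
          DFunLike.congr_fun (star_unitary_commute hSb) ξ
        have h2 : ∀ ζ, (S : H →L[ℂ] H) (B.twist (B.R.π b) ζ) =
            B.twist (B.R.π b) ((S : H →L[ℂ] H) ζ) :=
          fun ζ => DFunLike.congr_fun (h.mul_twist hSb) ζ
        have hbξ := hD.π_mem hb.1 hξ
        change (S : H →L[ℂ] H) (K (star (S : H →L[ℂ] H) ξ)) = K ξ
        rw [← (hK _ hζ).2, ← h1, map_sub, h2, ← NCGauge.ev_conj (h.dom' _ hbξ),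
          ← NCGauge.ev_conj hζ, h.ev_conj hξ, h.ev_conj hbξ, h.comm_star_fixed hD hb hξ, h2,
          ← (hK ξ hξ).2, map_add]
        abel
      -- Conjugation by `S` is only known to preserve `𝒜`; density of `𝒜` and closedness of the
      -- one-forms extend the membership to all of `A`.
      have key : ∀ a : A, (S : H →L[ℂ] H) * B.R.π a * star (S : H →L[ℂ] H) * K ∈
          B.oneForms D := by
        intro a
        have hc : IsClosed {a : A | (S : H →L[ℂ] H) * B.R.π a * star (S : H →L[ℂ] H) * K ∈
            B.oneForms D} := (Submodule.isClosed_topologicalClosure _).preimage (by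
          have := B.continuous_π
          fun_prop)
        refine hc.closure_subset_iff.2 ?_ (B.𝒜_dense a)
        intro a ha
        obtain ⟨c, -, e⟩ := h.algebra a ha
        change (S : H →L[ℂ] H) * B.R.π a * star (S : H →L[ℂ] H) * K ∈ B.oneForms D
        rw [e, mul_assoc (B.R.π c), unitary_mul_star, mul_one]
        exact Submodule.le_topologicalClosure _ (Submodule.subset_span ⟨c, b, K, hb, hK, rfl⟩)
      have e : (S : H →L[ℂ] H) * (B.R.π a * K) * star (S : H →L[ℂ] H) =
          (S : H →L[ℂ] H) * B.R.π a * star (S : H →L[ℂ] H) * K := by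
        conv_rhs => rw [← hK']
        simp only [mul_assoc]
        rw [← mul_assoc (star (S : H →L[ℂ] H)) (S : H →L[ℂ] H), Unitary.coe_star_mul_self,
          one_mul]
      change (S : H →L[ℂ] H) * (B.R.π a * K) * star (S : H →L[ℂ] H) ∈ B.oneForms D
      rw [e]
      exact key a
    · refine (Submodule.isClosed_topologicalClosure _).preimage ?_
      change Continuous fun K => (S : H →L[ℂ] H) * K * star (S : H →L[ℂ] H)
      fun_prop
  exact hle hK

/-- The potential is `S[D, S*]`. Its symmetry, parity and invariance are read off from the form `S D
S* - D`, its supercommutation with the Clifford algebra and `𝒜^G` from `S[D, S*]`. -/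
theorem IsGauge.exists_isShift (hD : B.IsAdmissible D) (h : B.IsGauge D S) :
    ∃ T, B.IsPotential D T ∧ B.IsShift D (conj S D) T := by
  have hi := h.inv hD
  obtain ⟨W, hW⟩ := hi.bounded
  have hcl := hi.comm_clifford
  rw [coe_inv_unitary] at hW hcl
  have hev : ∀ ξ ∈ D.domain, B.evV ((S : H →L[ℂ] H).comp W) ξ =
      ev (conj S D) ξ - ev D ξ := fun ξ hξ => by
    rw [evV_clm_comp _ _ (hD.dom_le hξ), hW ξ hξ, h.ev_conj hξ, add_sub_cancel_left]
  have hev' : ∀ ξ ∈ D.domain, B.evV ((S : H →L[ℂ] H).comp W) ξ =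
      (S : H →L[ℂ] H) (comm D (star (S : H →L[ℂ] H)) ξ) := fun ξ hξ => by
    rw [evV_clm_comp _ _ (hD.dom_le hξ), hW ξ hξ]
  have hdom : (conj S D).domain = D.domain := by
    ext ξ
    rw [mem_conj_domain]
    refine ⟨fun hξ => ?_, h.dom' ξ⟩
    have := h.dom _ hξ
    rwa [unitary_star_apply] at this
  have hcj : ∀ ξ ∈ D.domain, ev (conj S D) ξ =
      (S : H →L[ℂ] H) (ev D (star (S : H →L[ℂ] H) ξ)) := fun ξ hξ =>
    NCGauge.ev_conj (h.dom' ξ hξ)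
  have ap : ∀ {X : H →L[ℂ] H}, (S : H →L[ℂ] H) * X = X * S → ∀ ζ,
      (S : H →L[ℂ] H) (X ζ) = X ((S : H →L[ℂ] H) ζ) := fun e ζ => DFunLike.congr_fun e ζ
  have ap' : ∀ {X : H →L[ℂ] H}, (S : H →L[ℂ] H) * X = X * S → ∀ ζ,
      star (S : H →L[ℂ] H) (X ζ) = X (star (S : H →L[ℂ] H) ζ) := fun e ζ =>
    DFunLike.congr_fun (star_unitary_commute e) ζ
  refine ⟨(S : H →L[ℂ] H).comp W, ⟨fun ξ hξ => ?_, fun i ξ hξ => ?_, fun ξ hξ η hη => ?_,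
    fun g ξ hξ => ?_, fun X hX ξ hξ => ?_, fun b hb ξ hξ => ?_, fun a ha => ?_⟩,
    hdom, fun ξ hξ => by rw [hev ξ hξ, add_sub_cancel]⟩
  · have h1 := hD.triple.nodd.1 ξ hξ
    have h2 := hD.triple.nodd.1 _ (h.dom' ξ hξ)
    rw [hev _ h1.1, hev ξ hξ, hcj _ h1.1, hcj ξ hξ, ap' h.even, h2.2, h1.2, map_neg, ap h.even,
      map_sub]
    abel
  · have h1 := hD.triple.nodd.2 i ξ hξ
    have h2 := hD.triple.nodd.2 i _ (h.dom' ξ hξ)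
    rw [hev _ h1.1, hev ξ hξ, hcj _ h1.1, hcj ξ hξ, ap' (h.multigrading i), h2.2, h1.2,
      ap (h.mul_twist (h.multigrading i)), map_sub]
  · rw [hev ξ hξ, hev η hη, hcj ξ hξ, hcj η hη, inner_sub_left, inner_sub_right, inner_unitary,
      hD.symm _ (h.dom' ξ hξ) _ (h.dom' η hη), hD.symm ξ hξ η hη, inner_star_unitary]
  · have h1 := hD.triple.invariant g ξ hξ
    have h2 := hD.triple.invariant g _ (h.dom' ξ hξ)
    rw [hev _ h1.1, hev ξ hξ, hcj _ h1.1, hcj ξ hξ, ap' (h.invariant g), h2.2, h1.2,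
      ap (h.invariant g), map_sub]
  · rw [hev' _ (hD.clifford_mem hX hξ), hev' ξ hξ, hcl X hX ξ hξ,
      ap (h.mul_twist (h.clifford X hX))]
  · rw [hev' _ (hD.π_mem hb.1 hξ), hev' ξ hξ, h.comm_star_fixed hD hb hξ,
      ap (h.mul_twist (h.fixed b hb.2))]
  -- With `a = S a' S*` the commutator is `S[D, a']S* - [D, a]`. Since `D_v` commutes with `S`, this
  -- equals `S[D_h, a']S* - [D_h, a]`, a difference of one-forms.
  · obtain ⟨a', ha', e⟩ := h.algebra' a ha
    obtain ⟨K, hK, h1⟩ := hD.principal.horizontal a ha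
    obtain ⟨L, hL, h2⟩ := hD.principal.horizontal a' ha'
    refine ⟨(S : H →L[ℂ] H) * L * star (S : H →L[ℂ] H) - K,
      sub_mem (h.conj_mem_oneForms hD hL) hK, fun ξ hξ => ?_⟩
    set ζ := star (S : H →L[ℂ] H) ξ with hζ
    have hζD : ζ ∈ D.domain := h.dom' ξ hξ
    have hSζ : (S : H →L[ℂ] H) ζ = ξ := unitary_star_apply S ξ
    have haξ := hD.π_mem ha hξ
    have haζ := hD.π_mem ha' hζD
    have e1 : ∀ x, (S : H →L[ℂ] H) (B.R.π a' x) = B.R.π a ((S : H →L[ℂ] H) x) :=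
      fun x => DFunLike.congr_fun e x
    have e2 : ∀ x, (S : H →L[ℂ] H) (B.twist (B.R.π a') x) =
        B.twist (B.R.π a) ((S : H →L[ℂ] H) x) := fun x => DFunLike.congr_fun (h.mul_twist e) x
    have e3 : star (S : H →L[ℂ] H) (B.R.π a ξ) = B.R.π a' ζ := by
      rw [← hSζ, ← e1, star_unitary_apply]
    have hv : ∀ x ∈ B.Dv.domain, (S : H →L[ℂ] H) (ev B.Dv x) = ev B.Dv ((S : H →L[ℂ] H) x) :=
      fun x hx => by
        have := (h.supercommIs_Dv hD x hx).2
        rw [h.twist_eq, zero_apply, sub_eq_zero] at this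
        exact this.symm
    have h3 := (h1 ξ (ev_Dh hD.dom_le hξ).1).2
    have h4 := (h2 ζ (ev_Dh hD.dom_le hζD).1).2
    rw [(ev_Dh hD.dom_le hξ).2, (ev_Dh hD.dom_le haξ).2] at h3
    rw [(ev_Dh hD.dom_le hζD).2, (ev_Dh hD.dom_le haζ).2] at h4
    change _ = (S : H →L[ℂ] H) (L ζ) - K ξ
    rw [← h3, ← h4, hev _ haξ, hev ξ hξ, hcj _ haξ, hcj ξ hξ, e3]
    simp only [map_sub, e2, hv _ (hD.dom_le haζ), hv _ (hD.dom_le hζD), e1, hSζ, ← hζ]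
    abel

end Background

end NCGauge

end

noncomputable section

namespace NCGauge

namespace Background

variable {m n : ℕ} {G A H : Type*} [TopologicalSpace G]
  [ChartedSpace (EuclideanSpace ℝ (Fin m)) G] [Group G]
  [CStarAlgebra A] [PartialOrder A] [StarOrderedRing A]
  [NormedAddCommGroup H] [InnerProductSpace ℂ H] [CompleteSpace H]
  {B : Background m n G A H} [LieGroup (𝓡 m) ∞ G] {D E D₀ : H →ₗ.[ℂ] H} {T : B.VDom →L[ℂ] H}
  {S R : unitary (H →L[ℂ] H)}

/-! ### The gauge group and its action on the Atiyah space -/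

/-- The gauge group. -/
def gaugeGroup (hD₀ : B.IsAdmissible D₀) : Subgroup (unitary (H →L[ℂ] H)) where
  carrier := {S | B.IsGauge D₀ S}
  one_mem' := IsGauge.one D₀
  mul_mem' hS hR := IsGauge.mul hD₀ hS hR
  inv_mem' hS := IsGauge.inv hD₀ hS

theorem Atiyah.isGauge_iff (hD₀ : B.IsAdmissible D₀) (D : B.Atiyah D₀) :
    B.IsGauge D.1 S ↔ B.IsGauge D₀ S := by
  have hs := isShift_atiyahEquiv hD₀ D
  have hT := (atiyahEquiv hD₀ D).2
  refine ⟨fun h => h.shift hs.reverse D.2.1 ?_, fun h => h.shift hs hD₀ hT⟩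
  exact (Atiyah.isPotential_iff hD₀ D).2 ((B.potentials D₀).neg_mem hT)

theorem Atiyah.conj_mem (hD₀ : B.IsAdmissible D₀) (hS : B.IsGauge D₀ S) (D : B.Atiyah D₀) :
    B.IsAdmissible (conj S D.1) ∧ B.GaugeComparable D₀ (conj S D.1) := by
  obtain ⟨T, hT, hs⟩ := ((Atiyah.isGauge_iff hD₀ D).2 hS).exists_isShift D.2.1
  have hT' := (B.potentials D₀).add_mem (atiyahEquiv hD₀ D).2 ((Atiyah.isPotential_iff hD₀ D).1 hT)
  have hs' := (isShift_atiyahEquiv hD₀ D).trans hs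
  exact ⟨hs'.isAdmissible hD₀ hT', hs'.gaugeComparable hD₀ hT'⟩

/-- The gauge action on the Atiyah space. -/
abbrev gaugeAction (hD₀ : B.IsAdmissible D₀) : MulAction (gaugeGroup hD₀) (B.Atiyah D₀) where
  smul S D := ⟨conj S.1 D.1, Atiyah.conj_mem hD₀ S.2 D⟩
  one_smul D := Subtype.ext (conj_one D.1)
  mul_smul S R D := Subtype.ext (conj_mul S.1 R.1 D.1)

/-- The gauge action on the Atiyah space, as a function. -/
def conjAtiyah (hD₀ : B.IsAdmissible D₀) (S : gaugeGroup hD₀) (D : B.Atiyah D₀) : B.Atiyah D₀ :=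
  ⟨conj S.1 D.1, Atiyah.conj_mem hD₀ S.2 D⟩

theorem supercommIs_star_Dv (hD₀ : B.IsAdmissible D₀) (S : gaugeGroup hD₀) :
    B.SupercommIs B.Dv (star (S.1 : H →L[ℂ] H)) 0 := by
  have := IsGauge.supercommIs_Dv (IsGauge.inv hD₀ S.2) hD₀
  rwa [coe_inv_unitary] at this

theorem ev_sub_conjAtiyah (hD₀ : B.IsAdmissible D₀) (S : gaugeGroup hD₀) (D E : B.Atiyah D₀) :
    (atiyahEquiv hD₀ (conjAtiyah hD₀ S D) - atiyahEquiv hD₀ (conjAtiyah hD₀ S E) :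
      B.potentials D₀).1 = (S.1 : H →L[ℂ] H).comp
        ((atiyahEquiv hD₀ D - atiyahEquiv hD₀ E : B.potentials D₀).1.comp
          (vmap (supercommIs_star_Dv hD₀ S))) := by
  refine hD₀.ext_VDom fun ξ hξ => ?_
  have hS : B.IsGauge D₀ S.1 := S.2
  have h1 := hS.dom' ξ hξ
  have hdom : ∀ (F : B.Atiyah D₀), ∀ x ∈ D₀.domain, x ∈ F.1.domain := fun F x hx => by
    rwa [Atiyah.domain_eq hD₀ F]
  have h2 := (Atiyah.isShift_sub hD₀ (conjAtiyah hD₀ S D) (conjAtiyah hD₀ S E)).ev_eq ξ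
    (hdom _ ξ hξ)
  have h3 := (Atiyah.isShift_sub hD₀ D E).ev_eq _ (hdom E _ h1)
  have h4 : ev (conjAtiyah hD₀ S D).1 ξ = _ := ev_conj (S := S.1) (hdom D _ h1)
  have h5 : ev (conjAtiyah hD₀ S E).1 ξ = _ := ev_conj (S := S.1) (hdom E _ h1)
  rw [h4, h5, h3, map_add] at h2
  rw [evV_clm_comp _ _ (hD₀.dom_le hξ), evV_comp_vmap _ _ (hD₀.dom_le hξ)]
  exact (add_left_cancel h2).symm

/-- Every potential is a difference of two points of the Atiyah space, and conjugation preserves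
that space, so none of the defining conditions has to be checked. -/
theorem conj_mem_potentials (hD₀ : B.IsAdmissible D₀) (S : gaugeGroup hD₀)
    (T : B.potentials D₀) :
    (S.1 : H →L[ℂ] H).comp (T.1.comp (vmap (supercommIs_star_Dv hD₀ S))) ∈ B.potentials D₀ := by
  have h := ev_sub_conjAtiyah hD₀ S ((atiyahEquiv hD₀).symm T) ((atiyahEquiv hD₀).symm 0)
  rw [Equiv.apply_symm_apply, Equiv.apply_symm_apply, sub_zero] at h
  rw [← h]
  exact Submodule.coe_mem _

/-- The linear gauge action `T ↦ S T S*` on relative gauge potentials. -/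
def gaugeLin (hD₀ : B.IsAdmissible D₀) (S : gaugeGroup hD₀) :
    B.potentials D₀ →ₗ[ℝ] B.potentials D₀ where
  toFun T := ⟨_, conj_mem_potentials hD₀ S T⟩
  map_add' _ _ := Subtype.ext (ContinuousLinearMap.ext fun _ => map_add (S.1 : H →L[ℂ] H) _ _)
  map_smul' s T := Subtype.ext (ContinuousLinearMap.ext fun x =>
    map_smul (S.1 : H →L[ℂ] H) (s : ℂ) (T.1 (vmap (supercommIs_star_Dv hD₀ S) x)))

theorem gaugeLin_apply (hD₀ : B.IsAdmissible D₀) (S : gaugeGroup hD₀) (T : B.potentials D₀)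
    (x : B.VDom) : (gaugeLin hD₀ S T).1 x =
      (S.1 : H →L[ℂ] H) (T.1 (vmap (supercommIs_star_Dv hD₀ S) x)) := rfl

theorem sub_conjAtiyah (hD₀ : B.IsAdmissible D₀) (S : gaugeGroup hD₀) (D E : B.Atiyah D₀) :
    atiyahEquiv hD₀ (conjAtiyah hD₀ S D) - atiyahEquiv hD₀ (conjAtiyah hD₀ S E) =
      gaugeLin hD₀ S (atiyahEquiv hD₀ D - atiyahEquiv hD₀ E) :=
  Subtype.ext (ev_sub_conjAtiyah hD₀ S D E)

theorem gaugeLin_inv (hD₀ : B.IsAdmissible D₀) (S : gaugeGroup hD₀) (T : B.potentials D₀) :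
    gaugeLin hD₀ S (gaugeLin hD₀ S⁻¹ T) = T := by
  refine Subtype.ext (ContinuousLinearMap.ext fun x => ?_)
  rw [gaugeLin_apply, gaugeLin_apply]
  have h1 : ((S⁻¹ : gaugeGroup hD₀).1 : H →L[ℂ] H) = star (S.1 : H →L[ℂ] H) :=
    coe_inv_unitary S.1
  have h2 : vmap (supercommIs_star_Dv hD₀ S⁻¹) (vmap (supercommIs_star_Dv hD₀ S) x) = x := by
    refine VDom.ext ?_
    rw [incl_vmap, incl_vmap, h1, star_star, unitary_star_apply]
  rw [h2, h1, unitary_star_apply]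

/-- `S*` is unitary on `H` and commutes with `D_v`, so it preserves both terms of the graph norm. -/
theorem norm_vmap_star (hD₀ : B.IsAdmissible D₀) (S : gaugeGroup hD₀) (x : B.VDom) :
    ‖vmap (supercommIs_star_Dv hD₀ S) x‖ = ‖x‖ := by
  have hS : B.IsGauge D₀ S.1 := S.2
  have hn : ∀ ζ : H, ‖star (S.1 : H →L[ℂ] H) ζ‖ = ‖ζ‖ := fun ζ => by
    have := norm_unitary_apply S.1⁻¹ ζ
    rwa [coe_inv_unitary] at this
  have h1 := (supercommIs_star_Dv hD₀ S _ (B.incl_mem x)).2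
  rw [twist_star, hS.twist_eq, zero_apply, sub_eq_zero] at h1
  refine (pow_left_inj₀ (norm_nonneg _) (norm_nonneg _) two_ne_zero).1 ?_
  rw [norm_sq_VDom, norm_sq_VDom, incl_vmap, h1, hn, hn]

theorem norm_gaugeLin_le (hD₀ : B.IsAdmissible D₀) (S : gaugeGroup hD₀) (T : B.potentials D₀) :
    ‖gaugeLin hD₀ S T‖ ≤ ‖T‖ := by
  refine ContinuousLinearMap.opNorm_le_bound _ (norm_nonneg _) fun x => ?_
  change ‖(gaugeLin hD₀ S T).1 x‖ ≤ ‖T.1‖ * ‖x‖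
  rw [gaugeLin_apply, norm_unitary_apply, ← norm_vmap_star hD₀ S x]
  exact T.1.le_opNorm _

/-- The linear gauge action as a group of linear isometries. -/
def gaugeLinIsometry (hD₀ : B.IsAdmissible D₀) (S : gaugeGroup hD₀) :
    B.potentials D₀ ≃ₗᵢ[ℝ] B.potentials D₀ where
  toLinearEquiv := LinearEquiv.ofLinearMap (gaugeLin hD₀ S) (gaugeLin hD₀ S⁻¹)
    (LinearMap.ext fun T => gaugeLin_inv hD₀ S T)
    (LinearMap.ext fun T => by
      have := gaugeLin_inv hD₀ S⁻¹ T
      rwa [inv_inv] at this)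
  norm_map' T := by
    refine le_antisymm (norm_gaugeLin_le hD₀ S T) ?_
    have h := norm_gaugeLin_le hD₀ S⁻¹ (gaugeLin hD₀ S T)
    have h' := gaugeLin_inv hD₀ S⁻¹ T
    rw [inv_inv] at h'
    rwa [h'] at h

/-- The affine gauge action on relative gauge potentials with origin `D`. -/
def gaugeAffine (hD₀ : B.IsAdmissible D₀) (D : B.Atiyah D₀) (S : gaugeGroup hD₀) :
    B.potentials D₀ ≃ᵃⁱ[ℝ] B.potentials D₀ :=
  AffineIsometryEquiv.mk' (fun T => gaugeLin hD₀ S T +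
    (atiyahEquiv hD₀ (conjAtiyah hD₀ S D) - atiyahEquiv hD₀ D)) (gaugeLinIsometry hD₀ S) 0
    fun T => by
      rw [vsub_eq_sub, sub_zero, vadd_eq_add, map_zero, zero_add]
      rfl

theorem gaugeAffine_apply (hD₀ : B.IsAdmissible D₀) (D : B.Atiyah D₀) (S : gaugeGroup hD₀)
    (T : B.potentials D₀) : gaugeAffine hD₀ D S T = gaugeLin hD₀ S T +
      (atiyahEquiv hD₀ (conjAtiyah hD₀ S D) - atiyahEquiv hD₀ D) := rfl

/-- `S E S* - D` splits as `S(E - D)S* + (S D S* - D)`: linear part plus translation. -/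
theorem gaugeAffine_sub (hD₀ : B.IsAdmissible D₀) (D E : B.Atiyah D₀) (S : gaugeGroup hD₀) :
    gaugeAffine hD₀ D S (atiyahEquiv hD₀ E - atiyahEquiv hD₀ D) =
      atiyahEquiv hD₀ (conjAtiyah hD₀ S E) - atiyahEquiv hD₀ D := by
  rw [gaugeAffine_apply, ← sub_conjAtiyah, sub_add_sub_cancel]

theorem exists_sub_eq (hD₀ : B.IsAdmissible D₀) (D : B.Atiyah D₀) (T : B.potentials D₀) :
    ∃ E, atiyahEquiv hD₀ E - atiyahEquiv hD₀ D = T :=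
  ⟨(atiyahEquiv hD₀).symm (T + atiyahEquiv hD₀ D), by
    rw [Equiv.apply_symm_apply, add_sub_cancel_right]⟩

/-- The affine gauge action as a homomorphism. -/
def gaugeAffineHom (hD₀ : B.IsAdmissible D₀) (D : B.Atiyah D₀) :
    gaugeGroup hD₀ →* (B.potentials D₀ ≃ᵃⁱ[ℝ] B.potentials D₀) where
  toFun := gaugeAffine hD₀ D
  map_one' := by
    refine AffineIsometryEquiv.ext fun T => ?_
    -- Every potential has the form `E - D`, so the homomorphism laws are inherited from conjugation
    -- on the Atiyah space.
    obtain ⟨E, rfl⟩ := exists_sub_eq hD₀ D T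
    have h : conjAtiyah hD₀ 1 E = E := Subtype.ext (conj_one E.1)
    rw [gaugeAffine_sub, h]; rfl
  map_mul' S R := by
    refine AffineIsometryEquiv.ext fun T => ?_
    obtain ⟨E, rfl⟩ := exists_sub_eq hD₀ D T
    have h : conjAtiyah hD₀ (S * R) E = conjAtiyah hD₀ S (conjAtiyah hD₀ R E) :=
      Subtype.ext (conj_mul S.1 R.1 E.1)
    rw [AffineIsometryEquiv.coe_mul, Function.comp_apply, gaugeAffine_sub, gaugeAffine_sub,
      gaugeAffine_sub, h]

theorem gaugeAffine_apply_apply (hD₀ : B.IsAdmissible D₀) (D : B.Atiyah D₀) (S : gaugeGroup hD₀)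
    (T : B.potentials D₀) (x : B.VDom) (hx : B.incl x ∈ D.1.domain) :
    ∃ y : B.VDom, B.incl y = star (S.1 : H →L[ℂ] H) (B.incl x) ∧ B.incl y ∈ D.1.domain ∧
      (gaugeAffine hD₀ D S T).1 x =
        (S.1 : H →L[ℂ] H) (comm D.1 (star (S.1 : H →L[ℂ] H)) (B.incl x)) +
          (S.1 : H →L[ℂ] H) (T.1 y) := by
  have hS : B.IsGauge D.1 S.1 := (Atiyah.isGauge_iff hD₀ D).2 S.2
  refine ⟨vmap (supercommIs_star_Dv hD₀ S) x, rfl, hS.dom' _ hx, ?_⟩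
  have h := (Atiyah.isShift_sub hD₀ (conjAtiyah hD₀ S D) D).ev_eq _ hx
  have h1 : ev (conjAtiyah hD₀ S D).1 (B.incl x) = _ := hS.ev_conj hx
  rw [h1] at h
  rw [add_left_cancel h, evV_incl, gaugeAffine_apply, Submodule.coe_add, add_apply, add_comm]
  rfl

end Background

end NCGauge

end

/-! ### The theorem. -/

theorem mainTheorem6 {m n : ℕ} {G A H : Type*}
    [TopologicalSpace G] [ChartedSpace (EuclideanSpace ℝ (Fin m)) G] [Group G]
    [LieGroup (𝓡 m) ∞ G] [T2Space G] [CompactSpace G] [ConnectedSpace G]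
    [CStarAlgebra A] [PartialOrder A] [StarOrderedRing A]
    [NormedAddCommGroup H] [InnerProductSpace ℂ H] [CompleteSpace H]
    (B : NCGauge.Background m n G A H) (D₀ : H →ₗ.[ℂ] H) (hD₀ : B.IsAdmissible D₀) :
    ∃ (pot : Submodule ℝ (B.VDom →L[ℂ] H)) (𝔊 : Subgroup (unitary (H →L[ℂ] H))),
      -- `pot` is the space of relative gauge potentials of each `D`, each of them being identified
      -- with its unique bounded extension to `Dom D_v`
      (∀ (D : B.Atiyah D₀) (θ : H →ₗ.[ℂ] H), B.IsRelGaugePotential D.1 θ →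
        ∃! T, B.ExtendsTo θ.domain (NCGauge.ev θ) T) ∧
      (∀ (D : B.Atiyah D₀) (T : B.VDom →L[ℂ] H), T ∈ pot ↔
        ∃ θ, B.IsRelGaugePotential D.1 θ ∧ B.ExtendsTo θ.domain (NCGauge.ev θ) T) ∧
      -- the topology of its seminorms `‖θ φ_k‖` is that of the operator norm
      ((inferInstance : TopologicalSpace pot) = ⨅ k, TopologicalSpace.induced
        (fun θ : pot => B.extension B.Dv.domain fun ξ => B.evV θ.1 (B.R.π (B.φ k) ξ))
        inferInstance) ∧
      -- `𝔊` is the group of gauge transformations of each `D`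
      (∀ (D : B.Atiyah D₀) (S : unitary (H →L[ℂ] H)),
        S ∈ 𝔊 ↔ B.IsGaugeTransformation D.1 S) ∧
      -- affine structure, and the gauge action
      ∃ (_ : AddTorsor pot (B.Atiyah D₀)) (_ : IsTopologicalAddTorsor (B.Atiyah D₀))
        (_ : MulAction 𝔊 (B.Atiyah D₀)),
        (∀ (D₁ D₂ : B.Atiyah D₀) (ξ : B.VDom),
          ∃ h : B.incl ξ ∈ (D₁.1 - D₂.1).closure.domain,
            (D₁ -ᵥ D₂ : pot).1 ξ = (D₁.1 - D₂.1).closure ⟨B.incl ξ, h⟩) ∧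
        (∀ (S : 𝔊) (D : B.Atiyah D₀), (S • D).1 = NCGauge.conj S.1 D.1) ∧
        ∀ D : B.Atiyah D₀,
          IsHomeomorph (fun D' : B.Atiyah D₀ => (D' -ᵥ D : pot)) ∧
          ∃ act : 𝔊 →* (pot ≃ᵃⁱ[ℝ] pot),
            (∀ (S : 𝔊) (θ : pot) (ξ : B.VDom), B.incl ξ ∈ D.1.domain →
              ∃ η : B.VDom, B.incl η = star (S.1 : H →L[ℂ] H) (B.incl ξ) ∧
                B.incl η ∈ D.1.domain ∧
                (act S θ).1 ξ =
                  (S.1 : H →L[ℂ] H) (NCGauge.comm D.1 (star (S.1 : H →L[ℂ] H)) (B.incl ξ))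
                    + (S.1 : H →L[ℂ] H) (θ.1 η)) ∧
            ∀ (S : 𝔊) (D' : B.Atiyah D₀), (S • D' -ᵥ D : pot) = act S (D' -ᵥ D) := by
  have hdiff : ∀ (D₁ D₂ : B.Atiyah D₀) (ξ : B.VDom),
      ∃ h : B.incl ξ ∈ (D₁.1 - D₂.1).closure.domain,
        (NCGauge.Background.atiyahEquiv hD₀ D₁ - NCGauge.Background.atiyahEquiv hD₀ D₂ :
          B.potentials D₀).1 ξ = (D₁.1 - D₂.1).closure ⟨B.incl ξ, h⟩ := fun D₁ D₂ ξ =>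
    (NCGauge.Background.Atiyah.isShift_sub hD₀ D₁ D₂).closure_sub D₂.2.1
      ((NCGauge.Background.Atiyah.isPotential_iff hD₀ D₂).2 (Submodule.coe_mem _)) ξ
  refine ⟨B.potentials D₀, NCGauge.Background.gaugeGroup hD₀,
    fun D θ hθ => D.2.1.existsUnique_extension hθ, fun D T => ?_, ?_, fun D S => ?_,
    NCGauge.Background.atiyahTorsor hD₀, NCGauge.Background.isTopologicalAddTorsor_atiyah hD₀,
    NCGauge.Background.gaugeAction hD₀, hdiff, fun S D => rfl, fun D =>
    ⟨NCGauge.Background.isHomeomorph_sub hD₀ D, NCGauge.Background.gaugeAffineHom hD₀ D,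
      fun S θ ξ hξ => NCGauge.Background.gaugeAffine_apply_apply hD₀ D S θ ξ hξ,
      fun S D' => (NCGauge.Background.gaugeAffine_sub hD₀ D D' S).symm⟩⟩
  · rw [← D.2.1.isPotential_iff]
    exact (NCGauge.Background.Atiyah.isPotential_iff hD₀ D).symm
  · simp only [NCGauge.Background.extension_evV_φ hD₀]
    exact NCGauge.Background.potentials_topology hD₀
  · rw [NCGauge.Background.isGauge_iff D.2.1, NCGauge.Background.Atiyah.isGauge_iff hD₀ D]
    rfl
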